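/- Let $n\ge 2$ and let $c$ be a Coxeter element of the affine symmetric group $\widehat{\mathfrak S}_n$ (a product, in some order, of the simple reflections $s_0,\dots,s_{n-1}$, each used once, where $s_i$ exchanges $i+pn$ and $i+1+pn$ for all $p\in\mathbb Z$). Put $\overline{L_c}=\{i\in\mathbb Z: c(i)>i\}$ and $\overline{R_c}=\{i\in\mathbb Z: c(i)<i\}$. **TITOs.** A TITO is a strict total order $\prec$ on $\mathbb Z$ with $x\prec y\Leftrightarrow x+n\prec y+n$ such that $x+n\prec x$ is never a cover relation. Its blocks are the classes of integers at finite distance for $\prec$; a block is *waxing* if $x\prec x+n$ on it and *waning* if $x+n\prec x$ on it. A window notation $[\cdot]$ (waxing) or $\underline{[\cdot]}$ (waning) lists a block by concatenating the translates by multiples of $n$ of a finite word. A TITO is *$c$-sortable* if (1) it is a single waxing block, or it consists of a waxing block $L$, a waning block $M$, a waxing block $R$, in this order ($L$, $R$ possibly empty), with $L\subset\overline{L_c}$, $R\subset\overline{R_c}$, $M\cap\overline{L_c}\ne\emptyset\ne M\cap\overline{R_c}$; and (2) there are no $i<j<k$ with $k\prec i\prec j$ and $j\in\overline{L_c}$,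 or with $j\prec k\prec i$ and $j\in\overline{R_c}$. **Arc diagrams.** An arc is $(p,q,L,R)$ with $p<q$ integers and $L\sqcup R=\{p+1,\dots,q-1\}$. Two distinct arcs $(p,q,L,R)$, $(p',q',L',R')$ intersect if $p=p'$, or $q=q'$, or both $((L\cup\{p,q\})\cap R')\cup(L\cap\{p',q'\})\neq\emptyset$ and $(R\cap(L'\cup\{p',q'\}))\cup(\{p,q\}\cap L')\ne\emptyset$. A *cyclic noncrossing arc diagram* is a set $\mathcal A$ of pairwise nonintersecting arcs invariant under translation by $n$. We write $p\to q$ if $\mathcal A$ has an arc from $p$ to $q$. A *chain* is a sequence $x_1\to\dots\to x_k$ ($k\ge1$) with no arc ending at $x_1$ and no arc starting at $x_k$; a *loop* is a bi-infinite sequence $\cdots\to x_i\to x_{i+1}\to\cdots$; both are identified with their supports. The diagram is a *cyclic $c$-noncrossing arc diagram* if $L\subset\overline{L_c}$ and $R\subset\overline{R_c}$ for each arc, and no loop has its support contained in $\overline{L_c}$ or in $\overline{R_c}$. **The map $\widetilde{\mathrm{ncad}}$.** $\widetilde{\mathrm{ncad}}(\prec)$ is the set of arcs $(p,q,L,R)$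 for all $p<q$ such that $q\prec p$ is a cover relation, with $L=\{i: p<i<q,\ i\prec q\}$ and $R=\{i: p<i<q,\ p\prec i\}$. **The sequence $\mathcal C_a(\mathcal A)$.** Let $\mathcal A$ be a cyclic $c$-noncrossing arc diagram. For $b\in\mathbb Z$ let $X\in\{\overline{L_c},\overline{R_c}\}$ contain $b$. Among the arcs $p\to q$ with $p<b<q$, the *neighbor arc* of $b$ is the one with $p\in X$ maximal if there is one with $p\in X$, and otherwise the one with $p$ minimal (there is none if no arc covers $b$). The sequence $\mathcal C_a(\mathcal A)$ starts with $a$; an integer $b$ with $b\to b'$ is followed by $\rightarrow,b'$; if no arc starts at $b$, it is followed by $\downarrow$ (if $b\in\overline{L_c}$) or $\uparrow$ (if $b\in\overline{R_c}$) and the final point of its neighbor arc, and the sequence stops if there is no neighbor arc. A periodic factor is a word of minimal length of which a tail of $\mathcal C_a(\mathcal A)$, with integers reduced mod $n$, is a repetition. **The $a$-numbering.** If $\mathcal C_a(\mathcal A)$ is finite with last element $b$, let $\mathcal N_a(\mathcal A)$ be the set of chains contained in $]b-n,b]$. Otherwise let $\tau_a$ be the first factor of $\mathcal C_a(\mathcal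 A)$ that is a periodic factor mod $n$ and starts with $\downarrow$ if possible, otherwise with $\uparrow$ if possible, otherwise with $\rightarrow$. Let $\mathcal M_a$ be the set of chains and loops containing an integer of $\tau_a$. If $\tau_a$ starts with $\downarrow$, let $m$ and $M$ be the minimum and maximum of the union of the elements of $\mathcal M_a$; let $\mathcal L_a$ (resp. $\mathcal R_a$) be the set of chains contained in $\overline{L_c}\cap\,]M-n,M[\,\setminus(\tau_a+n\mathbb Z)$ (resp. $\overline{R_c}\cap\,]m,m+n[\,\setminus(\tau_a+n\mathbb Z)$). Otherwise, call a chain $L$-kept (resp. $R$-kept) if it is contained in $\overline{L_c}$ (resp. $\overline{R_c}$) and no translate of it by a multiple of $n$ is in $\mathcal M_a$; let $\mathcal A_L$ (resp. $\mathcal A_R$) be the diagram of the arcs of $L$-kept (resp. $R$-kept) chains, and let $\mathcal L_a$ (resp. $\mathcal R_a$) be the set of $L$-kept chains in $\mathcal N_a(\mathcal A_L)$ (resp. $R$-kept chains in $\mathcal N_a(\mathcal A_R)$). In both cases $\mathcal N_a(\mathcal A)=\mathcal L_a\cup\mathcal M_a\cup\mathcal R_a$. **Selection order.** For chains, $\gamma$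 *hides* $\gamma'\neq\gamma$ if $\min\gamma<\min\gamma'<\max\gamma$ with $\min\gamma'\in\overline{R_c}$, or $\min\gamma'<\min\gamma<\max\gamma'$ with $\min\gamma\in\overline{L_c}$; a loop hides the chains contained in $\overline{R_c}$ and is hidden by the chains contained in $\overline{L_c}$. A finite set of chains and loops is totally ordered by repeatedly selecting and removing, among its elements hidden by no other remaining one, the one whose maximum is minimal (a loop has maximum $+\infty$). The word of such a set is the concatenation, in this order, of the supports listed decreasingly (for a loop, one period of the support). **The map $\mathrm{tito}_{c,a}$.** If $\mathcal C_a(\mathcal A)$ is finite or $\downarrow$ occurs in its periodic factors, $\mathrm{tito}_{c,a}(\mathcal A)$ is the order with window $[N]$, where $N$ is the word of $\mathcal N_a(\mathcal A)$. Otherwise it is the order with windows $[L]\,\underline{[M]}\,[R]$, where $L,M,R$ are the words of $\mathcal L_a,\mathcal M_a,\mathcal R_a$. **Statement.** The map $\widetilde{\mathrm{ncad}}$ restricts to a bijection $\widetilde{\mathrm{ncad}}_c$ from the set of $c$-sortable TITOs onto the set of cyclic $c$-noncrossing arc diagrams. For every $a\in\mathbb Z$, $\mathrm{tito}_{c,a}$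 maps cyclic $c$-noncrossing arc diagrams to $c$-sortable TITOs and is the inverse of $\widetilde{\mathrm{ncad}}_c$; in particular $\mathrm{tito}_{c,a}=\mathrm{tito}_{c,b}$ for all $a,b\in\mathbb Z$. -/

import Mathlib

namespace AffineTITO

/-! ### Coxeter elements of the affine symmetric group -/

/-- The simple reflection of the affine symmetric group (for `n ≥ 2`): it exchanges `i + pn` and
`i + 1 + pn` for all `p`, and fixes all the other integers. -/
def simpleReflection (n : ℕ) (i x : ℤ) : ℤ :=
  if x ≡ i [ZMOD n] then x + 1 else if x ≡ i + 1 [ZMOD n] then x - 1 else x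

/-- A Coxeter element: the product, in some order, of the `n` simple reflections, each of them
being used exactly once. -/
def IsCoxeterElement (n : ℕ) (c : Equiv.Perm ℤ) : Prop :=
  ∃ l : List ℕ, l.Perm (List.range n) ∧
    ∀ x : ℤ, c x = l.foldr (fun (i : ℕ) (y : ℤ) => simpleReflection n i y) x

/-- The set `L_c + nℤ`. -/
def Lbar (c : Equiv.Perm ℤ) : Set ℤ := {i | i < c i}

/-- The set `R_c + nℤ`. -/
def Rbar (c : Equiv.Perm ℤ) : Set ℤ := {i | c i < i}

open Classical in
/-- The one of the two sets `L_c + nℤ`, `R_c + nℤ` that contains `a`. -/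
noncomputable def side (c : Equiv.Perm ℤ) (a : ℤ) : Set ℤ :=
  if a ∈ Lbar c then Lbar c else Rbar c

/-! ### Translation-invariant total orders -/

/-- The covering relation `x ⋖ y` of the strict order `r`. -/
def CoverRel (r : ℤ → ℤ → Prop) (x y : ℤ) : Prop :=
  r x y ∧ ∀ z, ¬ (r x z ∧ r z y)

/-- (Real) translation-invariant total orders on `ℤ`, given by their strict order relation. -/
structure IsTITO (n : ℕ) (r : ℤ → ℤ → Prop) : Prop where
  irrefl : ∀ x, ¬ r x x
  trans : ∀ x y z, r x y → r y z → r x z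
  total : ∀ x y, x ≠ y → r x y ∨ r y x
  translation : ∀ x y, r x y ↔ r (x + n) (y + n)
  real : ∀ x, ¬ CoverRel r (x + n) x

/-- `x` and `y` are at finite distance for `r`. -/
def FiniteDistance (r : ℤ → ℤ → Prop) (x y : ℤ) : Prop :=
  {z | r x z ∧ r z y}.Finite ∧ {z | r y z ∧ r z x}.Finite

/-- Blocks: infinite sets whose elements are at finite distance of each other and at infinite
distance of all the other integers. -/
def IsBlock (r : ℤ → ℤ → Prop) (I : Set ℤ) : Prop :=
  I.Infinite ∧ ∀ x ∈ I, ∀ y, y ∈ I ↔ FiniteDistance r x y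

/-- A block is waxing if `x ≺ x + n` and waning if `x + n ≺ x` for its elements `x`. -/
inductive Direction
  | waxing
  | waning

/-- The elements of `I` go in direction `d`. -/
def HasDirection (n : ℕ) (r : ℤ → ℤ → Prop) : Direction → Set ℤ → Prop
  | .waxing, I => ∀ x ∈ I, r x (x + n)
  | .waning, I => ∀ x ∈ I, r (x + n) x

/-- The order `r` consists of the given blocks, in the given order and with the given directions;
empty blocks are allowed to appear. A block is a union of classes modulo `n` and is given here by
all of its elements instead of their residues. -/
def HasShape (n : ℕ) (r : ℤ → ℤ → Prop) (bs : List (Direction × Set ℤ)) : Prop :=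
  (∀ b ∈ bs, b.2 = ∅ ∨ (IsBlock r b.2 ∧ HasDirection n r b.1 b.2)) ∧
  bs.Pairwise (fun b b' => ∀ x ∈ b.2, ∀ y ∈ b'.2, r x y) ∧
  ∀ x, ∃ b ∈ bs, x ∈ b.2

/-- `c`-sortable TITOs. -/
structure IsSortable (n : ℕ) (c : Equiv.Perm ℤ) (r : ℤ → ℤ → Prop) : Prop where
  isTITO : IsTITO n r
  shape : HasShape n r [(.waxing, Set.univ)] ∨
    ∃ L M R : Set ℤ, HasShape n r [(.waxing, L), (.waning, M), (.waxing, R)] ∧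
      L ⊆ Lbar c ∧ R ⊆ Rbar c ∧ (M ∩ Lbar c).Nonempty ∧ (M ∩ Rbar c).Nonempty
  avoids_kij : ∀ i j k : ℤ, i < j → j < k → j ∈ Lbar c → ¬ (r k i ∧ r i j)
  avoids_jki : ∀ i j k : ℤ, i < j → j < k → j ∈ Rbar c → ¬ (r j k ∧ r k i)

/-- The set of `c`-sortable TITOs on `ℤ`. -/
def sortableTITO (n : ℕ) (c : Equiv.Perm ℤ) : Set (ℤ → ℤ → Prop) := {r | IsSortable n c r}

/-! ### Cyclic noncrossing arc diagrams -/

/-- The combinatorial data `(p, q, L, R)` of an arc: initial point, final point, points on the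
left, points on the right. -/
@[ext]
structure Arc where
  p : ℤ
  q : ℤ
  L : Set ℤ
  R : Set ℤ

/-- Every point strictly between the end points is either on the left or on the right. -/
structure Arc.IsValid (α : Arc) : Prop where
  lt : α.p < α.q
  union : α.L ∪ α.R = Set.Ioo α.p α.q
  disjoint : Disjoint α.L α.R

/-- Translation of an arc. -/
def Arc.translate (α : Arc) (m : ℤ) : Arc :=
  ⟨α.p + m, α.q + m, (· + m) '' α.L, (· + m) '' α.R⟩

/-- Two (distinct) arcs intersect: they have the same initial point, or the same final point, or
each of them is somewhere on the left of the other one. The final point of an arc may be the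
initial point of another one. -/
def Arc.Intersects (α β : Arc) : Prop :=
  α.p = β.p ∨ α.q = β.q ∨
    ((((α.L ∪ {α.p, α.q}) ∩ β.R) ∪ (α.L ∩ {β.p, β.q})).Nonempty ∧
      ((α.R ∩ (β.L ∪ {β.p, β.q})) ∪ ({α.p, α.q} ∩ β.L)).Nonempty)

/-- Cyclic noncrossing arc diagrams on `n` points. -/
structure IsCyclicNCAD (n : ℕ) (A : Set Arc) : Prop where
  valid : ∀ α ∈ A, α.IsValid
  translation : ∀ α : Arc, α ∈ A ↔ α.translate n ∈ A
  noncrossing : ∀ α ∈ A, ∀ β ∈ A, α ≠ β → ¬ α.Intersects β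

/-- `p → q` is (the pair of end points of) an arc of `A`. -/
def HasArc (A : Set Arc) (p q : ℤ) : Prop := ∃ α ∈ A, α.p = p ∧ α.q = q

/-- Chains (full chains, and singletons for the points that are on no arc), given by their
supports: the support is listed along the arcs, no arc ends at its first element and no arc starts
at its last element. -/
def IsArcChain (A : Set Arc) (γ : Set ℤ) : Prop :=
  ∃ (l : List ℤ) (hl : l ≠ []), l.IsChain (HasArc A) ∧ (∀ x, ¬ HasArc A x (l.head hl)) ∧
    (∀ x, ¬ HasArc A (l.getLast hl) x) ∧ γ = {x | x ∈ l}

/-- Loops, given by their supports: bi-infinite sequences of consecutive arcs. -/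
def IsArcLoop (A : Set Arc) (γ : Set ℤ) : Prop :=
  ∃ f : ℤ → ℤ, (∀ i, HasArc A (f i) (f (i + 1))) ∧ γ = Set.range f

/-- Cyclic `c`-noncrossing arc diagrams. -/
structure IsCyclicCNCAD (n : ℕ) (c : Equiv.Perm ℤ) (A : Set Arc) : Prop where
  isCyclicNCAD : IsCyclicNCAD n A
  left_subset : ∀ α ∈ A, α.L ⊆ Lbar c
  right_subset : ∀ α ∈ A, α.R ⊆ Rbar c
  real_loop : ∀ γ, IsArcLoop A γ → ¬ γ ⊆ Lbar c ∧ ¬ γ ⊆ Rbar c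

/-- The set of cyclic `c`-noncrossing arc diagrams. -/
def cyclicCNCAD (n : ℕ) (c : Equiv.Perm ℤ) : Set (Set Arc) := {A | IsCyclicCNCAD n c A}

/-! ### The map from TITOs to arc diagrams -/

/-- The arc associated with a pair `p < q`. -/
def arcOf (r : ℤ → ℤ → Prop) (p q : ℤ) : Arc :=
  ⟨p, q, {i | p < i ∧ i < q ∧ r i q}, {i | p < i ∧ i < q ∧ r p i}⟩

/-- The arc diagram of a TITO. Since all pairs `p < q` of integers such that `q ≺ p` is a covering
relation are considered, the translates by multiples of `n` are included. -/
def ncad (r : ℤ → ℤ → Prop) : Set Arc :=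
  {α | ∃ p q : ℤ, p < q ∧ CoverRel r q p ∧ α = arcOf r p q}

/-! ### Neighbor arcs and the sequence attached to an integer -/

/-- `p → q` is a covering arc of `a`. -/
def IsCoveringArc (A : Set Arc) (a p q : ℤ) : Prop := HasArc A p q ∧ p < a ∧ a < q

/-- The initial points in `X` of the covering arcs of `a`. -/
def coveringStarts (A : Set Arc) (a : ℤ) (X : Set ℤ) : Set ℤ :=
  {p | p ∈ X ∧ ∃ q, IsCoveringArc A a p q}

open Classical in
/-- `p → q` is the neighbor arc of `a`. -/
def IsNeighborArc (c : Equiv.Perm ℤ) (A : Set Arc) (a p q : ℤ) : Prop :=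
  IsCoveringArc A a p q ∧
    if (coveringStarts A a (side c a)).Nonempty
    then IsGreatest (coveringStarts A a (side c a)) p
    else IsLeast (coveringStarts A a Set.univ) p

/-- The letters of the sequences: integers and the three arrows `→`, `↑`, `↓`. -/
inductive Letter
  | int (x : ℤ)
  | right
  | up
  | down

/-- Replace an integer by its residue modulo `n`. -/
def Letter.mod (n : ℕ) : Letter → Letter
  | .int x => .int (x % n)
  | l => l

open Classical in
/-- The arrow and the integer that follow the integer `b`: if `b → b'` is an arc, they are `→` and
`b'`; if `b` is the last element of its chain, they are a vertical arrow and the final point of the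
neighbor arc of `b`, and the sequence stops if there is no neighbor arc. -/
noncomputable def next (c : Equiv.Perm ℤ) (A : Set Arc) (b : ℤ) : Option (Letter × ℤ) :=
  if h : ∃ q, HasArc A b q then some (.right, h.choose)
  else if h : ∃ q, ∃ p, IsNeighborArc c A b p q then
    some (if b ∈ Lbar c then .down else .up, h.choose)
  else none

/-- The successive integers of the sequence starting at `a`. -/
noncomputable def seqPoint (c : Equiv.Perm ℤ) (A : Set Arc) (a : ℤ) : ℕ → Option ℤ
  | 0 => some a
  | k + 1 => (seqPoint c A a k).bind fun b => (next c A b).map Prod.snd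

/-- The sequence `C_a(A)`; the value `none` means that the sequence has stopped. The integers are
in even position, the arrows in odd position. -/
noncomputable def seqC (c : Equiv.Perm ℤ) (A : Set Arc) (a : ℤ) (m : ℕ) : Option Letter :=
  if m % 2 = 0 then (seqPoint c A a (m / 2)).map Letter.int
  else (seqPoint c A a (m / 2)).bind fun b => (next c A b).map Prod.fst

/-- The sequence `C_a(A)` with all integers replaced by their residues modulo `n`. -/
noncomputable def seqCmod (n : ℕ) (c : Equiv.Perm ℤ) (A : Set Arc) (a : ℤ) (m : ℕ) :
    Option Letter :=
  (seqC c A a m).map (Letter.mod n)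

/-- The sequence `C_a(A)` is finite. -/
def SeqFinite (c : Equiv.Perm ℤ) (A : Set Arc) (a : ℤ) : Prop := ∃ m, seqC c A a m = none

/-- `b` is the last element of the (finite) sequence `C_a(A)`. -/
def IsSeqLast (c : Equiv.Perm ℤ) (A : Set Arc) (a b : ℤ) : Prop :=
  ∃ m, seqC c A a m = some (.int b) ∧ seqC c A a (m + 1) = none

/-- From a certain point, the sequence `u` consists of repetitions of the word `w`. -/
def EventuallyRepeats (u : ℕ → Option Letter) (w : List Letter) : Prop :=
  w ≠ [] ∧ ∃ N, ∀ j, u (N + j) = w[j % w.length]?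

/-- Periodic factors: words of minimal length that are eventually repeated. -/
def IsPeriodicFactor (u : ℕ → Option Letter) (w : List Letter) : Prop :=
  EventuallyRepeats u w ∧ ∀ w', EventuallyRepeats u w' → w.length ≤ w'.length

/-- `w` is a factor of `C_a(A)` at position `i`, starts with the letter `s`, and is a periodic
factor modulo `n`. -/
def IsPeriodicFactorAt (n : ℕ) (c : Equiv.Perm ℤ) (A : Set Arc) (a : ℤ) (s : Letter) (i : ℕ)
    (w : List Letter) : Prop :=
  (∀ j < w.length, seqC c A a (i + j) = w[j]?) ∧ w.head? = some s ∧
    IsPeriodicFactor (seqCmod n c A a) (w.map (Letter.mod n))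

open Classical in
/-- The first letter of `τ_a`: `↓` if possible, otherwise `↑` if possible, otherwise `→`. -/
noncomputable def tauStart (n : ℕ) (c : Equiv.Perm ℤ) (A : Set Arc) (a : ℤ) : Letter :=
  if ∃ i w, IsPeriodicFactorAt n c A a .down i w then .down
  else if ∃ i w, IsPeriodicFactorAt n c A a .up i w then .up
  else .right

/-- `w` is the first factor of `C_a(A)` that is a periodic factor modulo `n` and that starts with
the prescribed letter. -/
def IsTau (n : ℕ) (c : Equiv.Perm ℤ) (A : Set Arc) (a : ℤ) (w : List Letter) : Prop :=
  ∃ i, IsPeriodicFactorAt n c A a (tauStart n c A a) i w ∧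
    ∀ i' w', IsPeriodicFactorAt n c A a (tauStart n c A a) i' w' → i ≤ i'

open Classical in
/-- The factor `τ_a` of an infinite sequence `C_a(A)`. -/
noncomputable def tau (n : ℕ) (c : Equiv.Perm ℤ) (A : Set Arc) (a : ℤ) : List Letter :=
  if h : ∃ w, IsTau n c A a w then h.choose else []

/-- The integers that appear in `τ_a`. -/
def tauInts (n : ℕ) (c : Equiv.Perm ℤ) (A : Set Arc) (a : ℤ) : Set ℤ :=
  {x | Letter.int x ∈ tau n c A a}

/-! ### The `a`-numbering -/

/-- The `a`-numbering in the case where `C_a(A)` is finite. -/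
def finiteNumbering (n : ℕ) (c : Equiv.Perm ℤ) (A : Set Arc) (a : ℤ) : Set (Set ℤ) :=
  {γ | IsArcChain A γ ∧ ∃ b, IsSeqLast c A a b ∧ γ ⊆ Set.Ioc (b - n) b}

/-- The set `M_a(A)`: the chains and loops that contain a number of `τ_a`. -/
def middleNumbering (n : ℕ) (c : Equiv.Perm ℤ) (A : Set Arc) (a : ℤ) : Set (Set ℤ) :=
  {γ | (IsArcChain A γ ∨ IsArcLoop A γ) ∧ (γ ∩ tauInts n c A a).Nonempty}

/-- The integers that are congruent modulo `n` to a number of `τ_a`. -/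
def tauClasses (n : ℕ) (c : Equiv.Perm ℤ) (A : Set Arc) (a : ℤ) : Set ℤ :=
  {x | ∃ t ∈ tauInts n c A a, x ≡ t [ZMOD n]}

/-- The chains with support in `X` that have no representative modulo `n` in `M_a(A)`. -/
def keptChains (n : ℕ) (c : Equiv.Perm ℤ) (A : Set Arc) (a : ℤ) (X : Set ℤ) : Set (Set ℤ) :=
  {γ | IsArcChain A γ ∧ γ ⊆ X ∧
    ∀ k : ℤ, (fun x => x + k * (n : ℤ)) '' γ ∉ middleNumbering n c A a}

/-- The diagrams `A_L` (for `X = L_c + nℤ`) and `A_R` (for `X = R_c + nℤ`), consisting of the arcs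
of the kept chains. -/
def subdiagram (n : ℕ) (c : Equiv.Perm ℤ) (A : Set Arc) (a : ℤ) (X : Set ℤ) : Set Arc :=
  {α | α ∈ A ∧ ∃ γ ∈ keptChains n c A a X, α.p ∈ γ ∧ α.q ∈ γ}

open Classical in
/-- The set `L_a(A)`. -/
noncomputable def leftNumbering (n : ℕ) (c : Equiv.Perm ℤ) (A : Set Arc) (a : ℤ) :
    Set (Set ℤ) :=
  if tauStart n c A a = .down then
    {γ | IsArcChain A γ ∧
      γ ⊆ (Lbar c ∩ Set.Ioo (sSup (⋃₀ middleNumbering n c A a) - n)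
        (sSup (⋃₀ middleNumbering n c A a))) \ tauClasses n c A a}
  else keptChains n c A a (Lbar c) ∩ finiteNumbering n c (subdiagram n c A a (Lbar c)) a

open Classical in
/-- The set `R_a(A)`. -/
noncomputable def rightNumbering (n : ℕ) (c : Equiv.Perm ℤ) (A : Set Arc) (a : ℤ) :
    Set (Set ℤ) :=
  if tauStart n c A a = .down then
    {γ | IsArcChain A γ ∧
      γ ⊆ (Rbar c ∩ Set.Ioo (sInf (⋃₀ middleNumbering n c A a))
        (sInf (⋃₀ middleNumbering n c A a) + n)) \ tauClasses n c A a}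
  else keptChains n c A a (Rbar c) ∩ finiteNumbering n c (subdiagram n c A a (Rbar c)) a

open Classical in
/-- The `a`-numbering `N_a(A)`. -/
noncomputable def numbering (n : ℕ) (c : Equiv.Perm ℤ) (A : Set Arc) (a : ℤ) : Set (Set ℤ) :=
  if SeqFinite c A a then finiteNumbering n c A a
  else leftNumbering n c A a ∪ middleNumbering n c A a ∪ rightNumbering n c A a

/-! ### Hiding and the order given by the selection procedure -/

/-- The chain or loop `γ` hides the chain or loop `γ'`. The minimum of a chain is `sInf` and its
maximum is `sSup`. -/
def Hides (c : Equiv.Perm ℤ) (A : Set Arc) (γ γ' : Set ℤ) : Prop :=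
  (IsArcLoop A γ ∧ γ' ⊆ Rbar c) ∨ (IsArcLoop A γ' ∧ γ ⊆ Lbar c) ∨
  (¬ IsArcLoop A γ ∧ ¬ IsArcLoop A γ' ∧
    ((sInf γ < sInf γ' ∧ sInf γ' ∈ Rbar c ∧ sInf γ' < sSup γ) ∨
     (sInf γ' < sInf γ ∧ sInf γ ∈ Lbar c ∧ sInf γ < sSup γ')))

/-- The elements of `N` that are hidden by no other element of `N`. -/
def unhidden (c : Equiv.Perm ℤ) (A : Set Arc) (N : Set (Set ℤ)) : Set (Set ℤ) :=
  {γ | γ ∈ N ∧ ∀ γ' ∈ N, γ' ≠ γ → ¬ Hides c A γ' γ}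

open Classical in
/-- The maximum of a chain, and `⊤` for a loop. -/
noncomputable def maxOf (A : Set Arc) (γ : Set ℤ) : WithTop ℤ :=
  if IsArcLoop A γ then ⊤ else ((sSup γ : ℤ) : WithTop ℤ)

/-- The unhidden element of `N` whose maximum is minimal. -/
noncomputable def select (c : Equiv.Perm ℤ) (A : Set Arc) (N : Set (Set ℤ)) : Set ℤ :=
  Classical.epsilon fun γ =>
    γ ∈ unhidden c A N ∧ ∀ γ' ∈ unhidden c A N, maxOf A γ ≤ maxOf A γ'

/-- The first `k` elements obtained by iteratively selecting and removing elements of `N`. -/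
noncomputable def selectList (c : Equiv.Perm ℤ) (A : Set Arc) : ℕ → Set (Set ℤ) → List (Set ℤ)
  | 0, _ => []
  | k + 1, N => select c A N :: selectList c A k (N \ {select c A N})

open Classical in
/-- The elements of a finite set of integers, from largest to smallest. -/
noncomputable def descending (S : Set ℤ) : List ℤ :=
  if h : S.Finite then h.toFinset.sort (· ≥ ·) else []

open Classical in
/-- The contribution of a chain or loop to a window: the support of a chain, and one period of the
support of a loop, from largest to smallest. -/
noncomputable def supportWord (n : ℕ) (a : ℤ) (γ : Set ℤ) : List ℤ :=
  descending (if γ.Finite then γ else γ ∩ Set.Ioc (a - n) a)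

/-- The window made of the supports of the elements of the finite set `N`, taken in the order given
by the selection procedure. -/
noncomputable def windowOf (n : ℕ) (c : Equiv.Perm ℤ) (A : Set Arc) (a : ℤ) (N : Set (Set ℤ)) :
    List ℤ :=
  (selectList c A N.ncard N).flatMap (supportWord n a)

/-! ### The map from arc diagrams to TITOs -/

/-- `x` belongs to the block with window `w`. -/
def InBlock (n : ℕ) (w : List ℤ) (x : ℤ) : Prop := ∃ y ∈ w, x ≡ y [ZMOD n]

/-- The order inside a block with window `w`: the translates `w + kn` are concatenated, by
increasing `k` for a waxing block and by decreasing `k` for a waning block. -/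
def BlockLT (n : ℕ) (d : Direction) (w : List ℤ) (x y : ℤ) : Prop :=
  ∃ (i j : Fin w.length) (k l : ℤ), x = w.get i + k * n ∧ y = w.get j + l * n ∧
    ((match d with
      | .waxing => k < l
      | .waning => l < k) ∨ (k = l ∧ i < j))

/-- The order on `ℤ` given by a window notation: the concatenation of the blocks with the given
directions and windows. -/
def windowNotation (n : ℕ) (bs : List (Direction × List ℤ)) (x y : ℤ) : Prop :=
  (∃ i j : Fin bs.length, i < j ∧ InBlock n (bs.get i).2 x ∧ InBlock n (bs.get j).2 y) ∨
  ∃ b ∈ bs, BlockLT n b.1 b.2 x y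

open Classical in
/-- The map `tito_{c,a}`. -/
noncomputable def tito (n : ℕ) (c : Equiv.Perm ℤ) (a : ℤ) (A : Set Arc) : ℤ → ℤ → Prop :=
  if SeqFinite c A a ∨ Letter.down ∈ tau n c A a then
    windowNotation n [(.waxing, windowOf n c A a (numbering n c A a))]
  else
    windowNotation n
      [(.waxing, windowOf n c A a (leftNumbering n c A a)),
       (.waning, windowOf n c A a (middleNumbering n c A a)),
       (.waxing, windowOf n c A a (rightNumbering n c A a))]

end AffineTITO

/-! Only two properties of c matter: it fixes no integer and it commutes with translation by n. So ℤ
is colored periodically by `Lbar c` and `Rbar c`, and the colors determine the two sides of every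
arc.

Bijectivity of `ncad`. A total order on ℤ amounts to its inversions, the pairs y < x with x ≺ y. In
an order avoiding the patterns, a descent q ⋖ p puts the points of color L over the arc p → q before
q and those of color R after p; this yields the elementary inversions of the arc (`InvStep`).
Conversely, let the arcs of a diagram A generate the transitive relation `Inv c A`. If (x, z) is an
inversion and z < y < x, then (y, z) is one when y has color L, and (x, y) is one when y has color
R. This makes the complement transitive as well, so that an order `ordOf c A` results, and it is
also exactly the avoidance of the patterns. The noncrossing condition says that the descents of this
order are the arcs of A (`inv_of_arc`, `inv_of_arc'`, `ncad_ordOf`). In the other direction, the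
inversions of a sortable order are generated by its arcs (`IsSortable.inv_iff`): at finite distance
by subdivision, at infinite distance because a waning block has an arc crossing every level. Finally
the condition on loops matches the condition on shapes: a waning block of one color has only
descents, hence is a loop, and a loop fills a whole waning block.

The map `tito`. It remains to recover a sortable order r from `ncad r`. A chain is an interval of r,
and a point off the chain but between its extreme values precedes or follows the chain according to
its color. Hence hiding implies preceding, and the selection procedure sorts every finite family of
chains with convex union (`windowOf_spec`). So it suffices that the numbering covers, in each block,
a fundamental domain cut out by the order. The neighbor arc of b is the covering arc closest to b
for r (`neighbor_closest_L`, `neighbor_closest_R`). If the sequence stops at b, no arc crosses b,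
and the integers at most b form an initial segment of r. Otherwise the periodic part of the sequence
extends to a biinfinite orbit.

In a single waxing block the orbit cannot always move to the left for r, so it contains ↓. A
planarity argument shows that it advances by exactly n in a period (`d_eq_one_of_down`). Chains that
avoid it have one color each and do not straddle certain thresholds, which produces an initial
segment (`initialSegment`) whose fundamental domain is the numbering. When there is a waning block,
the orbit lies in it, always moves to the left, and visits the ends of all of its chains
(`top_mem_range`). The waxing blocks that remain have one color, and sequences on them are finite.
-/

namespace AffineTITO

/-! ### Coxeter elements -/

/-- The properties of Coxeter elements that matter here: no integer is fixed, and translation by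
`n` commutes with `c`. -/
structure IsColoring (n : ℕ) (c : Equiv.Perm ℤ) : Prop where
  ne : ∀ x, c x ≠ x
  add : ∀ x, c (x + n) = c x + n

theorem simpleReflection_add (n : ℕ) (i x : ℤ) :
    simpleReflection n i (x + n) = simpleReflection n i x + n := by
  have h : ∀ y : ℤ, (x + n ≡ y [ZMOD n]) ↔ (x ≡ y [ZMOD n]) := fun y => by
    simp [Int.ModEq]
  unfold simpleReflection
  simp only [h]
  split_ifs <;> ring

/-- A point that has been moved up by the reflection of index i sits at a residue i + 1. It could be
moved back only by that same reflection, which is not used again, so it can only go further up;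
symmetrically for points moved down. The first alternative records which reflections have been
harmless so far. -/
theorem foldr_simpleReflection_displacement (n : ℕ) (x : ℤ) (l : List ℕ)
    (hl : l.Nodup) (hn : ∀ i ∈ l, i < n) :
    let y := l.foldr (fun (i : ℕ) (y : ℤ) => simpleReflection n i y) x
    (y = x ∧ (∀ i ∈ l, ¬ x ≡ i [ZMOD n]) ∧ (∀ i ∈ l, ¬ x ≡ i + 1 [ZMOD n])) ∨
    (x < y ∧ ∃ i ∈ l, y ≡ i + 1 [ZMOD n]) ∨ (y < x ∧ ∃ i ∈ l, y ≡ i [ZMOD n]) := by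
  induction l with
  | nil => simp
  | cons j l ih =>
    have hl' := List.nodup_cons.1 hl
    have key : ∀ i ∈ l, ¬ (i : ℤ) ≡ j [ZMOD n] := by
      intro i hi h
      have h1 := hn i (List.mem_cons_of_mem _ hi)
      have h2 := hn j List.mem_cons_self
      have h3 := Nat.ModEq.eq_of_lt_of_lt ((Int.natCast_modEq_iff).1 h) h1 h2
      exact hl'.1 (h3 ▸ hi)
    have ih' := ih hl'.2 (fun i hi => hn i (List.mem_cons_of_mem _ hi))
    simp only [List.foldr_cons]
    set y := l.foldr (fun (i : ℕ) (y : ℤ) => simpleReflection n i y) x with hy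
    simp only at ih'
    unfold simpleReflection
    split_ifs with h1 h2
    · refine Or.inr (Or.inl ⟨?_, j, List.mem_cons_self, h1.add_right 1⟩)
      rcases ih' with h | h | ⟨h, i, hi, hi'⟩
      · omega
      · omega
      · exact absurd (hi'.symm.trans h1) (key i hi)
    · refine Or.inr (Or.inr ⟨?_, j, List.mem_cons_self, ?_⟩)
      · rcases ih' with h | ⟨h, i, hi, hi'⟩ | h
        · omega
        · exact absurd (Int.ModEq.add_right_cancel' 1 (hi'.symm.trans h2)) (key i hi)
        · omega
      · have := h2.sub_right 1
        simpa using this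
    · rcases ih' with ⟨h, h3, h4⟩ | ⟨h, i, hi, hi'⟩ | ⟨h, i, hi, hi'⟩
      · rw [h] at h1 h2
        refine Or.inl ⟨h, ?_, ?_⟩
        · simpa [h1] using h3
        · simpa [h2] using h4
      · exact Or.inr (Or.inl ⟨h, i, List.mem_cons_of_mem _ hi, hi'⟩)
      · exact Or.inr (Or.inr ⟨h, i, List.mem_cons_of_mem _ hi, hi'⟩)

theorem IsCoxeterElement.isColoring {n : ℕ} (hn : 0 < n) {c : Equiv.Perm ℤ}
    (hc : IsCoxeterElement n c) : IsColoring n c := by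
  obtain ⟨l, hl, hc⟩ := hc
  constructor
  · intro x hx
    have := foldr_simpleReflection_displacement n x l (hl.nodup_iff.2 List.nodup_range)
      (fun i hi => List.mem_range.1 (hl.mem_iff.1 hi))
    simp only [← hc x, hx, lt_irrefl, false_and, or_false, true_and] at this
    have hpos : (0 : ℤ) < n := by exact_mod_cast hn
    have hnn := Int.emod_nonneg x hpos.ne'
    -- The residue of x is the index of one of the reflections, which therefore moves x.
    refine this.1 (x % n).toNat (hl.mem_iff.2 (List.mem_range.2 ?_)) ?_
    · have := Int.emod_lt_of_pos x hpos
      omega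
    · rw [Int.toNat_of_nonneg hnn]
      exact (Int.mod_modEq x n).symm
  · intro x
    rw [hc, hc]
    clear hc hl
    induction l with
    | nil => rfl
    | cons j l ih => simp only [List.foldr_cons, ih, simpleReflection_add]

namespace IsColoring

variable {n : ℕ} {c : Equiv.Perm ℤ} (hc : IsColoring n c)
include hc

theorem add_mul (x k : ℤ) : c (x + k * n) = c x + k * n := by
  induction k using Int.induction_on with
  | zero => simp
  | succ i ih =>
    have := hc.add (x + i * n)
    rw [ih] at this
    rw [show x + ((i : ℤ) + 1) * n = x + i * n + n by ring, this]; ring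
  | pred i ih =>
    have := hc.add (x + (-i - 1) * n)
    rw [show x + (-(i : ℤ) - 1) * n + n = x + -i * n by ring, ih] at this
    linarith

theorem mem_L_add (x k : ℤ) : x + k * n ∈ Lbar c ↔ x ∈ Lbar c := by
  simp only [Lbar, Set.mem_ofPred_eq, hc.add_mul]; omega

theorem mem_R_add (x k : ℤ) : x + k * n ∈ Rbar c ↔ x ∈ Rbar c := by
  simp only [Rbar, Set.mem_ofPred_eq, hc.add_mul]; omega

theorem not_mem_L {x : ℤ} : x ∉ Lbar c ↔ x ∈ Rbar c := by
  have := hc.ne x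
  simp only [Lbar, Rbar, Set.mem_ofPred_eq]; omega

theorem not_mem_R {x : ℤ} : x ∉ Rbar c ↔ x ∈ Lbar c := by
  have := hc.ne x
  simp only [Lbar, Rbar, Set.mem_ofPred_eq]; omega

theorem L_or_R (x : ℤ) : x ∈ Lbar c ∨ x ∈ Rbar c := by
  by_cases h : x ∈ Lbar c
  · exact Or.inl h
  · exact Or.inr (hc.not_mem_L.1 h)

end IsColoring

theorem not_L_and_R {c : Equiv.Perm ℤ} {x : ℤ} (h : x ∈ Lbar c) (h' : x ∈ Rbar c) : False := by
  simp only [Lbar, Rbar, Set.mem_ofPred_eq] at h h'; omega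

/-! ### Translation-invariant strict total orders -/

/-- Strict total orders on `ℤ` that are invariant under translation by `n`. -/
structure IsPeriodicOrder (n : ℕ) (r : ℤ → ℤ → Prop) : Prop where
  irrefl : ∀ x, ¬ r x x
  trans : ∀ x y z, r x y → r y z → r x z
  total : ∀ x y, x ≠ y → r x y ∨ r y x
  translation : ∀ x y, r x y ↔ r (x + n) (y + n)

theorem IsTITO.isPeriodicOrder {n : ℕ} {r : ℤ → ℤ → Prop} (h : IsTITO n r) : IsPeriodicOrder n r :=
  ⟨h.irrefl, h.trans, h.total, h.translation⟩

namespace IsPeriodicOrder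

variable {n : ℕ} {r : ℤ → ℤ → Prop} (h : IsPeriodicOrder n r)
include h

theorem reverse : IsPeriodicOrder n (fun x y => r y x) :=
  ⟨h.irrefl, fun x y z a b => h.trans z y x b a, fun x y e => (h.total x y e).symm,
    fun x y => h.translation y x⟩

theorem asymm {x y : ℤ} (a : r x y) (b : r y x) : False := h.irrefl x (h.trans x y x a b)

theorem ne {x y : ℤ} (a : r x y) : x ≠ y := fun e => h.irrefl y (by rwa [e] at a)

theorem not_iff {x y : ℤ} (e : x ≠ y) : ¬ r x y ↔ r y x :=
  ⟨fun a => (h.total x y e).resolve_left a, fun a b => h.asymm a b⟩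

theorem tr (k x y : ℤ) : r (x + k * n) (y + k * n) ↔ r x y := by
  induction k using Int.induction_on with
  | zero => simp
  | succ i ih =>
    rw [← ih, h.translation (x + i * n)]
    ring_nf
  | pred i ih =>
    rw [← ih, h.translation (x + (-i - 1) * n)]
    ring_nf

theorem wax_mul {x : ℤ} (hx : r x (x + n)) {k : ℤ} (hk : 0 < k) : r x (x + k * n) := by
  induction k, hk using Int.leInduction with
  | base => simpa using hx
  | succ k hk ih =>
    refine h.trans _ _ _ ih ?_
    have := (h.tr k x (x + n)).2 hx
    rwa [show x + n + k * n = x + (k + 1) * n by ring] at this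

theorem wane_mul {x : ℤ} (hx : r (x + n) x) {k : ℤ} (hk : 0 < k) : r (x + k * n) x :=
  h.reverse.wax_mul (x := x) hx hk

theorem wax_tr (x k : ℤ) : r (x + k * n) (x + k * n + n) ↔ r x (x + n) := by
  rw [← h.tr k x, show x + n + k * n = x + k * n + n by ring]

theorem wane_tr (x k : ℤ) : r (x + k * n + n) (x + k * n) ↔ r (x + n) x :=
  h.reverse.wax_tr x k

theorem wax_or_wane (hn : 0 < n) (x : ℤ) : r x (x + n) ∨ r (x + n) x :=
  h.total _ _ (by omega)

/-- Two congruent integers z < z' cannot both lie between x and x + n: z ≺ x + n ≺ z + n makes z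
waxing, so z' is no earlier than z + n. Hence at most n elements per period. -/
theorem finite_wax (hn : 0 < n) (x : ℤ) (k : ℕ) :
    {z | r x z ∧ r z (x + k * n)}.Finite := by
  have base : {z | r x z ∧ r z (x + n)}.Finite := by
    refine Set.Finite.of_finite_image (f := fun z => z % (n : ℤ)) ?_ ?_
    · refine (Set.finite_Ico (0 : ℤ) n).subset ?_
      rintro _ ⟨z, -, rfl⟩
      exact ⟨Int.emod_nonneg _ (by omega), Int.emod_lt_of_pos _ (by omega)⟩
    · have key : ∀ z ∈ {z | r x z ∧ r z (x + n)}, ∀ z' ∈ {z | r x z ∧ r z (x + n)},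
          z % (n : ℤ) = z' % n → ¬ z < z' := by
        rintro z ⟨hz1, hz2⟩ z' ⟨hz3, hz4⟩ e hlt
        have hzw : r z (z + n) := h.trans _ _ _ hz2 ((h.translation _ _).1 hz1)
        obtain ⟨j, hj⟩ := Int.ModEq.dvd (show z ≡ z' [ZMOD n] from e)
        obtain rfl : z' = z + j * n := by linarith
        have hj0 : 0 < j := by
          by_contra hneg
          have : j * n ≤ 0 := mul_nonpos_of_nonpos_of_nonneg (by omega) (by omega)
          omega
        have h1 : r (x + n) (z + n) := (h.translation _ _).1 hz1
        have h2 : r (x + n) (z + j * n) := by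
          rcases eq_or_ne j 1 with rfl | hj1
          · simpa using h1
          · have := h.wax_mul ((h.wax_tr z 1).2 hzw) (k := j - 1) (by omega)
            rw [show z + 1 * n + (j - 1) * n = z + j * n by ring] at this
            exact h.trans _ _ _ h1 (by simpa using this)
        exact h.asymm h2 hz4
      intro z hz z' hz' e
      rcases lt_trichotomy z z' with hlt | he | hlt
      · exact absurd hlt (key z hz z' hz' e)
      · exact he
      · exact absurd hlt (key z' hz' z hz e.symm)
  induction k with
  | zero =>
    refine Set.Finite.subset Set.finite_empty ?_
    rintro z ⟨a, b⟩
    simp only [Nat.cast_zero, zero_mul, add_zero] at b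
    exact (h.asymm a b).elim
  | succ k ih =>
    have h2 : {z | r (x + k * n) z ∧ r z (x + (k + 1 : ℕ) * n)}.Finite := by
      refine (base.image (fun z : ℤ => z + (k : ℤ) * n)).subset ?_
      rintro z ⟨a, b⟩
      refine ⟨z - k * n, ⟨?_, ?_⟩, by ring⟩
      · rw [← h.tr k]; simpa using a
      · rw [← h.tr k]; push_cast at b; ring_nf at b ⊢; exact b
    refine ((ih.union h2).union (Set.finite_singleton (x + k * n))).subset ?_
    rintro z ⟨a, b⟩
    by_cases e : z = x + k * n
    · exact Or.inr e
    · rcases h.total _ _ e with e | e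
      · exact Or.inl (Or.inl ⟨a, e⟩)
      · exact Or.inl (Or.inr ⟨e, b⟩)

theorem finite_wane (hn : 0 < n) (x : ℤ) (k : ℕ) :
    {z | r (x + k * n) z ∧ r z x}.Finite := by
  have := h.reverse.finite_wax hn x k
  simpa [and_comm] using this

/-- Between two elements separated by finitely many others, one passes from a set to its complement
through a covering relation. -/
theorem exists_cover_of_finite {x y : ℤ} (hxy : r x y) (hf : {z | r x z ∧ r z y}.Finite)
    (p : ℤ → Prop) (hx : p x) (hy : ¬ p y) :
    ∃ u v, CoverRel r u v ∧ p u ∧ ¬ p v ∧ (u = x ∨ r x u) ∧ (v = y ∨ r v y) := by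
  induction hcard : hf.toFinset.card using Nat.strong_induction_on generalizing x y with
  | _ m ih =>
    by_cases hz : ∃ z, r x z ∧ r z y
    · obtain ⟨z, hxz, hzy⟩ := hz
      have sub1 : {w | r x w ∧ r w z} ⊆ {w | r x w ∧ r w y} :=
        fun w hw => ⟨hw.1, h.trans _ _ _ hw.2 hzy⟩
      have sub2 : {w | r z w ∧ r w y} ⊆ {w | r x w ∧ r w y} :=
        fun w hw => ⟨h.trans _ _ _ hxz hw.1, hw.2⟩
      by_cases hp : p z
      · obtain ⟨u, v, h1, h2, h3, h4, h5⟩ := ih _ (by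
          rw [← hcard]
          refine Finset.card_lt_card ⟨?_, fun hs => ?_⟩
          · exact Set.Finite.toFinset_subset_toFinset.2 sub2
          · have := hs ((Set.Finite.mem_toFinset hf).2 (show z ∈ _ from ⟨hxz, hzy⟩))
            exact h.irrefl z ((Set.Finite.mem_toFinset _).1 this).1)
          hzy (hf.subset sub2) hp hy rfl
        refine ⟨u, v, h1, h2, h3, Or.inr ?_, h5⟩
        rcases h4 with rfl | h4
        · exact hxz
        · exact h.trans _ _ _ hxz h4
      · obtain ⟨u, v, h1, h2, h3, h4, h5⟩ := ih _ (by
          rw [← hcard]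
          refine Finset.card_lt_card ⟨?_, fun hs => ?_⟩
          · exact Set.Finite.toFinset_subset_toFinset.2 sub1
          · have := hs ((Set.Finite.mem_toFinset hf).2 (show z ∈ _ from ⟨hxz, hzy⟩))
            exact h.irrefl z ((Set.Finite.mem_toFinset _).1 this).2)
          hxz (hf.subset sub1) hx hp rfl
        refine ⟨u, v, h1, h2, h3, h4, Or.inr ?_⟩
        rcases h5 with rfl | h5
        · exact hzy
        · exact h.trans _ _ _ h5 hzy
    · exact ⟨x, y, ⟨hxy, fun z hz' => hz ⟨z, hz'⟩⟩, hx, hy, Or.inl rfl, Or.inl rfl⟩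

theorem cover_right_unique {x y z : ℤ} (a : CoverRel r x y) (b : CoverRel r x z) : y = z := by
  by_contra e
  rcases h.total _ _ e with e | e
  · exact b.2 _ ⟨a.1, e⟩
  · exact a.2 _ ⟨b.1, e⟩

theorem cover_left_unique {x y z : ℤ} (a : CoverRel r x z) (b : CoverRel r y z) : x = y := by
  by_contra e
  rcases h.total _ _ e with e | e
  · exact a.2 _ ⟨e, b.1⟩
  · exact b.2 _ ⟨e, a.1⟩

theorem cover_tr (k x y : ℤ) : CoverRel r (x + k * n) (y + k * n) ↔ CoverRel r x y := by
  unfold CoverRel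
  rw [h.tr]
  refine and_congr_right fun _ => ⟨fun H z hz => H (z + k * n) ?_, fun H z hz => H (z - k * n) ?_⟩
  · rwa [h.tr, h.tr]
  · rw [← h.tr k, ← h.tr k (z - k * n)]
    simpa using hz

/-- If `u ⋖ v` and `u ≺ z` then `v ≼ z`. -/
theorem cover_le {u v z : ℤ} (a : CoverRel r u v) (b : r u z) : v = z ∨ r v z := by
  by_contra e
  push Not at e
  exact a.2 z ⟨b, (h.total _ _ e.1).resolve_left e.2⟩

/-- If `u ⋖ v` and `z ≺ v` then `z ≼ u`. -/
theorem le_cover {u v z : ℤ} (a : CoverRel r u v) (b : r z v) : z = u ∨ r z u := by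
  by_contra e
  push Not at e
  exact a.2 z ⟨(h.total _ _ e.1).resolve_left e.2, b⟩

end IsPeriodicOrder

end AffineTITO

namespace AffineTITO

/-! ### Arcs of a cyclic `c`-noncrossing arc diagram -/

namespace IsCyclicCNCAD

variable {n : ℕ} {c : Equiv.Perm ℤ} {A : Set Arc} (hA : IsCyclicCNCAD n c A) (hc : IsColoring n c)
include hA

theorem lt {p q : ℤ} (h : HasArc A p q) : p < q := by
  obtain ⟨α, hα, rfl, rfl⟩ := h
  exact (hA.isCyclicNCAD.valid α hα).lt

/-- Since the colors are disjoint and L ∪ R is the whole open interval, an arc is determined by its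
end points. This is why `HasArc` suffices from here on. -/
theorem eq_mk {α : Arc} (hα : α ∈ A) :
    α = ⟨α.p, α.q, Lbar c ∩ Set.Ioo α.p α.q, Rbar c ∩ Set.Ioo α.p α.q⟩ := by
  have hv := hA.isCyclicNCAD.valid α hα
  have hL := hA.left_subset α hα
  have hR := hA.right_subset α hα
  have hu : ∀ x, x ∈ α.L ∨ x ∈ α.R ↔ x ∈ Set.Ioo α.p α.q := fun x => by
    rw [← hv.union]; rfl
  ext x
  · rfl
  · rfl
  · refine ⟨fun h => ⟨hL h, (hu x).1 (Or.inl h)⟩, fun h => ?_⟩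
    exact ((hu x).2 h.2).resolve_right fun h' => not_L_and_R h.1 (hR h')
  · refine ⟨fun h => ⟨hR h, (hu x).1 (Or.inr h)⟩, fun h => ?_⟩
    exact ((hu x).2 h.2).resolve_left fun h' => not_L_and_R (hL h') h.1

theorem mem_of_hasArc {p q : ℤ} (h : HasArc A p q) :
    (⟨p, q, Lbar c ∩ Set.Ioo p q, Rbar c ∩ Set.Ioo p q⟩ : Arc) ∈ A := by
  obtain ⟨α, hα, rfl, rfl⟩ := h
  rw [← hA.eq_mk hα]; exact hα

/-- The colors make the intersections of left sides with right sides empty, so only the end points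
of one arc that lie over the other arc count. -/
theorem noncrossing {p q p' q' : ℤ} (h : HasArc A p q) (h' : HasArc A p' q')
    (hne : ¬ (p = p' ∧ q = q')) :
    p ≠ p' ∧ q ≠ q' ∧
    ¬ ((p' < p ∧ p < q' ∧ p ∈ Rbar c ∨ p' < q ∧ q < q' ∧ q ∈ Rbar c ∨
        p < p' ∧ p' < q ∧ p' ∈ Lbar c ∨ p < q' ∧ q' < q ∧ q' ∈ Lbar c) ∧
      (p < p' ∧ p' < q ∧ p' ∈ Rbar c ∨ p < q' ∧ q' < q ∧ q' ∈ Rbar c ∨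
        p' < p ∧ p < q' ∧ p ∈ Lbar c ∨ p' < q ∧ q < q' ∧ q ∈ Lbar c)) := by
  have := hA.isCyclicNCAD.noncrossing _ (hA.mem_of_hasArc h) _ (hA.mem_of_hasArc h')
    (fun e => hne ⟨congrArg Arc.p e, congrArg Arc.q e⟩)
  unfold Arc.Intersects at this
  simp only [not_or] at this
  refine ⟨this.1, this.2.1, fun ⟨h1, h2⟩ => this.2.2 ⟨?_, ?_⟩⟩
  · rcases h1 with h1 | h1 | h1 | h1
    · exact ⟨p, Or.inl ⟨Or.inr (Or.inl rfl), h1.2.2, h1.1, h1.2.1⟩⟩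
    · exact ⟨q, Or.inl ⟨Or.inr (Or.inr rfl), h1.2.2, h1.1, h1.2.1⟩⟩
    · exact ⟨p', Or.inr ⟨⟨h1.2.2, h1.1, h1.2.1⟩, Or.inl rfl⟩⟩
    · exact ⟨q', Or.inr ⟨⟨h1.2.2, h1.1, h1.2.1⟩, Or.inr rfl⟩⟩
  · rcases h2 with h2 | h2 | h2 | h2
    · exact ⟨p', Or.inl ⟨⟨h2.2.2, h2.1, h2.2.1⟩, Or.inr (Or.inl rfl)⟩⟩
    · exact ⟨q', Or.inl ⟨⟨h2.2.2, h2.1, h2.2.1⟩, Or.inr (Or.inr rfl)⟩⟩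
    · exact ⟨p, Or.inr ⟨Or.inl rfl, h2.2.2, h2.1, h2.2.1⟩⟩
    · exact ⟨q, Or.inr ⟨Or.inr rfl, h2.2.2, h2.1, h2.2.1⟩⟩

theorem hasArc_add {p q : ℤ} : HasArc A (p + n) (q + n) ↔ HasArc A p q := by
  constructor
  · rintro ⟨α, hα, h1, h2⟩
    refine ⟨α.translate (-n), (hA.isCyclicNCAD.translation _).2 ?_, ?_, ?_⟩
    · convert hα using 1
      ext x <;> simp [Arc.translate]
    · simp [Arc.translate, h1]
    · simp [Arc.translate, h2]
  · rintro ⟨α, hα, rfl, rfl⟩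
    exact ⟨_, (hA.isCyclicNCAD.translation α).1 hα, rfl, rfl⟩

end IsCyclicCNCAD

/-! ### The order associated with an arc diagram -/

/-- The elementary inversions: those of the smallest order having a given arc in its diagram. -/
def InvStep (c : Equiv.Perm ℤ) (A : Set Arc) (x y : ℤ) : Prop :=
  ∃ p q, HasArc A p q ∧ y < x ∧ (x = q ∨ p < x ∧ x < q ∧ x ∈ Lbar c) ∧
    (y = p ∨ p < y ∧ y < q ∧ y ∈ Rbar c)

/-- The inversions `x ≺ y` with `y < x` generated by an arc diagram. -/
def Inv (c : Equiv.Perm ℤ) (A : Set Arc) : ℤ → ℤ → Prop := Relation.TransGen (InvStep c A)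

/-- The order whose set of inversions is generated by an arc diagram. -/
def ordOf (c : Equiv.Perm ℤ) (A : Set Arc) (x y : ℤ) : Prop :=
  (x < y ∧ ¬ Inv c A y x) ∨ (y < x ∧ Inv c A x y)

theorem Inv.lt {c : Equiv.Perm ℤ} {A : Set Arc} {x y : ℤ} (h : Inv c A x y) : y < x := by
  induction h with
  | single h => exact h.choose_spec.choose_spec.2.1
  | tail _ h ih => exact lt_trans h.choose_spec.choose_spec.2.1 ih

theorem Inv.trans {c : Equiv.Perm ℤ} {A : Set Arc} {x y z : ℤ} (h : Inv c A x y)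
    (h' : Inv c A y z) : Inv c A x z := Relation.TransGen.trans h h'

/-- An inversion `(x, z)` and a point `y` of color `L` between them give an inversion `(y, z)`. -/
theorem Inv.of_mem_L {c : Equiv.Perm ℤ} {A : Set Arc} {x y z : ℤ} (h : Inv c A x z) (h1 : z < y)
    (h2 : y < x) (hy : y ∈ Lbar c) : Inv c A y z := by
  induction h using Relation.TransGen.head_induction_on with
  | single h =>
    obtain ⟨p, q, h3, h4, h5, h6⟩ := h
    refine .single ⟨p, q, h3, h1, Or.inr ⟨?_, ?_, hy⟩, h6⟩ <;> omega
  | head h h' ih =>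
    rename_i a b
    rcases lt_trichotomy y b with hb | rfl | hb
    · exact ih hb
    · exact h'
    · obtain ⟨p, q, h3, h4, h5, h6⟩ := h
      refine .head ⟨p, q, h3, hb, Or.inr ⟨?_, ?_, hy⟩, h6⟩ h' <;> omega

/-- An inversion `(x, z)` and a point `y` of color `R` between them give an inversion `(x, y)`. -/
theorem Inv.of_mem_R {c : Equiv.Perm ℤ} {A : Set Arc} {x y z : ℤ} (h : Inv c A x z) (h1 : z < y)
    (h2 : y < x) (hy : y ∈ Rbar c) : Inv c A x y := by
  induction h with
  | single h =>
    obtain ⟨p, q, h3, h4, h5, h6⟩ := h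
    refine .single ⟨p, q, h3, h2, h5, Or.inr ⟨?_, ?_, hy⟩⟩ <;> omega
  | tail h' h ih =>
    rename_i b a
    rcases lt_trichotomy y b with hb | rfl | hb
    · obtain ⟨p, q, h3, h4, h5, h6⟩ := h
      refine .tail h' ⟨p, q, h3, hb, h5, Or.inr ⟨?_, ?_, hy⟩⟩ <;> omega
    · exact h'
    · exact ih hb

section ordOf

variable {n : ℕ} {c : Equiv.Perm ℤ} {A : Set Arc} (hA : IsCyclicCNCAD n c A) (hc : IsColoring n c)
include hA hc

theorem Inv.add {x y : ℤ} (h : Inv c A x y) : Inv c A (x + n) (y + n) := by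
  refine Relation.TransGen.lift (· + (n : ℤ)) ?_ _ _ h
  rintro a b ⟨p, q, h3, h4, h5, h6⟩
  refine ⟨p + n, q + n, hA.hasArc_add.2 h3, by simpa using h4, ?_, ?_⟩
  · have e := hc.mem_L_add a 1
    rw [one_mul] at e
    exact h5.imp (fun h => by dsimp only; omega) fun h => ⟨by dsimp only; omega, by dsimp only; omega, e.2 h.2.2⟩
  · have e := hc.mem_R_add b 1
    rw [one_mul] at e
    exact h6.imp (fun h => by dsimp only; omega) fun h => ⟨by dsimp only; omega, by dsimp only; omega, e.2 h.2.2⟩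

theorem Inv.sub {x y : ℤ} (h : Inv c A x y) : Inv c A (x - n) (y - n) := by
  refine Relation.TransGen.lift (· - (n : ℤ)) ?_ _ _ h
  rintro a b ⟨p, q, h3, h4, h5, h6⟩
  refine ⟨p - n, q - n, hA.hasArc_add.1 (by simpa using h3), by simpa using h4, ?_, ?_⟩
  · have e := hc.mem_L_add a (-1)
    rw [neg_one_mul, ← sub_eq_add_neg] at e
    exact h5.imp (fun h => by dsimp only; omega) fun h => ⟨by dsimp only; omega, by dsimp only; omega, e.2 h.2.2⟩
  · have e := hc.mem_R_add b (-1)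
    rw [neg_one_mul, ← sub_eq_add_neg] at e
    exact h6.imp (fun h => by dsimp only; omega) fun h => ⟨by dsimp only; omega, by dsimp only; omega, e.2 h.2.2⟩

/-- Inversions are transitive by construction; `cot` says that their complement is transitive too,
by coloring the intermediate point. Together these are the transitivity of the order. -/
theorem isPeriodicOrder_ordOf : IsPeriodicOrder n (ordOf c A) := by
  have cot : ∀ x y z, z < y → y < x → Inv c A x z → Inv c A x y ∨ Inv c A y z := by
    intro x y z h1 h2 h
    rcases hc.L_or_R y with hy | hy
    · exact Or.inr (h.of_mem_L h1 h2 hy)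
    · exact Or.inl (h.of_mem_R h1 h2 hy)
  refine ⟨fun x h => ?_, fun x y z h h' => ?_, fun x y h => ?_, fun x y => ?_⟩
  · rcases h with h | h <;> exact lt_irrefl _ h.1
  · unfold ordOf at *
    rcases h with ⟨h1, h2⟩ | ⟨h1, h2⟩ <;> rcases h' with ⟨h3, h4⟩ | ⟨h3, h4⟩
    · refine Or.inl ⟨h1.trans h3, fun H => ?_⟩
      rcases cot _ _ _ h1 h3 H with H | H
      · exact h4 H
      · exact h2 H
    · rcases lt_trichotomy x z with h5 | rfl | h5
      · exact Or.inl ⟨h5, fun H => h2 (h4.trans H)⟩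
      · exact (h2 h4).elim
      · refine Or.inr ⟨h5, (cot _ _ _ h5 h1 h4).resolve_left h2⟩
    · rcases lt_trichotomy x z with h5 | rfl | h5
      · exact Or.inl ⟨h5, fun H => h4 (H.trans h2)⟩
      · exact (h4 h2).elim
      · refine Or.inr ⟨h5, (cot _ _ _ h3 h5 h2).resolve_right h4⟩
    · exact Or.inr ⟨h3.trans h1, h2.trans h4⟩
  · unfold ordOf
    rcases lt_or_gt_of_ne h with h1 | h1 <;> by_cases H : Inv c A x y <;>
      by_cases H' : Inv c A y x <;> simp [*]
  · unfold ordOf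
    have : ∀ u v, Inv c A (u + n) (v + n) ↔ Inv c A u v := fun u v =>
      ⟨fun h => by simpa using h.sub hA hc, fun h => h.add hA hc⟩
    rw [this, this]
    simp

/-- Descending from q by elementary inversions, one stays at points of color R over the arc p → q
until one reaches p or a point already inverted with p. Leaving the region in another way would need
an arc crossing p → q. -/
theorem inv_of_arc {p q z : ℤ} (h : HasArc A p q) (hz : Inv c A q z) :
    (p < z ∧ z < q ∧ z ∈ Rbar c) ∨ z = p ∨ Inv c A p z := by
  have key : ∀ a b, (a = q ∨ p < a ∧ a < q ∧ a ∈ Rbar c) → InvStep c A a b →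
      (p < b ∧ b < q ∧ b ∈ Rbar c) ∨ b = p ∨ Inv c A p b := by
    rintro a b ha ⟨p', q', h3, h4, h5, h6⟩
    by_cases e : p = p' ∧ q = q'
    · rcases h6 with h6 | h6
      · exact Or.inr (Or.inl (by omega))
      · exact Or.inl ⟨by omega, by omega, h6.2.2⟩
    · obtain ⟨e1, e2, h7⟩ := hA.noncrossing h h3 e
      -- The starting point a of the elementary inversion already witnesses the second half of the
      -- intersection condition, so the first half must fail.
      have h8 : ¬ (p' < p ∧ p < q' ∧ p ∈ Rbar c ∨ p < p' ∧ p' < q ∧ p' ∈ Lbar c) := by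
        rintro h8
        refine h7 ⟨h8.elim Or.inl fun h => Or.inr (Or.inr (Or.inl h)), ?_⟩
        rcases ha with rfl | ha
        · rcases h5 with h5 | h5
          · omega
          · exact Or.inr (Or.inr (Or.inr h5))
        · rcases h5 with rfl | h5
          · exact Or.inr (Or.inl ha)
          · exact (not_L_and_R h5.2.2 ha.2.2).elim
      clear h7
      rw [not_or] at h8
      have h9 := hA.lt h
      rcases lt_or_gt_of_ne e1 with h10 | h10
      · have h11 : p' ∈ Rbar c := hc.not_mem_L.1 fun H => h8.2 ⟨h10, by omega, H⟩
        refine Or.inl ⟨by omega, by omega, ?_⟩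
        rcases h6 with rfl | h6
        · exact h11
        · exact h6.2.2
      · have h11 : p ∈ Lbar c := hc.not_mem_R.1 fun H => h8.1 ⟨h10, by omega, H⟩
        rcases lt_trichotomy b p with h12 | h12 | h12
        · exact Or.inr (Or.inr (.single ⟨p', q', h3, h12, Or.inr ⟨h10, by omega, h11⟩, h6⟩))
        · exact Or.inr (Or.inl h12)
        · refine Or.inl ⟨h12, by omega, ?_⟩
          rcases h6 with rfl | h6
          · omega
          · exact h6.2.2
  induction hz with
  | single hs => exact key _ _ (Or.inl rfl) hs
  | tail _ hs ih =>
    rcases ih with ih | rfl | ih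
    · exact key _ _ (Or.inr ih) hs
    · exact Or.inr (Or.inr (.single hs))
    · exact Or.inr (Or.inr (.tail ih hs))

/-- The mirror image of `inv_of_arc`, with the two colors and the two ends exchanged. -/
theorem inv_of_arc' {p q z : ℤ} (h : HasArc A p q) (hz : Inv c A z p) :
    (p < z ∧ z < q ∧ z ∈ Lbar c) ∨ z = q ∨ Inv c A z q := by
  have key : ∀ b a, (a = p ∨ p < a ∧ a < q ∧ a ∈ Lbar c) → InvStep c A b a →
      (p < b ∧ b < q ∧ b ∈ Lbar c) ∨ b = q ∨ Inv c A b q := by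
    rintro b a ha ⟨p', q', h3, h4, h6, h5⟩
    by_cases e : p = p' ∧ q = q'
    · rcases h6 with h6 | h6
      · exact Or.inr (Or.inl (by omega))
      · exact Or.inl ⟨by omega, by omega, h6.2.2⟩
    · obtain ⟨e1, e2, h7⟩ := hA.noncrossing h h3 e
      have h8 : ¬ (p' < q ∧ q < q' ∧ q ∈ Lbar c ∨ p < q' ∧ q' < q ∧ q' ∈ Rbar c) := by
        rintro h8
        refine h7 ⟨?_, h8.elim (fun h => Or.inr (Or.inr (Or.inr h))) fun h => Or.inr (Or.inl h)⟩
        rcases ha with rfl | ha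
        · rcases h5 with h5 | h5
          · omega
          · exact Or.inl h5
        · rcases h5 with rfl | h5
          · exact Or.inr (Or.inr (Or.inl ha))
          · exact (not_L_and_R ha.2.2 h5.2.2).elim
      clear h7
      rw [not_or] at h8
      have h9 := hA.lt h
      rcases lt_or_gt_of_ne e2 with h10 | h10
      · have h11 : q ∈ Rbar c := hc.not_mem_L.1 fun H => h8.1 ⟨by omega, h10, H⟩
        rcases lt_trichotomy b q with h12 | h12 | h12
        · refine Or.inl ⟨by omega, h12, ?_⟩
          rcases h6 with rfl | h6
          · omega
          · exact h6.2.2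
        · exact Or.inr (Or.inl h12)
        · exact Or.inr (Or.inr (.single ⟨p', q', h3, h12, h6, Or.inr ⟨by omega, h10, h11⟩⟩))
      · have h11 : q' ∈ Lbar c := hc.not_mem_R.1 fun H => h8.2 ⟨by omega, h10, H⟩
        refine Or.inl ⟨by omega, by omega, ?_⟩
        rcases h6 with rfl | h6
        · exact h11
        · exact h6.2.2
  induction hz using Relation.TransGen.head_induction_on with
  | single hs => exact key _ _ (Or.inl rfl) hs
  | head hs _ ih =>
    rcases ih with ih | rfl | ih
    · exact key _ _ (Or.inr ih) hs
    · exact Or.inr (Or.inr (.single hs))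
    · exact Or.inr (Or.inr (.head hs ih))

omit hc in
theorem invStep_of_arc {p q : ℤ} (h : HasArc A p q) : InvStep c A q p :=
  ⟨p, q, h, hA.lt h, Or.inl rfl, Or.inl rfl⟩

/-- An element between q and p with value outside ]p, q[ is excluded by one of the two preceding
lemmas; with value inside, it would have both colors. -/
theorem coverRel_ordOf_of_hasArc {p q : ℤ} (h : HasArc A p q) : CoverRel (ordOf c A) q p := by
  have hlt := hA.lt h
  refine ⟨Or.inr ⟨hlt, .single (invStep_of_arc hA h)⟩, fun z hz => ?_⟩
  rcases hz with ⟨⟨h1, h2⟩ | ⟨h1, h2⟩, ⟨h3, h4⟩ | ⟨h3, h4⟩⟩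
  · omega
  · rcases inv_of_arc' hA hc h h4 with h5 | h5 | h5
    · omega
    · omega
    · exact h2 h5
  · rcases inv_of_arc hA hc h h2 with h5 | h5 | h5
    · omega
    · omega
    · exact h4 h5
  · rcases inv_of_arc hA hc h h2 with h5 | h5 | h5
    · rcases inv_of_arc' hA hc h h4 with h6 | h6 | h6
      · exact not_L_and_R h6.2.2 h5.2.2
      · omega
      · have := h6.lt; omega
    · omega
    · have := h5.lt; omega

/-- A covering inversion cannot be a composite, so it is elementary, for some arc p' → q'. Then q ≼
q' ≺ p' ≼ p, and the covering property forces equalities. -/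
theorem hasArc_of_coverRel_ordOf {p q : ℤ} (hlt : p < q) (h : CoverRel (ordOf c A) q p) :
    HasArc A p q := by
  have hI : Inv c A q p := by
    rcases h.1 with h1 | h1
    · omega
    · exact h1.2
  have hs : InvStep c A q p := by
    rcases Relation.TransGen.head'_iff.1 hI with ⟨b, h1, h2⟩
    rcases Relation.reflTransGen_iff_eq_or_transGen.1 h2 with h2 | h2
    · rwa [h2]
    · have h3 : Inv c A q b := .single h1
      exact (h.2 b ⟨Or.inr ⟨h3.lt, h3⟩, Or.inr ⟨Inv.lt h2, h2⟩⟩).elim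
  obtain ⟨p', q', h3, h4, h5, h6⟩ := hs
  have hcov := coverRel_ordOf_of_hasArc hA hc h3
  have hT := isPeriodicOrder_ordOf hA hc
  have hq : q = q' ∨ ordOf c A q q' := by
    refine h5.imp_right fun h5 => Or.inl ⟨h5.2.1, fun H => ?_⟩
    rcases inv_of_arc hA hc h3 H with h7 | h7 | h7
    · exact not_L_and_R h5.2.2 h7.2.2
    · omega
    · have := h7.lt; omega
  have hp : p = p' ∨ ordOf c A p' p := by
    refine h6.imp_right fun h6 => Or.inl ⟨h6.1, fun H => ?_⟩
    rcases inv_of_arc' hA hc h3 H with h7 | h7 | h7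
    · exact not_L_and_R h7.2.2 h6.2.2
    · omega
    · have := h7.lt; omega
  have hqp : q = q' := by
    refine hq.resolve_right fun H => h.2 q' ⟨H, ?_⟩
    rcases hp with rfl | hp
    · exact hcov.1
    · exact hT.trans _ _ _ hcov.1 hp
  subst hqp
  have hpp : p = p' := hp.resolve_right fun H => h.2 p' ⟨hcov.1, H⟩
  rwa [hpp]

theorem ncad_ordOf : ncad (ordOf c A) = A := by
  have harc : ∀ p q, HasArc A p q →
      arcOf (ordOf c A) p q = ⟨p, q, Lbar c ∩ Set.Ioo p q, Rbar c ∩ Set.Ioo p q⟩ := by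
    intro p q h
    ext x
    · rfl
    · rfl
    · constructor
      · rintro ⟨h1, h2, h3⟩
        refine ⟨hc.not_mem_R.1 fun H => ?_, h1, h2⟩
        have : Inv c A q x := .single ⟨p, q, h, h2, Or.inl rfl, Or.inr ⟨h1, h2, H⟩⟩
        rcases h3 with h3 | h3
        · exact h3.2 this
        · omega
      · rintro ⟨H, h1, h2⟩
        refine ⟨h1, h2, Or.inl ⟨h2, fun H' => ?_⟩⟩
        rcases inv_of_arc hA hc h H' with h7 | h7 | h7
        · exact not_L_and_R H h7.2.2
        · omega
        · have := h7.lt; omega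
    · constructor
      · rintro ⟨h1, h2, h3⟩
        refine ⟨hc.not_mem_L.1 fun H => ?_, h1, h2⟩
        have : Inv c A x p := .single ⟨p, q, h, h1, Or.inr ⟨h1, h2, H⟩, Or.inl rfl⟩
        rcases h3 with h3 | h3
        · exact h3.2 this
        · omega
      · rintro ⟨H, h1, h2⟩
        refine ⟨h1, h2, Or.inl ⟨h1, fun H' => ?_⟩⟩
        rcases inv_of_arc' hA hc h H' with h7 | h7 | h7
        · exact not_L_and_R h7.2.2 H
        · omega
        · have := h7.lt; omega
  refine Set.Subset.antisymm ?_ ?_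
  · rintro α ⟨p, q, h1, h2, rfl⟩
    have h := hasArc_of_coverRel_ordOf hA hc h1 h2
    rw [harc p q h]
    exact hA.mem_of_hasArc h
  · intro α hα
    have h : HasArc A α.p α.q := ⟨α, hα, rfl, rfl⟩
    refine ⟨α.p, α.q, hA.lt h, coverRel_ordOf_of_hasArc hA hc h, ?_⟩
    rw [harc _ _ h]
    exact hA.eq_mk hα

omit hA hc in
theorem ordOf_avoids_kij {i j k : ℤ} (hij : i < j) (hjk : j < k) (hj : j ∈ Lbar c) :
    ¬ (ordOf c A k i ∧ ordOf c A i j) := by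
  rintro ⟨h1 | h1, h2 | h2⟩
  · omega
  · omega
  · exact h2.2 (h1.2.of_mem_L hij hjk hj)
  · omega

omit hA hc in
theorem ordOf_avoids_jki {i j k : ℤ} (hij : i < j) (hjk : j < k) (hj : j ∈ Rbar c) :
    ¬ (ordOf c A j k ∧ ordOf c A k i) := by
  rintro ⟨h1 | h1, h2 | h2⟩
  · omega
  · exact h1.2 (h2.2.of_mem_R hij hjk hj)
  · omega
  · omega

/-- Such a covering relation would make x + nℤ a loop, all of whose points have the color of x. -/
theorem ordOf_real (hn : 0 < n) (x : ℤ) : ¬ CoverRel (ordOf c A) (x + n) x := by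
  intro h
  have harc := hasArc_of_coverRel_ordOf hA hc (by omega) h
  have hall : ∀ i : ℤ, HasArc A (x + i * n) (x + (i + 1) * n) := by
    intro i
    have := hasArc_of_coverRel_ordOf hA hc (by omega)
      (((isPeriodicOrder_ordOf hA hc).cover_tr i (x + n) x).2 h)
    rwa [show x + n + i * n = x + (i + 1) * n by ring] at this
  have := hA.real_loop _ ⟨fun i => x + i * n, hall, rfl⟩
  rcases hc.L_or_R x with hx | hx
  · refine this.1 ?_
    rintro _ ⟨i, rfl⟩
    exact (hc.mem_L_add x i).2 hx
  · refine this.2 ?_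
    rintro _ ⟨i, rfl⟩
    exact (hc.mem_R_add x i).2 hx

end ordOf

end AffineTITO

/-! ### Blocks: finite and infinite distance -/

namespace AffineTITO

namespace IsPeriodicOrder

variable {n : ℕ} {r : ℤ → ℤ → Prop} (h : IsPeriodicOrder n r)
include h

theorem between_wax (hn : 0 < n) {x u : ℤ} {k : ℤ} (hk : 0 ≤ k) (h1 : r x u)
    (h2 : r u (x + k * n)) : r u (u + n) := by
  refine (h.wax_or_wane hn u).resolve_right fun hu => ?_
  rcases hk.eq_or_lt with rfl | hk
  · exact h.asymm h1 (by simpa using h2)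
  · exact h.asymm h2 (h.trans _ _ _ ((h.tr k _ _).2 h1) (h.wane_mul hu hk))

theorem between_wane (hn : 0 < n) {x u : ℤ} {k : ℤ} (hk : 0 ≤ k) (h1 : r (x + k * n) u)
    (h2 : r u x) : r (u + n) u := by
  have := h.reverse.between_wax hn hk h2 h1
  exact this

theorem wax_of_mul (hn : 0 < n) {x k : ℤ} (hk : 0 ≤ k) (h1 : r x (x + k * n)) : r x (x + n) := by
  refine (h.wax_or_wane hn x).resolve_right fun hu => ?_
  rcases hk.eq_or_lt with rfl | hk
  · exact h.irrefl x (by simpa using h1)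
  · exact h.asymm h1 (h.wane_mul hu hk)

theorem wane_of_mul (hn : 0 < n) {x k : ℤ} (hk : 0 ≤ k) (h1 : r (x + k * n) x) : r (x + n) x :=
  h.reverse.wax_of_mul hn hk h1

omit h in
theorem finiteDistance_symm {x y : ℤ} (hf : FiniteDistance r x y) : FiniteDistance r y x :=
  ⟨hf.2, hf.1⟩

/-- If y precedes no translate of x, all the translates of x precede y and infinitely many of them
lie between x and y. Conversely the interval between two translates of a point is finite. -/
theorem finiteDistance_iff (hn : 0 < n) {x y : ℤ} (hxy : r x y) :
    FiniteDistance r x y ↔ ∃ k : ℤ, r y (x + k * n) := by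
  have hemp : {z | r y z ∧ r z x} = ∅ := by
    refine Set.eq_empty_of_forall_notMem fun z hz => ?_
    exact h.asymm hxy (h.trans _ _ _ hz.1 hz.2)
  constructor
  · intro hf
    by_contra hcon
    push Not at hcon
    have hall : ∀ k : ℤ, r (x + k * n) y := by
      intro k
      -- If y is itself a translate of x, its neighbor among the translates in the increasing
      -- direction of r follows y, against `hcon`.
      by_cases e : x + k * n = y
      · rcases h.wax_or_wane hn y with hy | hy
        · refine (hcon (k + 1) ?_).elim
          rwa [show x + (k + 1) * n = y + n by rw [← e]; ring]
        · refine (hcon (k - 1) ?_).elim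
          rw [show x + (k - 1) * n = y - n by rw [← e]; ring]
          rw [h.translation]; simpa using hy
      · exact (h.total _ _ e).resolve_right (hcon k)
    have hinj : ∀ a b : ℤ, x + a * n = x + b * n → a = b := by
      intro a b e
      have : (n : ℤ) ≠ 0 := by omega
      exact mul_right_cancel₀ this (by linarith)
    rcases h.wax_or_wane hn x with hx | hx
    · refine Set.infinite_of_injective_forall_mem (f := fun k : ℕ => x + ((k : ℤ) + 1) * n)
        (fun a b e => ?_) (fun k => ?_) hf.1
      · have := hinj _ _ e; omega
      · exact ⟨h.wax_mul hx (by omega), hall _⟩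
    · refine Set.infinite_of_injective_forall_mem (f := fun k : ℕ => x + (-(k : ℤ) - 1) * n)
        (fun a b e => ?_) (fun k => ?_) hf.1
      · have := hinj _ _ e; omega
      · refine ⟨?_, hall _⟩
        have := h.wane_mul ((h.wane_tr x (-(k : ℤ) - 1)).2 hx) (k := k + 1) (by omega)
        ring_nf at this ⊢
        exact this
  · rintro ⟨k, hk⟩
    refine ⟨?_, by rw [hemp]; exact Set.finite_empty⟩
    have hx := h.trans _ _ _ hxy hk
    rcases le_or_gt 0 k with hk0 | hk0
    · obtain ⟨m, rfl⟩ := Int.eq_ofNat_of_zero_le hk0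
      exact (h.finite_wax hn x m).subset fun z hz => ⟨hz.1, h.trans _ _ _ hz.2 hk⟩
    · obtain ⟨m, hm⟩ := Int.eq_ofNat_of_zero_le (show 0 ≤ -k by omega)
      obtain rfl : k = -m := by omega
      have hy : r (y + (m : ℕ) * n) x := by
        have := (h.tr m _ _).2 hk
        simpa using this
      exact (h.finite_wane hn y m).subset fun z hz => ⟨h.trans _ _ _ hy hz.1, hz.2⟩

end IsPeriodicOrder

/-- `x` and all its translates precede `y`. -/
def Far (n : ℕ) (r : ℤ → ℤ → Prop) (x y : ℤ) : Prop := ∀ k : ℤ, r (x + k * n) y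

namespace IsPeriodicOrder

variable {n : ℕ} {r : ℤ → ℤ → Prop} (h : IsPeriodicOrder n r)
include h

theorem Far.tr {x y : ℤ} (hf : Far n r x y) (j k : ℤ) : r (x + j * n) (y + k * n) := by
  have := (h.tr k _ _).2 (hf (j - k))
  rwa [show x + (j - k) * n + k * n = x + j * n by ring] at this

theorem Far.trans_right {x y z : ℤ} (hf : Far n r x y) (hz : r y z) : Far n r x z :=
  fun k => h.trans _ _ _ (hf k) hz

theorem Far.trans_left {x y z : ℤ} (hf : Far n r y z) (hz : r x y) : Far n r x z :=
  fun k => h.trans _ _ _ ((h.tr k _ _).2 hz) (hf k)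

/-- Infinite distance is uniform: it does not depend on the translates chosen. This is what allows
blocks to be compared through arbitrary translates of their elements. -/
theorem finiteDistance_or_far (hn : 0 < n) (x y : ℤ) :
    FiniteDistance r x y ∨ Far n r x y ∨ Far n r y x := by
  have key : ∀ x y, r x y → FiniteDistance r x y ∨ Far n r x y := by
    intro x y hxy
    by_cases hf : FiniteDistance r x y
    · exact Or.inl hf
    · refine Or.inr fun k => ?_
      have hk : ∀ k, ¬ r y (x + k * n) := fun k hk => hf ((h.finiteDistance_iff hn hxy).2 ⟨k, hk⟩)
      by_cases e : x + k * n = y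
      · exfalso
        rcases h.wax_or_wane hn y with hy | hy
        · refine (hk (k + 1) ?_).elim
          rwa [show x + (k + 1) * n = y + n by rw [← e]; ring]
        · refine (hk (k - 1) ?_).elim
          rw [show x + (k - 1) * n = y - n by rw [← e]; ring]
          rw [h.translation]; simpa using hy
      · exact (h.total _ _ e).resolve_right (hk k)
  by_cases e : x = y
  · subst e
    left
    have : {z | r x z ∧ r z x} = ∅ :=
      Set.eq_empty_of_forall_notMem fun z hz => h.asymm hz.1 hz.2
    exact ⟨this ▸ Set.finite_empty, this ▸ Set.finite_empty⟩
  · rcases h.total _ _ e with e | e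
    · exact (key _ _ e).imp_right Or.inl
    · exact (key _ _ e).imp finiteDistance_symm Or.inr

theorem Far.not_finiteDistance (hn : 0 < n) {x y : ℤ} (hf : Far n r x y) :
    ¬ FiniteDistance r x y := by
  intro H
  obtain ⟨k, hk⟩ := (h.finiteDistance_iff hn (by simpa using hf 0)).1 H
  exact h.asymm hk (hf k)

theorem wax_of_finiteDistance (hn : 0 < n) {x y : ℤ} (hf : FiniteDistance r x y)
    (hx : r x (x + n)) : r y (y + n) := by
  have key : ∀ x y, r x y → FiniteDistance r x y → (r x (x + n) ↔ r y (y + n)) := by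
    intro x y hxy hf
    obtain ⟨k, hk⟩ := (h.finiteDistance_iff hn hxy).1 hf
    rcases le_or_gt 0 k with hk0 | hk0
    · exact iff_of_true (h.wax_of_mul hn hk0 (h.trans _ _ _ hxy hk)) (h.between_wax hn hk0 hxy hk)
    · have e : x + k * n + (-k) * n = x := by ring
      have h1 := h.between_wane hn (x := x + k * n) (k := -k) (by omega) (by rwa [e]) hk
      have h2 := h.wane_of_mul hn (x := x + k * n) (k := -k) (by omega)
        (by rw [e]; exact h.trans _ _ _ hxy hk)
      exact iff_of_false (fun H => h.asymm H ((h.wane_tr x k).1 h2)) (fun H => h.asymm H h1)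
  by_cases e : x = y
  · rwa [← e]
  · rcases h.total _ _ e with e | e
    · exact (key _ _ e hf).1 hx
    · exact (key _ _ e (finiteDistance_symm hf)).2 hx

theorem wane_of_finiteDistance (hn : 0 < n) {x y : ℤ} (hf : FiniteDistance r x y)
    (hx : r (x + n) x) : r (y + n) y :=
  (h.wax_or_wane hn y).resolve_left fun H =>
    h.asymm hx (h.wax_of_finiteDistance hn (finiteDistance_symm hf) H)

theorem finiteDistance_trans {x y z : ℤ} (h1 : FiniteDistance r x y)
    (h2 : FiniteDistance r y z) : FiniteDistance r x z := by
  have key : ∀ a b d : ℤ, {w | r a w ∧ r w d} ⊆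
      {w | r a w ∧ r w b} ∪ {b} ∪ {w | r b w ∧ r w d} := by
    rintro a b d w ⟨hw1, hw2⟩
    by_cases e : w = b
    · exact Or.inl (Or.inr e)
    · rcases h.total _ _ e with e | e
      · exact Or.inl (Or.inl ⟨hw1, e⟩)
      · exact Or.inr ⟨e, hw2⟩
  exact ⟨((h1.1.union (Set.finite_singleton y)).union h2.1).subset (key x y z),
    ((h2.2.union (Set.finite_singleton y)).union h1.2).subset (key z y x)⟩

theorem Far.of_finiteDistance_right (hn : 0 < n) {x y z : ℤ} (hf : Far n r x y)
    (hz : FiniteDistance r y z) : Far n r x z := by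
  rcases h.finiteDistance_or_far hn x z with H | H | H
  · exact (Far.not_finiteDistance h hn hf
      (h.finiteDistance_trans H (finiteDistance_symm hz))).elim
  · exact H
  · exact (Far.not_finiteDistance h hn (Far.trans_right h H (by simpa using hf 0))
      (finiteDistance_symm hz)).elim

theorem Far.of_finiteDistance_left (hn : 0 < n) {x y z : ℤ} (hf : Far n r y z)
    (hz : FiniteDistance r x y) : Far n r x z := by
  rcases h.finiteDistance_or_far hn x z with H | H | H
  · exact (Far.not_finiteDistance h hn hf
      (h.finiteDistance_trans (finiteDistance_symm hz) H)).elim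
  · exact H
  · exact (Far.not_finiteDistance h hn (Far.trans_left h H (by simpa using hf 0))
      (finiteDistance_symm hz)).elim

omit h in
theorem infinite_of_closed (hn : 0 < n) {I : Set ℤ} {x : ℤ} (hI : ∀ k : ℤ, x + k * n ∈ I) :
    I.Infinite := by
  refine Set.infinite_of_injective_forall_mem (f := fun k : ℤ => x + k * n) (fun a b e => ?_) hI
  have h0 : (n : ℤ) ≠ 0 := by omega
  exact mul_right_cancel₀ h0 (by simpa using e)

theorem finiteDistance_tr (hn : 0 < n) (x k : ℤ) : FiniteDistance r x (x + k * n) := by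
  have hno : ∀ j j' : ℤ, ¬ Far n r (x + j * n) (x + j' * n) := fun j j' hf => by
    have := hf (j' - j)
    rw [show x + j * n + (j' - j) * n = x + j' * n by ring] at this
    exact h.irrefl _ this
  rcases h.finiteDistance_or_far hn x (x + k * n) with H | H | H
  · exact H
  · exact (hno 0 k (by simpa using H)).elim
  · exact (hno k 0 (by simpa using H)).elim

/-- An element that is not isolated from below has an immediate predecessor. -/
theorem exists_pred (hn : 0 < n) (x : ℤ) : ∃ u, CoverRel r u x ∧ FiniteDistance r x u := by
  have key : ∀ k : ℤ, r (x + k * n) x → ∃ u, CoverRel r u x ∧ FiniteDistance r x u := by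
    intro k hk
    have hf := h.finiteDistance_tr hn x k
    obtain ⟨u, v, h1, h2, h3, h4, h5⟩ := h.exists_cover_of_finite hk hf.2 (· ≠ x) (h.ne hk)
      (by simp)
    simp only [ne_eq, not_not] at h3
    subst h3
    refine ⟨u, h1, finiteDistance_symm ?_⟩
    rw [h.finiteDistance_iff hn h1.1]
    rcases h4 with h4 | h4
    · refine ⟨-k - k, ?_⟩
      rw [h4, show v + k * n + (-k - k) * n = v + (-k) * n by ring]
      have := (h.tr (-k) _ _).2 hk
      simpa using this
    · refine ⟨-k, ?_⟩
      have := (h.tr (-k) _ _).2 h4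
      simpa using this
  rcases h.wax_or_wane hn x with hx | hx
  · refine key (-1) ?_
    rw [h.translation]; simpa using hx
  · exact key 1 (by simpa using hx)

theorem exists_succ (hn : 0 < n) (x : ℤ) : ∃ u, CoverRel r x u ∧ FiniteDistance r x u := by
  obtain ⟨u, h1, h2⟩ := h.reverse.exists_pred hn x
  exact ⟨u, ⟨h1.1, fun z hz => h1.2 z ⟨hz.2, hz.1⟩⟩, by simpa only [FiniteDistance, and_comm] using h2⟩

end IsPeriodicOrder

theorem hasArc_ncad {r : ℤ → ℤ → Prop} {p q : ℤ} :
    HasArc (ncad r) p q ↔ p < q ∧ CoverRel r q p := by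
  constructor
  · rintro ⟨_, ⟨p, q, h1, h2, rfl⟩, rfl, rfl⟩
    exact ⟨h1, h2⟩
  · rintro ⟨h1, h2⟩
    exact ⟨_, ⟨p, q, h1, h2, rfl⟩, rfl, rfl⟩

theorem exists_arcLoop {A : Set Arc} {B : Set ℤ} {z : ℤ} (hz : z ∈ B)
    (hup : ∀ x ∈ B, ∃ y ∈ B, HasArc A x y) (hdown : ∀ x ∈ B, ∃ y ∈ B, HasArc A y x) :
    ∃ f : ℤ → ℤ, (∀ i, HasArc A (f i) (f (i + 1))) ∧ (∀ i, f i ∈ B) ∧ f 0 = z := by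
  choose! u hu hu' using hup
  choose! d hd hd' using hdown
  have hU : ∀ k : ℕ, u^[k] z ∈ B := fun k => by
    induction k with
    | zero => exact hz
    | succ k ih => rw [Function.iterate_succ_apply']; exact hu _ ih
  have hD : ∀ k : ℕ, d^[k] z ∈ B := fun k => by
    induction k with
    | zero => exact hz
    | succ k ih => rw [Function.iterate_succ_apply']; exact hd _ ih
  refine ⟨fun i => if 0 ≤ i then u^[i.toNat] z else d^[(-i).toNat] z, fun i => ?_, fun i => ?_, ?_⟩
  · dsimp only
    rcases le_or_gt 0 i with hi | hi
    · rw [if_pos hi, if_pos (by omega), show (i + 1).toNat = i.toNat + 1 by omega,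
        Function.iterate_succ_apply']
      exact hu' _ (hU _)
    · rw [if_neg (by omega)]
      have e : (-i).toNat = (-(i + 1)).toNat + 1 := by omega
      rw [e, Function.iterate_succ_apply']
      by_cases hi' : 0 ≤ i + 1
      · obtain rfl : i = -1 := by omega
        simpa using hd' _ hz
      · rw [if_neg hi']
        exact hd' _ (hD _)
  · dsimp only
    split_ifs
    · exact hU _
    · exact hD _
  · simp

/-! ### Pattern avoidance and shapes -/

/-- The orders satisfying the condition on patterns in the definition of `c`-sortable orders. -/
structure AvoidsPatterns (n : ℕ) (c : Equiv.Perm ℤ) (r : ℤ → ℤ → Prop) : Prop extends IsPeriodicOrder n r where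
  pos : 0 < n
  col : IsColoring n c
  kij : ∀ {i j k : ℤ}, i < j → j < k → j ∈ Lbar c → r k i → r i j → False
  jki : ∀ {i j k : ℤ}, i < j → j < k → j ∈ Rbar c → r j k → r k i → False

theorem exists_int_mul_gt {n : ℕ} (hn : 0 < n) (x y : ℤ) : ∃ k : ℤ, 0 < k ∧ y < x + k * n := by
  refine ⟨|y - x| + 1, by positivity, ?_⟩
  have h1 := le_abs_self (y - x)
  have h2 : (1 : ℤ) ≤ n := by omega
  have h3 := abs_nonneg (y - x)
  nlinarith

theorem exists_int_mul_lt {n : ℕ} (hn : 0 < n) (x y : ℤ) : ∃ k : ℤ, 0 < k ∧ x - k * n < y := by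
  obtain ⟨k, h1, h2⟩ := exists_int_mul_gt hn y x
  exact ⟨k, h1, by linarith⟩

namespace AvoidsPatterns

variable {n : ℕ} {c : Equiv.Perm ℤ} {r : ℤ → ℤ → Prop} (h : AvoidsPatterns n c r)
include h

/-- In this lemma and the next three, `Far` allows the translates to be chosen as large or as small
as desired without changing the order between the two points; a wrong color then yields a forbidden
pattern. -/
theorem far_right_of_wax {x y : ℤ} (hf : Far n r x y) (hy : r y (y + n)) : y ∈ Rbar c := by
  refine h.col.not_mem_L.1 fun hL => ?_
  obtain ⟨m, -, hm⟩ := exists_int_mul_gt h.pos x y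
  refine h.kij (i := y - n) (j := y) (k := x + m * n) (by have := h.pos; omega) hm hL ?_ ?_
  · have := IsPeriodicOrder.Far.tr h.toIsPeriodicOrder hf m (-1)
    simpa [sub_eq_add_neg] using this
  · rw [h.translation]; simpa using hy

theorem far_right_of_wane {x y : ℤ} (hf : Far n r x y) (hx : r (x + n) x) : y ∈ Rbar c := by
  refine h.col.not_mem_L.1 fun hL => ?_
  obtain ⟨m, hm0, hm⟩ := exists_int_mul_gt h.pos x y
  obtain ⟨l, hl0, hl⟩ := exists_int_mul_lt h.pos x y
  refine h.kij (i := x - l * n) (j := y) (k := x + m * n) hl hm hL ?_ ?_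
  · have := h.wane_mul ((h.wane_tr x (-l)).2 hx) (k := l + m) (by omega)
    ring_nf at this ⊢
    exact this
  · have := hf (-l)
    ring_nf at this ⊢
    exact this

theorem far_left_of_wax {x y : ℤ} (hf : Far n r x y) (hx : r x (x + n)) : x ∈ Lbar c := by
  refine h.col.not_mem_R.1 fun hR => ?_
  obtain ⟨l, -, hl⟩ := exists_int_mul_lt h.pos y x
  refine h.jki (i := y - l * n) (j := x) (k := x + n) hl (by have := h.pos; omega) hR hx ?_
  have := IsPeriodicOrder.Far.tr h.toIsPeriodicOrder hf 1 (-l)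
  ring_nf at this ⊢
  exact this

theorem far_left_of_wane {x y : ℤ} (hf : Far n r x y) (hy : r (y + n) y) : x ∈ Lbar c := by
  refine h.col.not_mem_R.1 fun hR => ?_
  obtain ⟨m, hm0, hm⟩ := exists_int_mul_gt h.pos y x
  obtain ⟨l, hl0, hl⟩ := exists_int_mul_lt h.pos y x
  refine h.jki (i := y - l * n) (j := x) (k := y + m * n) hl hm hR ?_ ?_
  · simpa using IsPeriodicOrder.Far.tr h.toIsPeriodicOrder hf 0 m
  · have := h.wane_mul ((h.wane_tr y (-l)).2 hy) (k := l + m) (by omega)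
    ring_nf at this ⊢
    exact this

/-- In a waning block, a covering relation whose terms have the same color is a descent. -/
theorem lt_of_cover_of_wane {u v : ℤ} (hc : CoverRel r u v) (hv : r (v + n) v)
    (h' : v ∈ Lbar c ∨ u ∈ Rbar c) : v < u := by
  have hne := h.ne hc.1
  have hvu : v + n = u ∨ r (v + n) u := h.le_cover hc hv
  by_contra hcon
  have hlt : u < v := by omega
  have hfd : FiniteDistance r v u := by
    refine IsPeriodicOrder.finiteDistance_symm ((h.finiteDistance_iff h.pos hc.1).2 ?_)
    rcases hvu with rfl | hvu
    · have := h.pos; omega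
    · refine ⟨-1, ?_⟩
      have := (h.tr (-1) _ _).2 hvu
      simpa using this
  have hu := h.wane_of_finiteDistance h.pos hfd hv
  rcases h' with h' | h'
  · refine h.kij (i := u) (j := v) (k := v + 2 * n) hlt (by have := h.pos; omega) h' ?_ hc.1
    have h1 : r (v + 2 * n) (v + n) := by
      have := (h.wane_tr v 1).2 hv
      ring_nf at this ⊢
      exact this
    rcases hvu with rfl | hvu
    · exact h1
    · exact h.trans _ _ _ h1 hvu
  · refine h.jki (i := u - 2 * n) (j := u) (k := v) (by have := h.pos; omega) hlt h' hc.1 ?_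
    have h1 : r (u - n) (u - 2 * n) := by
      have := (h.wane_tr u (-2)).2 hu
      ring_nf at this ⊢
      exact this
    rcases hvu with rfl | hvu
    · have := h.pos; omega
    · refine h.trans _ _ _ ?_ h1
      rw [h.translation]; simpa using hvu

/-- Every element of a block has an immediate predecessor and an immediate successor in the block.
In a waning block of one color these covering relations are all descents, so arcs continue in both
directions. -/
theorem exists_loop_of_wane {B : Set ℤ} {z : ℤ} (hz : z ∈ B) (hw : ∀ x ∈ B, r (x + n) x)
    (hB : ∀ x ∈ B, ∀ y, FiniteDistance r x y → y ∈ B) (hcol : B ⊆ Lbar c ∨ B ⊆ Rbar c) :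
    ∃ γ ⊆ B, IsArcLoop (ncad r) γ := by
  obtain ⟨f, h1, h2, h3⟩ := exists_arcLoop (A := ncad r) hz
    (by
      intro x hx
      obtain ⟨u, hu, hf⟩ := h.exists_pred h.pos x
      have huB := hB x hx u hf
      exact ⟨u, huB, hasArc_ncad.2 ⟨h.lt_of_cover_of_wane hu (hw x hx)
        (hcol.imp (fun H => H hx) (fun H => H huB)), hu⟩⟩)
    (by
      intro x hx
      obtain ⟨u, hu, hf⟩ := h.exists_succ h.pos x
      have huB := hB x hx u hf
      exact ⟨u, huB, hasArc_ncad.2 ⟨h.lt_of_cover_of_wane hu (hw u huB)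
        (hcol.imp (fun H => H huB) (fun H => H hx)), hu⟩⟩)
  refine ⟨Set.range f, ?_, f, h1, rfl⟩
  rintro _ ⟨i, rfl⟩
  exact h2 i

/-- Relative to a waning block, the blocks before it have color L and those after it have color R. A
second waxing block on one side would have an end of the wrong color, and a second waning block
would contain a loop of one color. Without waning elements the patterns do not exclude a waxing
block of color L followed by one of color R, hence the hypothesis `hwax`. -/
theorem isSortable (hreal : ∀ x, ¬ CoverRel r (x + n) x)
    (hloop : ∀ γ, IsArcLoop (ncad r) γ → ¬ γ ⊆ Lbar c ∧ ¬ γ ⊆ Rbar c)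
    (hwax : (∀ x, r x (x + n)) → ∀ x y, ¬ Far n r x y) : IsSortable n c r := by
  refine ⟨⟨h.irrefl, h.trans, h.total, h.translation, hreal⟩, ?_,
    fun i j k a b d e => h.kij a b d e.1 e.2, fun i j k a b d e => h.jki a b d e.1 e.2⟩
  have hn := h.pos
  have hinf : ∀ {I : Set ℤ} {x : ℤ}, x ∈ I → (∀ y ∈ I, ∀ z, z ∈ I ↔ FiniteDistance r y z) →
      IsBlock r I := fun {I x} hx hI =>
    ⟨IsPeriodicOrder.infinite_of_closed hn (x := x) fun k => (hI x hx _).2 (h.finiteDistance_tr hn x k), hI⟩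
  by_cases hall : ∀ x, r x (x + n)
  · left
    refine ⟨?_, by simp, fun x => ⟨_, List.mem_singleton_self _, trivial⟩⟩
    intro b hb
    obtain rfl := List.mem_singleton.1 hb
    refine Or.inr ⟨hinf (x := 0) trivial fun x _ y => iff_of_true trivial ?_, fun x _ => hall x⟩
    rcases h.finiteDistance_or_far hn x y with H | H | H
    · exact H
    · exact (hwax hall _ _ H).elim
    · exact (hwax hall _ _ H).elim
  · right
    push Not at hall
    obtain ⟨w, hw⟩ := hall
    have hw : r (w + n) w := (h.wax_or_wane hn w).resolve_left hw
    -- Of two waning blocks, the second would be contained in `Rbar c`, hence contain a forbidden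
    -- loop.
    have hM : ∀ x y, r (x + n) x → r (y + n) y → FiniteDistance r x y := by
      have key : ∀ x y, r (x + n) x → r (y + n) y → ¬ Far n r x y := by
        intro x y hx hy hf
        have hR : {z | FiniteDistance r y z} ⊆ Rbar c := fun z hz =>
          h.far_right_of_wane (IsPeriodicOrder.Far.of_finiteDistance_right h.toIsPeriodicOrder hn hf hz) hx
        obtain ⟨γ, h1, h2⟩ := h.exists_loop_of_wane (B := {z | FiniteDistance r y z}) (z := y)
          (by simpa using h.finiteDistance_tr hn y 0)
          (fun z hz => h.wane_of_finiteDistance hn hz hy)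
          (fun z hz z' hz' => h.finiteDistance_trans hz hz') (Or.inr hR)
        exact (hloop γ h2).2 (h1.trans hR)
      intro x y hx hy
      rcases h.finiteDistance_or_far hn x y with H | H | H
      · exact H
      · exact (key _ _ hx hy H).elim
      · exact (key _ _ hy hx H).elim
    have hno : ∀ x y, r x (x + n) → r (y + n) y → ¬ FiniteDistance r x y := fun x y hx hy hf =>
      h.asymm hy (h.wax_of_finiteDistance hn hf hx)
    have hcol : ∀ X : Set ℤ, (X = Lbar c ∨ X = Rbar c) → ¬ {z | r (z + n) z} ⊆ X := by
      intro X hX hsub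
      obtain ⟨γ, h1, h2⟩ := h.exists_loop_of_wane (B := {z | r (z + n) z}) (z := w)
        hw (fun z hz => hz) (fun z hz z' hz' => h.wane_of_finiteDistance hn hz' hz)
        (by rcases hX with rfl | rfl; exacts [Or.inl hsub, Or.inr hsub])
      rcases hX with rfl | rfl
      · exact (hloop γ h2).1 (h1.trans hsub)
      · exact (hloop γ h2).2 (h1.trans hsub)
    have hLfar : ∀ x y, r x (x + n) ∧ r x w → r (y + n) y → Far n r x y := fun x y hx hy => by
      refine IsPeriodicOrder.Far.of_finiteDistance_right h.toIsPeriodicOrder hn (y := w) ?_ (hM _ _ hw hy)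
      rcases h.finiteDistance_or_far hn x w with H | H | H
      · exact (hno _ _ hx.1 hw H).elim
      · exact H
      · exact (h.asymm hx.2 (by simpa using H 0)).elim
    have hRfar : ∀ x y, r x (x + n) ∧ r w x → r (y + n) y → Far n r y x := fun x y hx hy => by
      refine IsPeriodicOrder.Far.of_finiteDistance_left h.toIsPeriodicOrder hn (y := w) ?_ (hM _ _ hy hw)
      rcases h.finiteDistance_or_far hn x w with H | H | H
      · exact (hno _ _ hx.1 hw H).elim
      · exact (h.asymm hx.2 (by simpa using H 0)).elim
      · exact H
    have hL : {x | r x (x + n) ∧ r x w} ⊆ Lbar c := fun x hx =>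
      h.far_left_of_wax (hLfar x w hx hw) hx.1
    have hR : {x | r x (x + n) ∧ r w x} ⊆ Rbar c := fun x hx =>
      h.far_right_of_wax (hRfar x w hx hw) hx.1
    have hcases : ∀ x, (r x (x + n) ∧ r x w) ∨ r (x + n) x ∨ (r x (x + n) ∧ r w x) := by
      intro x
      rcases h.wax_or_wane hn x with hx | hx
      · have e : x ≠ w := by rintro rfl; exact h.asymm hx hw
        rcases h.total _ _ e with e | e
        · exact Or.inl ⟨hx, e⟩
        · exact Or.inr (Or.inr ⟨hx, e⟩)
      · exact Or.inr (Or.inl hx)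
    have hLR : ∀ x y, (r x (x + n) ∧ r x w) → (r y (y + n) ∧ r w y) → Far n r x y :=
      fun x y hx hy => IsPeriodicOrder.Far.trans_right h.toIsPeriodicOrder (hLfar x w hx hw) hy.2
    refine ⟨{x | r x (x + n) ∧ r x w}, {x | r (x + n) x}, {x | r x (x + n) ∧ r w x},
      ⟨?_, ?_, ?_⟩, hL, hR, ?_, ?_⟩
    · have hb : ∀ I : Set ℤ, (∀ y ∈ I, ∀ z, z ∈ I ↔ FiniteDistance r y z) → I = ∅ ∨ IsBlock r I :=
        fun I hI => I.eq_empty_or_nonempty.imp_right fun ⟨x, hx⟩ => hinf hx hI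
      intro b hb'
      simp only [List.mem_cons, List.not_mem_nil, or_false] at hb'
      rcases hb' with rfl | rfl | rfl
      · refine (hb _ fun y hy z => ⟨fun hz => ?_, fun hz => ?_⟩).imp_right fun H =>
          ⟨H, fun x hx => hx.1⟩
        · rcases h.finiteDistance_or_far hn y z with H | H | H
          · exact H
          · exact (not_L_and_R (hL hz) (h.far_right_of_wax H hz.1)).elim
          · exact (not_L_and_R (hL hy) (h.far_right_of_wax H hy.1)).elim
        · have h1 := h.wax_of_finiteDistance hn hz hy.1
          have h2 := IsPeriodicOrder.Far.of_finiteDistance_left h.toIsPeriodicOrder hn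
            (hLfar y w hy hw) (IsPeriodicOrder.finiteDistance_symm hz)
          exact ⟨h1, by simpa using h2 0⟩
      · refine (hb _ fun y hy z => ⟨fun hz => hM _ _ hy hz, fun hz => ?_⟩).imp_right fun H =>
          ⟨H, fun x hx => hx⟩
        exact h.wane_of_finiteDistance hn hz hy
      · refine (hb _ fun y hy z => ⟨fun hz => ?_, fun hz => ?_⟩).imp_right fun H =>
          ⟨H, fun x hx => hx.1⟩
        · rcases h.finiteDistance_or_far hn y z with H | H | H
          · exact H
          · exact (not_L_and_R (h.far_left_of_wax H hy.1) (hR hy)).elim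
          · exact (not_L_and_R (h.far_left_of_wax H hz.1) (hR hz)).elim
        · have h1 := h.wax_of_finiteDistance hn hz hy.1
          have h2 := IsPeriodicOrder.Far.of_finiteDistance_right h.toIsPeriodicOrder hn (hRfar y w hy hw) hz
          exact ⟨h1, by simpa using h2 0⟩
    · simp only [List.pairwise_cons, List.mem_cons, List.not_mem_nil, or_false]
      refine ⟨?_, ?_, by simp⟩
      · rintro b (rfl | rfl) x hx y hy
        · simpa using hLfar x y hx hy 0
        · simpa using hLR x y hx hy 0
      · rintro b rfl x hx y hy
        simpa using hRfar y x hy hx 0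
    · intro x
      rcases hcases x with H | H | H
      · exact ⟨_, List.mem_cons_self, H⟩
      · exact ⟨_, List.mem_cons_of_mem _ List.mem_cons_self, H⟩
      · exact ⟨_, List.mem_cons_of_mem _ (List.mem_cons_of_mem _ List.mem_cons_self), H⟩
    · by_contra hcon
      refine hcol _ (Or.inr rfl) fun z hz => h.col.not_mem_L.1 fun H => hcon ⟨z, hz, H⟩
    · by_contra hcon
      refine hcol _ (Or.inl rfl) fun z hz => h.col.not_mem_R.1 fun H => hcon ⟨z, hz, H⟩

end AvoidsPatterns

end AffineTITO

/-! ### Bounded arcs, and the order of a diagram without waning elements -/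

namespace AffineTITO

/-- Up to translation there is at most one arc for each residue of its initial point, hence finitely
many lengths. -/
theorem exists_arc_bound {n : ℕ} (hn : 0 < n) {E : ℤ → ℤ → Prop}
    (htr : ∀ k p q : ℤ, E (p + k * n) (q + k * n) ↔ E p q)
    (hfun : ∀ p q q', E p q → E p q' → q = q') : ∃ K : ℤ, ∀ p q, E p q → q - p ≤ K := by
  classical
  have hfin : {d : ℤ | ∃ p q, E p q ∧ d = q - p}.Finite := by
    refine ((Set.finite_Ico (0 : ℤ) n).image
      (fun p => if h : ∃ q, E p q then h.choose - p else 0)).subset ?_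
    rintro _ ⟨p, q, hpq, rfl⟩
    have e : p = p % n + p / n * n := by linarith [Int.emod_add_mul_ediv p n]
    have hE : E (p % n) (q - p / n * n) := by
      rw [← htr (p / n), ← e]; simpa using hpq
    refine ⟨p % n, ⟨Int.emod_nonneg _ (by omega), Int.emod_lt_of_pos _ (by omega)⟩, ?_⟩
    have hex : ∃ q, E (p % n) q := ⟨_, hE⟩
    simp only [dif_pos hex]
    rw [hfun _ _ _ hex.choose_spec hE]
    linarith
  obtain ⟨K, hK⟩ := hfin.bddAbove
  exact ⟨K, fun p q hpq => hK ⟨p, q, hpq, rfl⟩⟩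

theorem exists_modEq_of_fun {n : ℕ} (hn : 0 < n) (f : ℕ → ℤ) :
    ∃ i j, i < j ∧ f i ≡ f j [ZMOD n] := by
  have hm : ∀ i, (f i % (n : ℤ)).toNat ∈ Finset.range n := fun i => by
    have h1 := Int.emod_nonneg (f i) (show (n : ℤ) ≠ 0 by omega)
    have h2 := Int.emod_lt_of_pos (f i) (show (0 : ℤ) < n by omega)
    rw [Finset.mem_range]; omega
  obtain ⟨i, -, j, -, hne, e⟩ := Finset.exists_ne_map_eq_of_card_lt_of_maps_to
    (s := Finset.range (n + 1)) (t := Finset.range n) (by simp)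
    (f := fun i => (f i % (n : ℤ)).toNat) (fun i _ => hm i)
  have e' : f i ≡ f j [ZMOD n] := by
    have h1 := Int.emod_nonneg (f i) (show (n : ℤ) ≠ 0 by omega)
    have h2 := Int.emod_nonneg (f j) (show (n : ℤ) ≠ 0 by omega)
    unfold Int.ModEq
    omega
  rcases lt_or_gt_of_ne hne with h | h
  · exact ⟨i, j, h, e'⟩
  · exact ⟨j, i, h, e'.symm⟩

theorem exists_eq_add_mul {n : ℕ} {x y : ℤ} (h : x ≡ y [ZMOD n]) : ∃ k : ℤ, y = x + k * n := by
  obtain ⟨k, hk⟩ := h.dvd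
  exact ⟨k, by linarith⟩

theorem exists_eq_add_mul_pos {n : ℕ} {x y : ℤ} (h : x ≡ y [ZMOD n]) (hlt : x < y) :
    ∃ k : ℤ, 0 < k ∧ y = x + k * n := by
  obtain ⟨k, rfl⟩ := exists_eq_add_mul h
  refine ⟨k, ?_, rfl⟩
  by_contra hk
  have : k * n ≤ 0 := mul_nonpos_of_nonpos_of_nonneg (by omega) (by omega)
  omega

section ordOf

variable {n : ℕ} {c : Equiv.Perm ℤ} {A : Set Arc} (hA : IsCyclicCNCAD n c A) (hc : IsColoring n c)
include hA

theorem IsCyclicCNCAD.hasArc_tr (k : ℤ) {p q : ℤ} :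
    HasArc A (p + k * n) (q + k * n) ↔ HasArc A p q := by
  induction k using Int.induction_on with
  | zero => simp
  | succ i ih =>
    rw [← ih, ← hA.hasArc_add (p := p + i * n)]
    ring_nf
  | pred i ih =>
    rw [← ih, ← hA.hasArc_add (p := p + (-i - 1) * n)]
    ring_nf

theorem IsCyclicCNCAD.right_unique {p q q' : ℤ} (h : HasArc A p q) (h' : HasArc A p q') :
    q = q' := by
  by_contra hne
  exact (hA.noncrossing h h' (fun e => hne e.2)).1 rfl

include hc

/-- If all elements are waxing, a sequence of elementary inversions never meets the same residue
twice, so it has at most n steps, each of length at most K. Thus inversions have bounded length,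
whereas a pair at infinite distance would give arbitrarily long ones. -/
theorem ordOf_not_far (hn : 0 < n) (hw : ∀ x, ordOf c A x (x + n)) (x y : ℤ) :
    ¬ Far n (ordOf c A) x y := by
  classical
  intro hf
  have hT := isPeriodicOrder_ordOf hA hc
  obtain ⟨K, hK⟩ := exists_arc_bound hn (E := HasArc A) (fun k p q => hA.hasArc_tr k)
    (fun p q q' => hA.right_unique)
  have hK' : ∀ a b, InvStep c A a b → a - b ≤ K := by
    rintro a b ⟨p, q, h1, h2, h3, h4⟩
    have := hK _ _ h1
    omega
  -- The residues that can be reached from u by inversions; they strictly decrease along elementary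
  -- inversions, since the residue of the starting point is not met again.
  let S : ℤ → Finset ℤ := fun u => (Finset.Ico (0 : ℤ) n).filter
    fun ρ => ∃ v, (v = u ∨ Inv c A u v) ∧ v % n = ρ
  have key : ∀ u, Inv c A u y → 0 < K ∧ u - y ≤ K * (S u).card := by
    intro u hu
    have hmem : ∀ u, u % n ∈ S u := fun u => Finset.mem_filter.2
      ⟨Finset.mem_Ico.2 ⟨Int.emod_nonneg _ (by omega), Int.emod_lt_of_pos _ (by omega)⟩,
        u, Or.inl rfl, rfl⟩
    induction hu using Relation.TransGen.head_induction_on with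
    | single hs =>
      rename_i a
      have h1 := hK' _ _ hs
      have h2 : y < a := hs.choose_spec.choose_spec.2.1
      have h3 : 0 < (S a).card := Finset.card_pos.2 ⟨_, hmem a⟩
      refine ⟨by omega, ?_⟩
      have : (1 : ℤ) ≤ (S a).card := by omega
      nlinarith
    | head hs ht ih =>
      rename_i a b
      have h1 := hK' _ _ hs
      have h4 : (S b).card < (S a).card := by
        refine Finset.card_lt_card ⟨?_, fun hsub => ?_⟩
        · intro ρ hρ
          obtain ⟨h5, v, h6, h7⟩ := Finset.mem_filter.1 hρ
          refine Finset.mem_filter.2 ⟨h5, v, Or.inr ?_, h7⟩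
          rcases h6 with rfl | h6
          · exact .single hs
          · exact .head hs h6
        · obtain ⟨-, v, h6, h7⟩ := Finset.mem_filter.1 (hsub (hmem a))
          have h8 : Inv c A a v := by
            rcases h6 with rfl | h6
            · exact .single hs
            · exact .head hs h6
          obtain ⟨k, hk, rfl⟩ := exists_eq_add_mul_pos (n := n) h7 h8.lt
          exact hT.asymm (hT.wax_mul (hw v) hk) (Or.inr ⟨h8.lt, h8⟩)
      refine ⟨ih.1, ?_⟩
      have : ((S b).card : ℤ) + 1 ≤ (S a).card := by omega
      nlinarith [ih.1, ih.2]
  have hcard : ∀ u, ((S u).card : ℤ) ≤ n := fun u => by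
    have := Finset.card_filter_le (Finset.Ico (0 : ℤ) n)
      (fun ρ => ∃ v, (v = u ∨ Inv c A u v) ∧ v % n = ρ)
    simp only [Int.card_Ico, sub_zero, Int.toNat_natCast] at this
    exact_mod_cast this
  obtain ⟨k, -, hk⟩ := exists_int_mul_gt hn x (y + |K| * n)
  have habs : 0 ≤ |K| * n := by positivity
  have hI : Inv c A (x + k * n) y := by
    rcases hf k with h1 | h1
    · omega
    · exact h1.2
  obtain ⟨h1, h2⟩ := key _ hI
  rw [abs_of_pos h1] at hk
  nlinarith [hcard (x + k * n)]

theorem isSortable_ordOf (hn : 0 < n) : IsSortable n c (ordOf c A) := by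
  have hP : AvoidsPatterns n c (ordOf c A) := ⟨isPeriodicOrder_ordOf hA hc, hn, hc,
    fun a b d e f => ordOf_avoids_kij a b d ⟨e, f⟩, fun a b d e f => ordOf_avoids_jki a b d ⟨e, f⟩⟩
  refine hP.isSortable (ordOf_real hA hc hn) ?_ (ordOf_not_far hA hc hn)
  rw [ncad_ordOf hA hc]
  exact hA.real_loop

end ordOf

/-! ### The arc diagram of a `c`-sortable order -/

theorem IsSortable.avoidsPatterns {n : ℕ} (hn : 0 < n) {c : Equiv.Perm ℤ} (hc : IsColoring n c)
    {r : ℤ → ℤ → Prop} (h : IsSortable n c r) : AvoidsPatterns n c r :=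
  ⟨h.isTITO.isPeriodicOrder, hn, hc, fun a b d e f => h.avoids_kij _ _ _ a b d ⟨e, f⟩,
    fun a b d e f => h.avoids_jki _ _ _ a b d ⟨e, f⟩⟩

/-- The order consists of a waxing block `L`, a waning block `M` and a waxing block `R`. -/
structure HasBlocks (n : ℕ) (c : Equiv.Perm ℤ) (r : ℤ → ℤ → Prop) (L M R : Set ℤ) : Prop where
  cases : ∀ x, x ∈ L ∨ x ∈ M ∨ x ∈ R
  waxL : ∀ x ∈ L, r x (x + n)
  waneM : ∀ x ∈ M, r (x + n) x
  waxR : ∀ x ∈ R, r x (x + n)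
  subL : L ⊆ Lbar c
  subR : R ⊆ Rbar c
  fdL : ∀ x ∈ L, ∀ y, y ∈ L ↔ FiniteDistance r x y
  fdM : ∀ x ∈ M, ∀ y, y ∈ M ↔ FiniteDistance r x y
  fdR : ∀ x ∈ R, ∀ y, y ∈ R ↔ FiniteDistance r x y
  LM : ∀ x ∈ L, ∀ y ∈ M, r x y
  LR : ∀ x ∈ L, ∀ y ∈ R, r x y
  MR : ∀ x ∈ M, ∀ y ∈ R, r x y
  ML : (M ∩ Lbar c).Nonempty
  MRbar : (M ∩ Rbar c).Nonempty

theorem IsSortable.cases {n : ℕ} {c : Equiv.Perm ℤ} {r : ℤ → ℤ → Prop} (h : IsSortable n c r) :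
    (∀ x, r x (x + n)) ∧ (∀ x y, FiniteDistance r x y) ∨ ∃ L M R, HasBlocks n c r L M R := by
  rcases h.shape with h | ⟨L, M, R, h, h1, h2, h3, h4⟩
  · left
    rcases h.1 _ List.mem_cons_self with h5 | ⟨h5, h6⟩
    · have : (0 : ℤ) ∈ (∅ : Set ℤ) := by rw [← h5]; trivial
      exact this.elim
    · exact ⟨fun x => h6 x trivial, fun x y => (h5.2 x trivial y).1 trivial⟩
  · right
    obtain ⟨h5, h6, h7⟩ := h
    simp only [List.pairwise_cons, List.mem_cons, List.not_mem_nil, or_false, forall_eq_or_imp,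
      forall_eq, exists_eq_or_imp, exists_eq_left] at h5 h6 h7
    obtain ⟨hL, hM, hR⟩ := h5
    have key : ∀ {d : Direction} {I : Set ℤ}, I = ∅ ∨ IsBlock r I ∧ HasDirection n r d I →
        ∀ x ∈ I, (∀ y, y ∈ I ↔ FiniteDistance r x y) ∧ HasDirection n r d I := by
      rintro d I (rfl | hI) x hx
      · exact hx.elim
      · exact ⟨hI.1.2 x hx, hI.2⟩
    exact ⟨L, M, R, h7, fun x hx => (key hL x hx).2 x hx, fun x hx => (key hM x hx).2 x hx,
      fun x hx => (key hR x hx).2 x hx, h1, h2, fun x hx => (key hL x hx).1,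
      fun x hx => (key hM x hx).1, fun x hx => (key hR x hx).1, h6.1.1, h6.1.2, h6.2.1, h3, h4⟩

theorem IsPeriodicOrder.arcOf_translate {n : ℕ} {r : ℤ → ℤ → Prop} (h : IsPeriodicOrder n r) (k p q : ℤ) :
    (arcOf r p q).translate (k * n) = arcOf r (p + k * n) (q + k * n) := by
  ext x
  · rfl
  · rfl
  · simp only [Arc.translate, arcOf, Set.mem_image]
    constructor
    · rintro ⟨y, ⟨h1, h2, h3⟩, rfl⟩
      exact ⟨by omega, by omega, (h.tr k _ _).2 h3⟩
    · rintro ⟨h1, h2, h3⟩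
      refine ⟨x - k * n, ⟨by omega, by omega, (h.tr k _ _).1 (by simpa using h3)⟩, by ring⟩
  · simp only [Arc.translate, arcOf, Set.mem_image]
    constructor
    · rintro ⟨y, ⟨h1, h2, h3⟩, rfl⟩
      exact ⟨by omega, by omega, (h.tr k _ _).2 h3⟩
    · rintro ⟨h1, h2, h3⟩
      refine ⟨x - k * n, ⟨by omega, by omega, (h.tr k _ _).1 (by simpa using h3)⟩, by ring⟩

section ncad

variable {n : ℕ} {c : Equiv.Perm ℤ} {r : ℤ → ℤ → Prop} (h : AvoidsPatterns n c r)
include h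

theorem AvoidsPatterns.arc_L {p q x : ℤ} (ha : CoverRel r q p) (h1 : p < x) (h2 : x < q)
    (hx : x ∈ Lbar c) : r x q := by
  have e : x ≠ q := by omega
  refine (h.total _ _ e).resolve_right fun H => ?_
  rcases h.cover_le ha H with e' | H'
  · omega
  · exact h.kij h1 h2 hx ha.1 H'

theorem AvoidsPatterns.arc_R {p q x : ℤ} (ha : CoverRel r q p) (h1 : p < x) (h2 : x < q)
    (hx : x ∈ Rbar c) : r p x := by
  have e : p ≠ x := by omega
  refine (h.total _ _ e).resolve_right fun H => ?_
  rcases h.le_cover ha H with e' | H'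
  · omega
  · exact h.jki h1 h2 hx H' ha.1

/-- Take descents q ⋖ p and q' ⋖ p' with q ≺ q', so that p ≼ q'. All that is on the left of the
first, as well as its end points, precedes p', and what is on the right of the second follows p'.
The left side of the first even precedes q. So the first half of the intersection condition fails;
if q' ≺ q, the second half fails. -/
theorem AvoidsPatterns.isCyclicNCAD : IsCyclicNCAD n (ncad r) := by
  refine ⟨?_, ?_, ?_⟩
  · rintro _ ⟨p, q, h1, h2, rfl⟩
    refine ⟨h1, ?_, ?_⟩
    · ext x
      constructor
      · rintro (hx | hx)
        · exact ⟨hx.1, hx.2.1⟩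
        · exact ⟨hx.1, hx.2.1⟩
      · rintro ⟨hx1, hx2⟩
        have e : x ≠ q := ne_of_lt hx2
        rcases h.total _ _ e with H | H
        · exact Or.inl ⟨hx1, hx2, H⟩
        · refine Or.inr ⟨hx1, hx2, (h.cover_le h2 H).resolve_left (ne_of_lt hx1)⟩
    · rw [Set.disjoint_left]
      rintro x ⟨-, -, hx⟩ ⟨-, -, hx'⟩
      exact h.asymm h2.1 (h.trans _ _ _ hx' hx)
  · intro α
    constructor
    · rintro ⟨p, q, h1, h2, rfl⟩
      have := h.toIsPeriodicOrder.arcOf_translate 1 p q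
      simp only [one_mul] at this
      rw [this]
      refine ⟨p + n, q + n, by omega, ?_, rfl⟩
      simpa using (h.cover_tr 1 q p).2 h2
    · rintro ⟨p, q, h1, h2, e⟩
      have e' : α = (arcOf r p q).translate ((-1 : ℤ) * n) := by
        rw [← e]
        ext x <;> simp [Arc.translate]
      rw [e', h.toIsPeriodicOrder.arcOf_translate]
      exact ⟨_, _, by omega, (h.cover_tr (-1) q p).2 h2, rfl⟩
  · rintro _ ⟨p, q, h1, h2, rfl⟩ _ ⟨p', q', h3, h4, rfl⟩ hne hint
    have hpq : ¬ (p = p' ∧ q = q') := by rintro ⟨rfl, rfl⟩; exact hne rfl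
    rcases hint with e | e | ⟨H1, H2⟩
    · simp only [arcOf] at e
      subst e
      exact hpq ⟨rfl, h.cover_left_unique h2 h4⟩
    · simp only [arcOf] at e
      subst e
      exact hpq ⟨h.cover_right_unique h2 h4, rfl⟩
    · have hqq : q ≠ q' := by rintro rfl; exact hpq ⟨h.cover_right_unique h2 h4, rfl⟩
      rcases h.total _ _ hqq with H | H
      · have H' := h.cover_le h2 H
        have hpp' : r p p' := by
          rcases H' with rfl | H'
          · exact h4.1
          · exact h.trans _ _ _ H' h4.1
        obtain ⟨x, ⟨hx1, hx2⟩ | ⟨hx1, hx2⟩⟩ := H1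
        · have hxp : r x p' := by
            rcases hx1 with hx1 | rfl | rfl
            · exact h.trans _ _ _ hx1.2.2 (h.trans _ _ _ h2.1 hpp')
            · exact hpp'
            · exact h.trans _ _ _ h2.1 hpp'
          exact h.asymm hxp hx2.2.2
        · have hxq : r x q := hx1.2.2
          rcases hx2 with rfl | rfl
          · exact h.asymm hxq (h.trans _ _ _ h2.1 hpp')
          · exact h.asymm hxq H
      · have H' := h.cover_le h4 H
        have hpp' : r p' p := by
          rcases H' with rfl | H'
          · exact h2.1
          · exact h.trans _ _ _ H' h2.1
        obtain ⟨x, ⟨hx1, hx2⟩ | ⟨hx1, hx2⟩⟩ := H2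
        · have hxp : r x p := by
            rcases hx2 with hx2 | rfl | rfl
            · exact h.trans _ _ _ hx2.2.2 (h.trans _ _ _ h4.1 hpp')
            · exact hpp'
            · exact h.trans _ _ _ h4.1 hpp'
          exact h.asymm hxp hx1.2.2
        · have hxq : r x q' := hx2.2.2
          rcases hx1 with rfl | rfl
          · exact h.asymm hxq (h.trans _ _ _ h4.1 hpp')
          · exact h.asymm hxq H

/-- A loop is a full waning block. -/
theorem AvoidsPatterns.loop_wane {f : ℤ → ℤ} (hf : ∀ i, HasArc (ncad r) (f i) (f (i + 1))) (i : ℤ) :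
    r (f i + n) (f i) ∧ ∀ y, FiniteDistance r (f i) y → y ∈ Set.range f := by
  have hlt : ∀ i (k : ℕ), f i < f (i + k + 1) ∧ r (f (i + k + 1)) (f i) := by
    intro i k
    induction k with
    | zero =>
      have := hasArc_ncad.1 (hf i)
      simpa using ⟨this.1, this.2.1⟩
    | succ k ih =>
      have := hasArc_ncad.1 (hf (i + k + 1))
      push_cast
      rw [← add_assoc]
      exact ⟨ih.1.trans this.1, h.trans _ _ _ this.2.1 ih.2⟩
  have hmono : StrictMono f := by
    intro a b hab
    obtain ⟨k, hk⟩ := Int.eq_ofNat_of_zero_le (show 0 ≤ b - a - 1 by omega)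
    have := (hlt a k).1
    rwa [show a + (k : ℤ) + 1 = b by omega] at this
  -- By pigeonhole two points of the loop are congruent, and the larger one precedes the smaller
  -- one.
  have hw : ∃ i, r (f i + n) (f i) := by
    obtain ⟨i, j, hij, e⟩ := exists_modEq_of_fun h.pos (fun i : ℕ => f i)
    obtain ⟨k, hk, hk'⟩ := exists_eq_add_mul_pos e (hmono (by omega))
    refine ⟨i, h.wane_of_mul h.pos hk.le (k := k) ?_⟩
    have := (hlt i (j - i - 1)).2
    rw [show (i : ℤ) + ((j - i - 1 : ℕ) : ℤ) + 1 = j by omega] at this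
    rwa [hk'] at this
  -- Consecutive points of the loop are covering relations, so an element off the loop is beyond all
  -- the points of the loop on its side, and these are infinitely many.
  have hblock : ∀ i y, FiniteDistance r (f i) y → y ∈ Set.range f := by
    intro i y hy
    by_contra hcon
    have hne : ∀ j, f j ≠ y := fun j e => hcon ⟨j, e⟩
    rcases h.total _ _ (hne i) with H | H
    · have hall : ∀ k : ℕ, r (f (i - k)) y := fun k => by
        induction k with
        | zero => simpa using H
        | succ k ih =>
          have h1 := (hasArc_ncad.1 (hf (i - k - 1))).2
          rw [sub_add_cancel] at h1
          have := (h.cover_le h1 ih).resolve_left (hne _)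
          push_cast
          rwa [← sub_sub]
      refine Set.infinite_of_injective_forall_mem (f := fun k : ℕ => f (i - k - 1)) ?_ ?_ hy.1
      · intro a b e
        have := hmono.injective e
        omega
      · intro k
        refine ⟨?_, ?_⟩
        · have := (hlt (i - k - 1) k).2
          rwa [show i - (k : ℤ) - 1 + k + 1 = i by ring] at this
        · have := hall (k + 1)
          push_cast at this
          rwa [← sub_sub] at this
    · have hall : ∀ k : ℕ, r y (f (i + k)) := fun k => by
        induction k with
        | zero => simpa using H
        | succ k ih =>
          have h1 := (hasArc_ncad.1 (hf (i + k))).2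
          have := (h.le_cover h1 ih).resolve_left (Ne.symm (hne _))
          push_cast
          rwa [← add_assoc]
      refine Set.infinite_of_injective_forall_mem (f := fun k : ℕ => f (i + k + 1)) ?_ ?_ hy.2
      · intro a b e
        have := hmono.injective e
        omega
      · intro k
        refine ⟨?_, (hlt i k).2⟩
        have := hall (k + 1)
        push_cast at this
        rwa [← add_assoc] at this
  obtain ⟨j, hj⟩ := hw
  refine ⟨?_, hblock i⟩
  have key : ∀ (k : ℕ) (i : ℤ), FiniteDistance r (f i) (f (i + k)) := by
    intro k
    induction k with
    | zero => intro i; simpa using h.finiteDistance_tr h.pos (f i) 0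
    | succ k ih =>
      intro i
      have h1 := (hasArc_ncad.1 (hf (i + k))).2
      have h2 : FiniteDistance r (f (i + k + 1)) (f (i + k)) := by
        have e1 : {z | r (f (i + k + 1)) z ∧ r z (f (i + k))} = ∅ :=
          Set.eq_empty_of_forall_notMem fun z hz => h1.2 z hz
        have e2 : {z | r (f (i + k)) z ∧ r z (f (i + k + 1))} = ∅ :=
          Set.eq_empty_of_forall_notMem fun z hz =>
            h.asymm h1.1 (h.trans _ _ _ hz.1 hz.2)
        exact ⟨e1 ▸ Set.finite_empty, e2 ▸ Set.finite_empty⟩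
      push_cast
      rw [← add_assoc]
      exact h.finiteDistance_trans (ih i) (IsPeriodicOrder.finiteDistance_symm h2)
  refine h.wane_of_finiteDistance h.pos (x := f j) ?_ hj
  rcases le_total i j with hij | hij
  · obtain ⟨k, hk⟩ := Int.eq_ofNat_of_zero_le (show 0 ≤ j - i by omega)
    have := key k i
    rw [show i + (k : ℤ) = j by omega] at this
    exact IsPeriodicOrder.finiteDistance_symm this
  · obtain ⟨k, hk⟩ := Int.eq_ofNat_of_zero_le (show 0 ≤ i - j by omega)
    have := key k j
    rwa [show j + (k : ℤ) = i by omega] at this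

end ncad

/-- The nontrivial point is the condition on loops: a loop is waning, hence fills the block M, and M
has elements of both colors. -/
theorem IsSortable.isCyclicCNCAD {n : ℕ} (hn : 0 < n) {c : Equiv.Perm ℤ} (hc : IsColoring n c)
    {r : ℤ → ℤ → Prop} (hs : IsSortable n c r) : IsCyclicCNCAD n c (ncad r) := by
  have h := hs.avoidsPatterns hn hc
  refine ⟨h.isCyclicNCAD, ?_, ?_, ?_⟩
  · rintro _ ⟨p, q, h1, h2, rfl⟩ x ⟨hx1, hx2, hx3⟩
    refine hc.not_mem_R.1 fun H => h.asymm hx3 ?_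
    exact h.trans _ _ _ h2.1 (h.arc_R h2 hx1 hx2 H)
  · rintro _ ⟨p, q, h1, h2, rfl⟩ x ⟨hx1, hx2, hx3⟩
    refine hc.not_mem_L.1 fun H => h.asymm hx3 ?_
    exact h.trans _ _ _ (h.arc_L h2 hx1 hx2 H) h2.1
  · rintro _ ⟨f, hf, rfl⟩
    obtain ⟨h1, h2⟩ := h.loop_wane hf 0
    rcases hs.cases with H | ⟨L, M, R, H⟩
    · exact (h.asymm h1 (H.1 _)).elim
    · have hM : f 0 ∈ M := by
        rcases H.cases (f 0) with h3 | h3 | h3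
        · exact (h.asymm h1 (H.waxL _ h3)).elim
        · exact h3
        · exact (h.asymm h1 (H.waxR _ h3)).elim
      have hsub : M ⊆ Set.range f := fun y hy => h2 y ((H.fdM _ hM y).1 hy)
      constructor
      · intro hcon
        obtain ⟨x, hx1, hx2⟩ := H.MRbar
        exact not_L_and_R (hcon (hsub hx1)) hx2
      · intro hcon
        obtain ⟨x, hx1, hx2⟩ := H.ML
        exact not_L_and_R hx2 (hcon (hsub hx1))

end AffineTITO

/-! ### Recovering a sortable order from its descents -/

namespace AffineTITO

section

variable {n : ℕ} {c : Equiv.Perm ℤ} {r : ℤ → ℤ → Prop} (h : AvoidsPatterns n c r)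
include h

theorem AvoidsPatterns.rel_of_invStep {x y : ℤ} (hs : InvStep c (ncad r) x y) : r x y := by
  obtain ⟨p, q, h1, h2, h3, h4⟩ := hs
  obtain ⟨h5, h6⟩ := hasArc_ncad.1 h1
  have hx : x = q ∨ r x q := h3.imp_right fun h3 => h.arc_L h6 h3.1 h3.2.1 h3.2.2
  have hy : y = p ∨ r p y := h4.imp_right fun h4 => h.arc_R h6 h4.1 h4.2.1 h4.2.2
  have hxp : r x p := by
    rcases hx with rfl | hx
    · exact h6.1
    · exact h.trans _ _ _ hx h6.1
  rcases hy with rfl | hy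
  · exact hxp
  · exact h.trans _ _ _ hxp hy

theorem AvoidsPatterns.rel_of_inv {x y : ℤ} (hs : Inv c (ncad r) x y) : r x y := by
  induction hs with
  | single hs => exact h.rel_of_invStep hs
  | tail _ hs ih => exact h.trans _ _ _ ih (h.rel_of_invStep hs)

/-- The arc of a descent `u ⋖ v` over `x`, with `x ≼ u`. -/
theorem AvoidsPatterns.left_of_cover {u v x : ℤ} (hc : CoverRel r u v) (hx : x = u ∨ r x u)
    (h1 : v < x) (h2 : x < u ∨ x = u) : x = u ∨ v < x ∧ x < u ∧ x ∈ Lbar c := by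
  rcases h2 with h2 | h2
  · refine Or.inr ⟨h1, h2, h.col.not_mem_R.1 fun H => ?_⟩
    rcases hx with rfl | hx
    · omega
    · exact h.jki h1 h2 H hx hc.1
  · exact Or.inl h2

theorem AvoidsPatterns.right_of_cover {u v y : ℤ} (hc : CoverRel r u v) (hy : y = v ∨ r v y)
    (h1 : v < y ∨ y = v) (h2 : y < u) : y = v ∨ v < y ∧ y < u ∧ y ∈ Rbar c := by
  rcases h1 with h1 | h1
  · refine Or.inr ⟨h1, h2, h.col.not_mem_L.1 fun H => ?_⟩
    rcases hy with rfl | hy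
    · omega
    · exact h.kij h1 h2 H hc.1 hy
  · exact Or.inl h1

/-- The interval is split at elements whose values lie between y and x as long as there are any.
When there are none, the covering relation by which the order goes below the level x jumps down to y
or lower, and (x, y) is an elementary inversion of that single arc. -/
theorem AvoidsPatterns.inv_of_finite {x y : ℤ} (hf : {z | r x z ∧ r z y}.Finite) (hxy : r x y)
    (hlt : y < x) : Inv c (ncad r) x y := by
  induction hcard : hf.toFinset.card using Nat.strong_induction_on generalizing x y with
  | _ m ih =>
    by_cases hz : ∃ z, r x z ∧ r z y ∧ y < z ∧ z < x
    · obtain ⟨z, hxz, hzy, h1, h2⟩ := hz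
      have sub1 : {w | r x w ∧ r w z} ⊆ {w | r x w ∧ r w y} :=
        fun w hw => ⟨hw.1, h.trans _ _ _ hw.2 hzy⟩
      have sub2 : {w | r z w ∧ r w y} ⊆ {w | r x w ∧ r w y} :=
        fun w hw => ⟨h.trans _ _ _ hxz hw.1, hw.2⟩
      refine Inv.trans (ih _ ?_ (hf.subset sub1) hxz h2 rfl) (ih _ ?_ (hf.subset sub2) hzy h1 rfl)
      · rw [← hcard]
        refine Finset.card_lt_card ⟨Set.Finite.toFinset_subset_toFinset.2 sub1, fun hs => ?_⟩
        have := hs ((Set.Finite.mem_toFinset hf).2 (show z ∈ _ from ⟨hxz, hzy⟩))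
        exact h.irrefl z ((Set.Finite.mem_toFinset _).1 this).2
      · rw [← hcard]
        refine Finset.card_lt_card ⟨Set.Finite.toFinset_subset_toFinset.2 sub2, fun hs => ?_⟩
        have := hs ((Set.Finite.mem_toFinset hf).2 (show z ∈ _ from ⟨hxz, hzy⟩))
        exact h.irrefl z ((Set.Finite.mem_toFinset _).1 this).1
    · push Not at hz
      obtain ⟨u, v, h1, h2, h3, h4, h5⟩ :=
        h.exists_cover_of_finite hxy hf (fun z => x ≤ z) le_rfl (by omega)
      have hv : v ≤ y := by
        rcases h5 with rfl | h5
        · exact le_rfl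
        · have hxv : r x v := by
            rcases h4 with rfl | h4
            · exact h1.1
            · exact h.trans _ _ _ h4 h1.1
          by_contra hcon
          have := hz v hxv h5 (by omega)
          omega
      refine .single ⟨v, u, hasArc_ncad.2 ⟨by omega, h1⟩, hlt, ?_, ?_⟩
      · exact h.left_of_cover h1 (h4.imp_left Eq.symm) (by omega) (by omega)
      · exact h.right_of_cover h1 (h5.imp_left Eq.symm) (by omega) (by omega)

/-- A waning block crosses every level. -/
theorem AvoidsPatterns.exists_cover_of_wane {w x z : ℤ} (hw : r (w + n) w)
    (hz : FiniteDistance r w z) (hzx : z ≤ x) :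
    ∃ u v, CoverRel r u v ∧ x < u ∧ v ≤ x ∧ FiniteDistance r w u ∧ FiniteDistance r w v ∧
      (v = z ∨ r v z) := by
  have hzw := h.wane_of_finiteDistance h.pos hz hw
  obtain ⟨k, hk, hk'⟩ := exists_int_mul_gt h.pos z x
  have h0 := h.wane_mul hzw hk
  have hfd := h.finiteDistance_tr h.pos z k
  obtain ⟨u, v, h1, h2, h3, h4, h5⟩ :=
    h.exists_cover_of_finite h0 hfd.2 (fun y => x < y) hk' (by omega)
  have hconv : ∀ y, (z + k * n = y ∨ r (z + k * n) y) → (y = z ∨ r y z) →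
      FiniteDistance r w y := by
    intro y hy hy'
    refine h.finiteDistance_trans hz ?_
    rcases hy' with rfl | hy'
    · simpa using h.finiteDistance_tr h.pos y 0
    · rcases hy with rfl | hy
      · exact hfd
      · refine IsPeriodicOrder.finiteDistance_symm ((h.finiteDistance_iff h.pos hy').2 ⟨-k, ?_⟩)
        have := (h.tr (-k) _ _).2 hy
        simpa using this
  have hzu : z + k * n = u ∨ r (z + k * n) u := h4.imp_left Eq.symm
  have hzv : z + k * n = v ∨ r (z + k * n) v := by
    rcases hzu with e | e
    · exact Or.inr (e ▸ h1.1)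
    · exact Or.inr (h.trans _ _ _ e h1.1)
  have hvz : v = z ∨ r v z := h5
  have huz : u = z ∨ r u z := by
    rcases hvz with rfl | e
    · exact Or.inr h1.1
    · exact Or.inr (h.trans _ _ _ h1.1 e)
  exact ⟨u, v, h1, h2, by omega, hconv u hzu huz, hconv v hzv hvz, hvz⟩

theorem AvoidsPatterns.exists_cover_of_wane' {w x z : ℤ} (hw : r (w + n) w)
    (hz : FiniteDistance r w z) (hzx : x ≤ z) :
    ∃ u v, CoverRel r u v ∧ x ≤ u ∧ v < x ∧ FiniteDistance r w u ∧ FiniteDistance r w v ∧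
      (u = z ∨ r z u) := by
  have hzw := h.wane_of_finiteDistance h.pos hz hw
  obtain ⟨k, hk, hk'⟩ := exists_int_mul_lt h.pos z x
  have hk' : z + (-k) * n < x := by linarith
  have h0 : r z (z + (-k) * n) := by
    have := h.wane_mul ((h.wane_tr z (-k)).2 hzw) hk
    ring_nf at this ⊢
    exact this
  have hfd := h.finiteDistance_tr h.pos z (-k)
  obtain ⟨u, v, h1, h2, h3, h4, h5⟩ :=
    h.exists_cover_of_finite h0 hfd.1 (fun y => x ≤ y) hzx (by omega)
  have hconv : ∀ y, (y = z ∨ r z y) → (y = z + (-k) * n ∨ r y (z + (-k) * n)) →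
      FiniteDistance r w y := by
    intro y hy hy'
    refine h.finiteDistance_trans hz ?_
    rcases hy with rfl | hy
    · simpa using h.finiteDistance_tr h.pos y 0
    · rcases hy' with rfl | hy'
      · exact hfd
      · exact ((h.finiteDistance_iff h.pos hy).2 ⟨_, hy'⟩)
  have hzv : z = v ∨ r z v := by
    rcases h4 with rfl | e
    · exact Or.inr h1.1
    · exact Or.inr (h.trans _ _ _ e h1.1)
  have hvz : v = z + (-k) * n ∨ r v (z + (-k) * n) := h5
  have huz : u = z + (-k) * n ∨ r u (z + (-k) * n) := by
    rcases hvz with e | e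
    · exact Or.inr (e ▸ h1.1)
    · exact Or.inr (h.trans _ _ _ h1.1 e)
  exact ⟨u, v, h1, h2, by omega, hconv u h4 huz, hconv v (hzv.imp_left Eq.symm) hvz, h4⟩

/-- The point x has color L, and the waning block of y has an arc over x. This arc inverts x with
its initial point, which is then joined to y inside the block; if y is itself over the arc or its
initial point, the arc is enough. -/
theorem AvoidsPatterns.inv_of_far_left {x y : ℤ} (hf : Far n r x y) (hy : r (y + n) y)
    (hlt : y < x) : Inv c (ncad r) x y := by
  have hx := h.far_left_of_wane hf hy
  obtain ⟨u, v, h1, h2, h3, h4, h5, h6⟩ := h.exists_cover_of_wane hy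
    (by simpa using h.finiteDistance_tr h.pos y 0) hlt.le
  have hxu : r x u := by simpa using IsPeriodicOrder.Far.of_finiteDistance_right h.toIsPeriodicOrder h.pos hf h4 0
  have hxv : r x v := h.trans _ _ _ hxu h1.1
  have hvx : v < x := lt_of_le_of_ne h3 fun e => h.irrefl x (e ▸ hxv)
  have harc := hasArc_ncad.2 ⟨hvx.trans h2, h1⟩
  rcases lt_or_ge y v with hyv | hyv
  · have hvy := h6.resolve_left (by omega)
    refine Inv.trans (.single ⟨v, u, harc, hvx, Or.inr ⟨hvx, h2, hx⟩, Or.inl rfl⟩) ?_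
    exact h.inv_of_finite h5.2 hvy hyv
  · exact .single ⟨v, u, harc, hlt, Or.inr ⟨hvx, h2, hx⟩,
      h.right_of_cover h1 (h6.imp_left Eq.symm) (by omega) (by omega)⟩

theorem AvoidsPatterns.inv_of_far_right {x y : ℤ} (hf : Far n r x y) (hx : r (x + n) x)
    (hlt : y < x) : Inv c (ncad r) x y := by
  have hy := h.far_right_of_wane hf hx
  obtain ⟨u, v, h1, h2, h3, h4, h5, h6⟩ := h.exists_cover_of_wane' hx
    (by simpa using h.finiteDistance_tr h.pos x 0) hlt.le
  have hvy : r v y := by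
    simpa using IsPeriodicOrder.Far.of_finiteDistance_left h.toIsPeriodicOrder h.pos hf (IsPeriodicOrder.finiteDistance_symm h5) 0
  have huy : r u y := h.trans _ _ _ h1.1 hvy
  have hyu : y < u := lt_of_le_of_ne h2 fun e => h.irrefl y (e ▸ huy)
  have harc := hasArc_ncad.2 ⟨h3.trans hyu, h1⟩
  rcases lt_or_ge u x with hxu | hxu
  · have hxu' := h6.resolve_left (by omega)
    refine Inv.trans ?_ (.single ⟨v, u, harc, hyu, Or.inl rfl, Or.inr ⟨h3, hyu, hy⟩⟩)
    exact h.inv_of_finite h4.1 hxu' hxu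
  · exact .single ⟨v, u, harc, hlt,
      h.left_of_cover h1 (h6.imp_left Eq.symm) (by omega) (by omega), Or.inr ⟨h3, hyu, hy⟩⟩

theorem AvoidsPatterns.inv_of_far {w x y : ℤ} (hxw : Far n r x w) (hwy : Far n r w y)
    (hw : r (w + n) w) (hlt : y < x) : Inv c (ncad r) x y := by
  -- The translate of w is chosen to be at least x + 1, so that the waning block starts above the
  -- level x.
  obtain ⟨u, v, h1, h2, h3, h4, h5, -⟩ := h.exists_cover_of_wane' (x := x + 1)
    (z := w + (|x - w| + 1) * n) hw (h.finiteDistance_tr h.pos _ _) (by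
      have h1 := le_abs_self (x - w)
      have h2 : (1 : ℤ) ≤ n := by have := h.pos; omega
      have h3 := abs_nonneg (x - w)
      nlinarith)
  have hx := h.far_left_of_wane hxw hw
  have hy := h.far_right_of_wane hwy hw
  have hxu : r x v := by simpa using IsPeriodicOrder.Far.of_finiteDistance_right h.toIsPeriodicOrder h.pos hxw h5 0
  have hvx : v < x := lt_of_le_of_ne (by omega) fun e => h.irrefl x (e ▸ hxu)
  have hwane := h.wane_of_finiteDistance h.pos h5 hw
  have hvy : Far n r v y := IsPeriodicOrder.Far.of_finiteDistance_left h.toIsPeriodicOrder h.pos hwy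
    (IsPeriodicOrder.finiteDistance_symm h5)
  have harc := hasArc_ncad.2 ⟨(show v < u by omega), h1⟩
  rcases lt_trichotomy v y with e | rfl | e
  · exact .single ⟨v, u, harc, hlt, Or.inr ⟨hvx, by omega, hx⟩, Or.inr ⟨e, by omega, hy⟩⟩
  · exact (h.irrefl v (by simpa using hvy 0)).elim
  · exact Inv.trans (.single ⟨v, u, harc, hvx, Or.inr ⟨hvx, by omega, hx⟩, Or.inl rfl⟩)
      (h.inv_of_far_right hvy hwane e)

end

section

variable {n : ℕ} (hn : 0 < n) {c : Equiv.Perm ℤ} (hc : IsColoring n c)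
include hn hc

theorem IsSortable.inv_iff {r : ℤ → ℤ → Prop} (hs : IsSortable n c r) {x y : ℤ} (hlt : y < x) :
    Inv c (ncad r) x y ↔ r x y := by
  have h := hs.avoidsPatterns hn hc
  refine ⟨h.rel_of_inv, fun hxy => ?_⟩
  by_cases hfd : FiniteDistance r x y
  · exact h.inv_of_finite hfd.1 hxy hlt
  have hfar : Far n r x y := by
    rcases h.finiteDistance_or_far hn x y with H | H | H
    · exact (hfd H).elim
    · exact H
    · exact (h.asymm hxy (by simpa using H 0)).elim
  rcases hs.cases with H | ⟨L, M, R, H⟩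
  · exact (hfd (H.2 x y)).elim
  · rcases H.cases x with hx | hx | hx <;> rcases H.cases y with hy | hy | hy
    · exact (hfd ((H.fdL x hx y).1 hy)).elim
    · exact h.inv_of_far_left hfar (H.waneM y hy) hlt
    · obtain ⟨w, hw, -⟩ := H.ML
      have hM : ∀ k : ℤ, w + k * n ∈ M := fun k => (H.fdM w hw _).2 (h.finiteDistance_tr hn w k)
      refine h.inv_of_far (w := w) (fun k => ?_) (fun k => H.MR _ (hM k) y hy) (H.waneM w hw) hlt
      have := (h.tr k x (w + (-k) * n)).2 (H.LM x hx _ (hM _))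
      simpa using this
    · exact (h.asymm hxy (H.LM y hy x hx)).elim
    · exact (hfd ((H.fdM x hx y).1 hy)).elim
    · exact h.inv_of_far_right hfar (H.waneM x hx) hlt
    · exact (h.asymm hxy (H.LR y hy x hx)).elim
    · exact (h.asymm hxy (H.MR y hy x hx)).elim
    · exact (hfd ((H.fdR x hx y).1 hy)).elim

theorem IsSortable.ordOf_ncad {r : ℤ → ℤ → Prop} (hs : IsSortable n c r) :
    ordOf c (ncad r) = r := by
  have h := hs.avoidsPatterns hn hc
  funext x y
  refine propext ?_
  unfold ordOf
  rcases lt_trichotomy x y with hlt | rfl | hlt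
  · rw [hs.inv_iff hn hc hlt, h.not_iff (by omega)]
    simp [hlt, hlt.asymm]
  · simp [h.irrefl]
  · rw [hs.inv_iff hn hc hlt]
    simp [hlt, hlt.asymm]

theorem ncad_bijOn : Set.BijOn ncad (sortableTITO n c) (cyclicCNCAD n c) := by
  refine ⟨fun r hr => IsSortable.isCyclicCNCAD hn hc hr, fun r hr r' hr' e => ?_, fun A hA => ?_⟩
  · rw [← IsSortable.ordOf_ncad hn hc hr, ← IsSortable.ordOf_ncad hn hc hr', e]
  · exact ⟨ordOf c A, isSortable_ordOf hA hc hn, ncad_ordOf hA hc⟩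

/-- It is enough to recover the order from its arc diagram. -/
theorem bijOn_and_invOn_of_tito_ncad
    (H : ∀ (a : ℤ) (r : ℤ → ℤ → Prop), IsSortable n c r → tito n c a (ncad r) = r) :
    Set.BijOn ncad (sortableTITO n c) (cyclicCNCAD n c) ∧
    (∀ a : ℤ,
      Set.MapsTo (tito n c a) (cyclicCNCAD n c) (sortableTITO n c) ∧
      Set.InvOn (tito n c a) ncad (sortableTITO n c) (cyclicCNCAD n c)) ∧
    (∀ a b : ℤ, ∀ A ∈ cyclicCNCAD n c, tito n c a A = tito n c b A) := by
  have hb := ncad_bijOn hn hc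
  have hex : ∀ A ∈ cyclicCNCAD n c, ∃ r, IsSortable n c r ∧ ncad r = A := fun A hA =>
    hb.surjOn hA
  refine ⟨hb, fun a => ⟨fun A hA => ?_, fun r hr => H a r hr, fun A hA => ?_⟩, fun a b A hA => ?_⟩
  · obtain ⟨r, hr, rfl⟩ := hex A hA
    rw [H a r hr]; exact hr
  · obtain ⟨r, hr, rfl⟩ := hex A hA
    rw [H a r hr]
  · obtain ⟨r, hr, rfl⟩ := hex A hA
    rw [H a r hr, H b r hr]

end

end AffineTITO

namespace AffineTITO

/-! ### Neighbor arcs -/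

/-- The diagram `A` consists of descents of `r` and is invariant under translation. -/
structure IsSubdiagram (n : ℕ) (r : ℤ → ℤ → Prop) (A : Set Arc) : Prop where
  arc : ∀ {p q}, HasArc A p q → p < q ∧ CoverRel r q p
  tr : ∀ (k : ℤ) {p q}, HasArc A (p + k * n) (q + k * n) ↔ HasArc A p q

theorem IsPeriodicOrder.isSubdiagram_ncad {n : ℕ} {r : ℤ → ℤ → Prop} (h : IsPeriodicOrder n r) :
    IsSubdiagram n r (ncad r) :=
  ⟨fun H => hasArc_ncad.1 H, fun k {p q} => by
    rw [hasArc_ncad, hasArc_ncad, h.cover_tr]; simp⟩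

/-- `b` is followed by `b'`, the final point of the arc `p → b'`. -/
structure Step (c : Equiv.Perm ℤ) (r : ℤ → ℤ → Prop) (A : Set Arc) (b p b' : ℤ) : Prop where
  arc : HasArc A p b'
  le : p ≤ b
  lt : b < b'
  out : p = b ∨ ∀ q, ¬ HasArc A b q
  -- A point of color L precedes the final points of the arcs over it, and the chosen arc is the
  -- first of these arcs; a point of color R follows their initial points, and the chosen arc is the
  -- last. Comparing final points is enough because the arcs are covering relations.
  closeL : p < b → b ∈ Lbar c → ∀ p' q', HasArc A p' q' → p' < b → b < q' → q' = b' ∨ r b' q'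
  closeR : p < b → b ∈ Rbar c → ∀ p' q', HasArc A p' q' → p' < b → b < q' → q' = b' ∨ r q' b'

theorem next_eq_some {c : Equiv.Perm ℤ} {A : Set Arc} {b b' : ℤ} {l : Letter}
    (hn : next c A b = some (l, b')) :
    (HasArc A b b' ∧ l = .right) ∨ ((∀ q, ¬ HasArc A b q) ∧ (∃ p, IsNeighborArc c A b p b') ∧
      (b ∈ Lbar c ∧ l = .down ∨ b ∉ Lbar c ∧ l = .up)) := by
  unfold next at hn
  split_ifs at hn with h1 h2 h3
  · have := Option.some.inj hn
    rw [Prod.mk.injEq] at this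
    exact Or.inl ⟨this.2 ▸ h1.choose_spec, this.1.symm⟩
  · have := Option.some.inj hn
    rw [Prod.mk.injEq] at this
    exact Or.inr ⟨fun q hq => h1 ⟨q, hq⟩, this.2 ▸ h2.choose_spec, Or.inl ⟨h3, this.1.symm⟩⟩
  · have := Option.some.inj hn
    rw [Prod.mk.injEq] at this
    exact Or.inr ⟨fun q hq => h1 ⟨q, hq⟩, this.2 ▸ h2.choose_spec, Or.inr ⟨h3, this.1.symm⟩⟩

theorem next_eq_none {c : Equiv.Perm ℤ} {A : Set Arc} {b : ℤ} (hn : next c A b = none) :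
    (∀ q, ¬ HasArc A b q) ∧ ∀ p q, ¬ IsNeighborArc c A b p q := by
  unfold next at hn
  split_ifs at hn with h1 h2
  exact ⟨fun q hq => h1 ⟨q, hq⟩, fun p q hq => h2 ⟨q, p, hq⟩⟩

theorem exists_isGreatest_of_le {S : Set ℤ} (hS : S.Nonempty) {b : ℤ} (hb : ∀ x ∈ S, x ≤ b) :
    ∃ x, IsGreatest S x := by
  obtain ⟨x, hx, hx'⟩ := Int.exists_greatest_of_bdd (P := (· ∈ S)) ⟨b, hb⟩ hS
  exact ⟨x, hx, hx'⟩

theorem exists_isLeast_of_le {S : Set ℤ} (hS : S.Nonempty) {b : ℤ} (hb : ∀ x ∈ S, b ≤ x) :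
    ∃ x, IsLeast S x := by
  obtain ⟨x, hx, hx'⟩ := Int.exists_least_of_bdd (P := (· ∈ S)) ⟨b, hb⟩ hS
  exact ⟨x, hx, hx'⟩

namespace IsSubdiagram

variable {n : ℕ} {c : Equiv.Perm ℤ} {r : ℤ → ℤ → Prop} {A : Set Arc}
  (h : AvoidsPatterns n c r) (hA : IsSubdiagram n r A)
include h hA

theorem right_unique {p q q' : ℤ} (h1 : HasArc A p q) (h2 : HasArc A p q') : q = q' :=
  h.cover_left_unique (hA.arc h1).2 (hA.arc h2).2

theorem left_unique {p p' q : ℤ} (h1 : HasArc A p q) (h2 : HasArc A p' q) : p = p' :=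
  h.cover_right_unique (hA.arc h1).2 (hA.arc h2).2

theorem exists_bound : ∃ K : ℤ, ∀ p q, HasArc A p q → q - p ≤ K :=
  exists_arc_bound h.pos (E := HasArc A) (fun k _ _ => hA.tr k) fun _ _ _ => right_unique h hA

theorem exists_isNeighborArc {b : ℤ} (hb : ∃ p q, IsCoveringArc A b p q) :
    ∃ p q, IsNeighborArc c A b p q := by
  classical
  obtain ⟨K, hK⟩ := exists_bound h hA
  have hle : ∀ X, ∀ x ∈ coveringStarts A b X, x ≤ b := fun X x hx => by
    obtain ⟨-, q, -, hq, -⟩ := hx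
    exact hq.le
  have hge : ∀ X, ∀ x ∈ coveringStarts A b X, b - K ≤ x := fun X x hx => by
    obtain ⟨-, q, hq1, hq2, hq3⟩ := hx
    have := hK _ _ hq1
    omega
  by_cases hne : (coveringStarts A b (side c b)).Nonempty
  · obtain ⟨p, hp⟩ := exists_isGreatest_of_le hne (hle _)
    obtain ⟨-, q, hq⟩ := hp.1
    exact ⟨p, q, hq, by rwa [if_pos hne]⟩
  · obtain ⟨p, q, hpq⟩ := hb
    obtain ⟨p', hp'⟩ := exists_isLeast_of_le (S := coveringStarts A b Set.univ)
      ⟨p, trivial, q, hpq⟩ (hge _)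
    obtain ⟨-, q', hq'⟩ := hp'.1
    exact ⟨p', q', hq', by rwa [if_neg hne]⟩

theorem neighbor_unique {b p q p' q' : ℤ} (h1 : IsNeighborArc c A b p q)
    (h2 : IsNeighborArc c A b p' q') : p = p' ∧ q = q' := by
  have hp : p = p' := by
    have h3 := h1.2
    have h4 := h2.2
    split_ifs at h3 h4 with h5
    · exact h3.unique h4
    · exact h3.unique h4
  subst hp
  exact ⟨rfl, right_unique h hA h1.1.1 h2.1.1⟩

/-- The neighbor arc is the covering arc that is closest for the order. -/
theorem neighbor_closest_L {b p q : ℤ} (hb : b ∈ Lbar c) (h1 : IsNeighborArc c A b p q)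
    {p' q' : ℤ} (h2 : HasArc A p' q') (h3 : p' < b) (h4 : b < q') : q' = q ∨ r q q' := by
  by_contra hcon
  push Not at hcon
  have hqq := (h.not_iff hcon.1.symm).1 hcon.2
  obtain ⟨⟨ha, hpb, hbq⟩, hN⟩ := h1
  have hc1 := (hA.arc ha).2
  have hc2 := (hA.arc h2).2
  have hside : side c b = Lbar c := if_pos hb
  rw [hside] at hN
  -- The competing arc lies before the neighbor arc: q' ⋖ p' ≺ q ⋖ p. According to the order of p
  -- and p' and the color of the larger one, this is a forbidden pattern or contradicts the extremal
  -- choice of p.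
  have hp'q : r p' q := by
    rcases h.cover_le hc2 hqq with e | e
    · omega
    · exact e
  have hp'p : r p' p := h.trans _ _ _ hp'q hc1.1
  have hcov' : IsCoveringArc A b p' q' := ⟨h2, h3, h4⟩
  rcases lt_or_gt_of_ne (h.ne hp'p) with e | e
  · -- `p' < p`
    rcases h.col.L_or_R p with hp | hp
    · exact h.kij e (by omega) hp hc2.1 hp'p
    · split_ifs at hN with hne
      · exact not_L_and_R hN.1.1 hp
      · have := hN.2 ⟨trivial, _, hcov'⟩
        omega
  · rcases h.col.L_or_R p' with hp | hp
    · split_ifs at hN with hne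
      · have := hN.2 ⟨hp, _, hcov'⟩
        omega
      · exact hne ⟨_, hp, _, hcov'⟩
    · exact h.jki e (by omega) hp hp'q hc1.1

theorem neighbor_closest_R {b p q : ℤ} (hb : b ∈ Rbar c) (h1 : IsNeighborArc c A b p q)
    {p' q' : ℤ} (h2 : HasArc A p' q') (h3 : p' < b) (h4 : b < q') : q' = q ∨ r q' q := by
  by_contra hcon
  push Not at hcon
  have hqq := (h.not_iff hcon.1).1 hcon.2
  obtain ⟨⟨ha, hpb, hbq⟩, hN⟩ := h1
  have hc1 := (hA.arc ha).2
  have hc2 := (hA.arc h2).2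
  have hside : side c b = Rbar c := if_neg fun H => not_L_and_R H hb
  rw [hside] at hN
  have hpq' : r p q' := by
    rcases h.cover_le hc1 hqq with e | e
    · omega
    · exact e
  have hpp' : r p p' := h.trans _ _ _ hpq' hc2.1
  have hcov' : IsCoveringArc A b p' q' := ⟨h2, h3, h4⟩
  rcases lt_or_gt_of_ne (h.ne hpp') with e | e
  · rcases h.col.L_or_R p' with hp | hp
    · exact h.kij e (by omega) hp hc1.1 hpp'
    · split_ifs at hN with hne
      · have := hN.2 ⟨hp, _, hcov'⟩
        omega
      · exact hne ⟨_, hp, _, hcov'⟩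
  · rcases h.col.L_or_R p with hp | hp
    · split_ifs at hN with hne
      · exact not_L_and_R hp hN.1.1
      · have := hN.2 ⟨trivial, _, hcov'⟩
        omega
    · exact h.jki e (by omega) hp hpq' hc2.1

theorem step_of_next {b b' : ℤ} {l : Letter} (hn : next c A b = some (l, b')) :
    ∃ p, Step c r A b p b' ∧ (l = .right ↔ HasArc A b b') ∧
      (l = .down ↔ b ∈ Lbar c ∧ ∀ q, ¬ HasArc A b q) ∧
      (l = .up ↔ b ∈ Rbar c ∧ ∀ q, ¬ HasArc A b q) := by
  rcases next_eq_some hn with ⟨h1, rfl⟩ | ⟨h1, ⟨p, h2⟩, h3⟩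
  · have h2 := hA.arc h1
    refine ⟨b, ⟨h1, le_rfl, h2.1, Or.inl rfl, fun H => (lt_irrefl _ H).elim,
      fun H => (lt_irrefl _ H).elim⟩, by simp [h1], by simpa using fun _ => ⟨_, h1⟩,
      by simpa using fun _ => ⟨_, h1⟩⟩
  · refine ⟨p, ⟨h2.1.1, h2.1.2.1.le, h2.1.2.2, Or.inr h1, fun _ hb p' q' a1 a2 a3 =>
      neighbor_closest_L h hA hb h2 a1 a2 a3, fun _ hb p' q' a1 a2 a3 =>
      neighbor_closest_R h hA hb h2 a1 a2 a3⟩, ?_⟩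
    rcases h3 with ⟨h3, rfl⟩ | ⟨h3, rfl⟩
    · have : b ∉ Rbar c := h.col.not_mem_R.2 h3
      simp [h1, h3, this]
    · have : b ∈ Rbar c := h.col.not_mem_L.1 h3
      simp [h1, h3, this]

theorem next_none_spec {b : ℤ} (hn : next c A b = none) :
    (∀ q, ¬ HasArc A b q) ∧ ∀ p q, HasArc A p q → p < b → b < q → False := by
  obtain ⟨h1, h2⟩ := next_eq_none hn
  refine ⟨h1, fun p q h3 h4 h5 => ?_⟩
  obtain ⟨p', q', h6⟩ := exists_isNeighborArc h hA (c := c) ⟨p, q, h3, h4, h5⟩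
  exact h2 _ _ h6

omit h in
theorem coveringStarts_tr (k b : ℤ) (X : Set ℤ) (hX : ∀ x, x + k * n ∈ X ↔ x ∈ X) (p : ℤ) :
    p + k * n ∈ coveringStarts A (b + k * n) X ↔ p ∈ coveringStarts A b X := by
  unfold coveringStarts IsCoveringArc
  refine and_congr (hX p) ⟨?_, ?_⟩
  · rintro ⟨q, h1, h2, h3⟩
    refine ⟨q - k * n, ?_, by omega, by omega⟩
    rw [← hA.tr k]; simpa using h1
  · rintro ⟨q, h1, h2, h3⟩
    exact ⟨q + k * n, (hA.tr k).2 h1, by omega, by omega⟩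

theorem neighbor_tr (k : ℤ) {b p q : ℤ} (h1 : IsNeighborArc c A b p q) :
    IsNeighborArc c A (b + k * n) (p + k * n) (q + k * n) := by
  obtain ⟨⟨h1, h2, h3⟩, h4⟩ := h1
  refine ⟨⟨(hA.tr k).2 h1, by omega, by omega⟩, ?_⟩
  have hs : side c (b + k * n) = side c b := by
    unfold side
    by_cases hb : b ∈ Lbar c
    · rw [if_pos hb, if_pos ((h.col.mem_L_add b k).2 hb)]
    · rw [if_neg hb, if_neg fun H => hb ((h.col.mem_L_add b k).1 H)]
  have hX : ∀ x, x + k * n ∈ side c b ↔ x ∈ side c b := by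
    intro x
    unfold side
    split_ifs
    · exact h.col.mem_L_add x k
    · exact h.col.mem_R_add x k
  have hcs := coveringStarts_tr hA k b _ hX
  have hcu := coveringStarts_tr hA k b Set.univ (fun _ => Iff.rfl)
  rw [hs]
  have hne : (coveringStarts A (b + k * n) (side c b)).Nonempty ↔
      (coveringStarts A b (side c b)).Nonempty := by
    constructor
    · rintro ⟨x, hx⟩
      exact ⟨x - k * n, (hcs _).1 (by simpa using hx)⟩
    · rintro ⟨x, hx⟩
      exact ⟨x + k * n, (hcs _).2 hx⟩
  split_ifs at h4 ⊢ with h5 h6 h6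
  · refine ⟨(hcs _).2 h4.1, fun x hx => ?_⟩
    have := h4.2 ((hcs (x - k * n)).1 (by simpa using hx))
    omega
  · exact (h6 (hne.1 h5)).elim
  · exact (h5 (hne.2 h6)).elim
  · refine ⟨(hcu _).2 h4.1, fun x hx => ?_⟩
    have := h4.2 ((hcu (x - k * n)).1 (by simpa using hx))
    omega

theorem next_of_arc {b b' : ℤ} (h1 : HasArc A b b') : next c A b = some (.right, b') := by
  unfold next
  have hex : ∃ q, HasArc A b q := ⟨b', h1⟩
  rw [dif_pos hex, right_unique h hA hex.choose_spec h1]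

theorem next_of_neighbor {b p b' : ℤ} (h1 : ∀ q, ¬ HasArc A b q) (h2 : IsNeighborArc c A b p b') :
    (next c A b).map Prod.snd = some b' := by
  unfold next
  have hex : ∃ q p, IsNeighborArc c A b p q := ⟨b', p, h2⟩
  rw [dif_neg (fun H => h1 _ H.choose_spec), dif_pos hex]
  obtain ⟨p', hp'⟩ := hex.choose_spec
  rw [Option.map_some, (neighbor_unique h hA hp' h2).2]

theorem next_tr (k : ℤ) {b b' : ℤ} {l : Letter} (hn : next c A b = some (l, b')) :
    next c A (b + k * n) = some (l, b' + k * n) := by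
  rcases next_eq_some hn with ⟨h1, rfl⟩ | ⟨h1, ⟨p, h2⟩, h3⟩
  · exact next_of_arc h hA ((hA.tr k).2 h1)
  · have h4 : ∀ q, ¬ HasArc A (b + k * n) q := fun q hq =>
      h1 (q - k * n) ((hA.tr k).1 (by simpa using hq))
    have h5 := next_of_neighbor h hA h4 (neighbor_tr h hA k h2)
    obtain ⟨⟨l', b''⟩, h6, rfl⟩ := Option.map_eq_some_iff.1 h5
    rw [h6]
    congr 1
    refine Prod.ext ?_ rfl
    rcases next_eq_some h6 with ⟨h7, -⟩ | ⟨-, -, h7⟩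
    · exact (h4 _ h7).elim
    · rw [h.col.mem_L_add] at h7
      show l' = l
      rcases h3 with ⟨h3, rfl⟩ | ⟨h3, rfl⟩ <;> rcases h7 with ⟨h7, rfl⟩ | ⟨h7, rfl⟩ <;>
        first | rfl | exact (h3 h7).elim | exact (h7 h3).elim

end IsSubdiagram

end AffineTITO

namespace AffineTITO

/-! ### Finite sequences -/

theorem next_ne_int {c : Equiv.Perm ℤ} {A : Set Arc} {b b' x : ℤ} :
    next c A b ≠ some (.int x, b') := by
  intro H
  rcases next_eq_some H with ⟨-, h⟩ | ⟨-, -, ⟨-, h⟩ | ⟨-, h⟩⟩ <;> cases h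

section Sequences

variable {c : Equiv.Perm ℤ} {A : Set Arc} {a : ℤ}

theorem seqC_two_mul (k : ℕ) : seqC c A a (2 * k) = (seqPoint c A a k).map Letter.int := by
  unfold seqC
  rw [if_pos (by omega), show 2 * k / 2 = k by omega]

theorem seqC_two_mul_add_one (k : ℕ) :
    seqC c A a (2 * k + 1) = (seqPoint c A a k).bind fun b => (next c A b).map Prod.fst := by
  unfold seqC
  rw [if_neg (by omega), show (2 * k + 1) / 2 = k by omega]

theorem seqC_succ_eq_none {m : ℕ} (hm : seqC c A a m = none) : seqC c A a (m + 1) = none := by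
  obtain ⟨k, rfl | rfl⟩ := Nat.even_or_odd' m
  · rw [seqC_two_mul, Option.map_eq_none_iff] at hm
    rw [seqC_two_mul_add_one, hm, Option.bind_none]
  · rw [seqC_two_mul_add_one, Option.bind_eq_none_iff] at hm
    rw [show 2 * k + 1 + 1 = 2 * (k + 1) by ring, seqC_two_mul, Option.map_eq_none_iff, seqPoint,
      Option.bind_eq_none_iff]
    intro b hb
    have := hm b hb
    rw [Option.map_eq_none_iff] at this ⊢
    exact this

theorem seqC_eq_none_of_le {m m' : ℕ} (hm : seqC c A a m = none) (hle : m ≤ m') :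
    seqC c A a m' = none := by
  induction m', hle using Nat.le_induction with
  | base => exact hm
  | succ k _ ih => exact seqC_succ_eq_none ih

theorem IsSeqLast.unique {b b' : ℤ} (h : IsSeqLast c A a b) (h' : IsSeqLast c A a b') : b = b' := by
  obtain ⟨m, h1, h2⟩ := h
  obtain ⟨m', h3, h4⟩ := h'
  rcases lt_trichotomy m m' with e | rfl | e
  · rw [seqC_eq_none_of_le h2 e] at h3
    cases h3
  · rw [h1] at h3
    injection h3 with h3
    injection h3
  · rw [seqC_eq_none_of_le h4 e] at h1
    cases h1

theorem IsSeqLast.next_eq_none {b : ℤ} (h : IsSeqLast c A a b) : next c A b = none := by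
  obtain ⟨m, h1, h2⟩ := h
  obtain ⟨k, rfl | rfl⟩ := Nat.even_or_odd' m
  · rw [seqC_two_mul, Option.map_eq_some_iff] at h1
    obtain ⟨x, h1, h3⟩ := h1
    injection h3 with h3
    rw [seqC_two_mul_add_one, h1, h3, Option.bind_some, Option.map_eq_none_iff] at h2
    exact h2
  · rw [seqC_two_mul_add_one, Option.bind_eq_some_iff] at h1
    obtain ⟨x, -, h1⟩ := h1
    rw [Option.map_eq_some_iff] at h1
    obtain ⟨⟨l, y⟩, h3, h4⟩ := h1
    simp only at h4
    subst h4
    exact (next_ne_int h3).elim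

theorem SeqFinite.exists_isSeqLast (h : SeqFinite c A a) : ∃ b, IsSeqLast c A a b := by
  classical
  have hm := Nat.find_spec h
  have hmin := fun m => @Nat.find_min _ _ h m
  set m := Nat.find h
  obtain ⟨k, hk | hk⟩ := Nat.even_or_odd' m
  · rcases k with _ | k
    · rw [hk, seqC_two_mul] at hm
      simp [seqPoint] at hm
    · have h1 := hmin (2 * k + 1) (by omega)
      rw [hk, seqC_two_mul, Option.map_eq_none_iff, seqPoint, Option.bind_eq_none_iff] at hm
      rw [seqC_two_mul_add_one, Option.bind_eq_none_iff] at h1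
      refine (h1 fun b hb => ?_).elim
      have := hm b hb
      rw [Option.map_eq_none_iff] at this ⊢
      exact this
  · have h1 := hmin (2 * k) (by omega)
    rw [seqC_two_mul] at h1
    obtain ⟨b, hb⟩ := Option.ne_none_iff_exists'.1 h1
    obtain ⟨x, h2, rfl⟩ := Option.map_eq_some_iff.1 hb
    exact ⟨x, 2 * k, by rw [seqC_two_mul, h2]; rfl, by rw [← hk]; exact hm⟩

theorem SeqFinite.finiteNumbering_eq (h : SeqFinite c A a) (n : ℕ) :
    ∃ b, next c A b = none ∧
      finiteNumbering n c A a = {γ | IsArcChain A γ ∧ γ ⊆ Set.Ioc (b - n) b} := by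
  obtain ⟨b, hb⟩ := h.exists_isSeqLast
  refine ⟨b, hb.next_eq_none, Set.ext fun γ => and_congr_right fun _ => ⟨?_, fun H => ⟨b, hb, H⟩⟩⟩
  rintro ⟨b', hb', H⟩
  rwa [hb.unique hb']

/-- The points `P k` and the arrows `s k` of an infinite sequence. -/
structure IsSeq (c : Equiv.Perm ℤ) (A : Set Arc) (a : ℤ) (P : ℕ → ℤ) (s : ℕ → Letter) : Prop where
  zero : P 0 = a
  next : ∀ k, next c A (P k) = some (s k, P (k + 1))

theorem exists_isSeq (h : ¬ SeqFinite c A a) : ∃ P s, IsSeq c A a P s := by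
  unfold SeqFinite at h
  push Not at h
  have h1 : ∀ k, ∃ b, seqPoint c A a k = some b := fun k => by
    have := h (2 * k)
    rw [seqC_two_mul] at this
    exact Option.ne_none_iff_exists'.1 fun H => this (by rw [H]; rfl)
  choose P hP using h1
  have h2 : ∀ k, ∃ l, AffineTITO.next c A (P k) = some (l, P (k + 1)) := fun k => by
    have := hP (k + 1)
    rw [seqPoint, hP k, Option.bind_some] at this
    obtain ⟨⟨l, y⟩, h3, h4⟩ := Option.map_eq_some_iff.1 this
    exact ⟨l, by rw [h3, ← h4]⟩
  choose s hs using h2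
  refine ⟨P, s, ?_, hs⟩
  have := hP 0
  rw [seqPoint] at this
  exact (Option.some.inj this).symm

namespace IsSeq

variable {P : ℕ → ℤ} {s : ℕ → Letter} (hP : IsSeq c A a P s)
include hP

theorem seqPoint_eq (k : ℕ) : seqPoint c A a k = some (P k) := by
  induction k with
  | zero => rw [seqPoint, hP.zero]
  | succ k ih => rw [seqPoint, ih, Option.bind_some, hP.next, Option.map_some]

theorem seqC_even (k : ℕ) : seqC c A a (2 * k) = some (.int (P k)) := by
  rw [seqC_two_mul, hP.seqPoint_eq, Option.map_some]

theorem seqC_odd (k : ℕ) : seqC c A a (2 * k + 1) = some (s k) := by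
  rw [seqC_two_mul_add_one, hP.seqPoint_eq, Option.bind_some, hP.next, Option.map_some]

theorem s_ne_int (k : ℕ) (x : ℤ) : s k ≠ .int x := fun H =>
  next_ne_int (H ▸ hP.next k)

theorem mod_s (n k : ℕ) : (s k).mod n = s k := by
  have := hP.s_ne_int k
  cases h : s k <;> simp_all [Letter.mod]

theorem seqCmod_even (n k : ℕ) : seqCmod n c A a (2 * k) = some (.int (P k % n)) := by
  unfold seqCmod
  rw [hP.seqC_even]; rfl

theorem seqCmod_odd (n k : ℕ) : seqCmod n c A a (2 * k + 1) = some (s k) := by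
  unfold seqCmod
  rw [hP.seqC_odd, Option.map_some, hP.mod_s]

theorem not_seqFinite : ¬ SeqFinite c A a := by
  rintro ⟨m, hm⟩
  obtain ⟨k, rfl | rfl⟩ := Nat.even_or_odd' m
  · rw [hP.seqC_even] at hm; cases hm
  · rw [hP.seqC_odd] at hm; cases hm

end IsSeq

end Sequences

end AffineTITO

namespace AffineTITO

/-! ### Periodic factors -/

/-- The value at i is read off after m periods and the drift of m periods is subtracted; the result
does not depend on m once i + k m ≥ 0, and m = |i| is always enough. -/
theorem exists_int_extension {Q : ℕ → ℤ} {u : ℕ → Letter} {k : ℕ} {e : ℤ} (hk : 0 < k)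
    (hQ : ∀ j, Q (j + k) = Q j + e) (hu : ∀ j, u (j + k) = u j) :
    ∃ (F : ℤ → ℤ) (s : ℤ → Letter), ∀ (i : ℤ) (m : ℕ), 0 ≤ i + k * m →
      F i = Q (i + k * m).toNat - m * e ∧ s i = u (i + k * m).toNat := by
  have hQm : ∀ j m : ℕ, Q (j + k * m) = Q j + m * e ∧ u (j + k * m) = u j := fun j m => by
    induction m with
    | zero => simp
    | succ m ih =>
      rw [show j + k * (m + 1) = j + k * m + k by ring, hQ, hu, ih.1, ih.2]
      push_cast
      exact ⟨by ring, rfl⟩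
  have key : ∀ (i : ℤ) (m m' : ℕ), 0 ≤ i + k * m →
      Q (i + k * (m + m' : ℕ)).toNat = Q (i + k * m).toNat + m' * e ∧
        u (i + k * (m + m' : ℕ)).toNat = u (i + k * m).toNat := fun i m m' h => by
    rw [show (i + k * (m + m' : ℕ)).toNat = (i + k * m).toNat + k * m' by
      push_cast
      rw [mul_add, ← add_assoc, Int.toNat_add h (by positivity)]
      norm_cast]
    exact hQm _ _
  have hpos : ∀ i : ℤ, 0 ≤ i + k * (i.natAbs : ℕ) := fun i => by
    have h1 : (i.natAbs : ℤ) ≤ k * i.natAbs := le_mul_of_one_le_left (by positivity) (by omega)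
    omega
  refine ⟨fun i => Q (i + k * i.natAbs).toNat - i.natAbs * e,
    fun i => u (i + k * i.natAbs).toNat, fun i m hm => ?_⟩
  obtain ⟨h1, h2⟩ := key i i.natAbs m (hpos i)
  obtain ⟨h3, h4⟩ := key i m i.natAbs hm
  rw [add_comm m, h1] at h3
  rw [add_comm m, h2] at h4
  exact ⟨by simp only; linarith, h4⟩

/-- A biinfinite sequence of successive points `F i` followed by the arrows `s i`, which is
`k`-periodic modulo `n`. -/
structure IsOrbit (n : ℕ) (c : Equiv.Perm ℤ) (A : Set Arc) (F : ℤ → ℤ) (s : ℤ → Letter)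
    (k d : ℤ) : Prop where
  pos : 0 < k
  next : ∀ i, next c A (F i) = some (s i, F (i + 1))
  add : ∀ i, F (i + k) = F i + d * n
  s_add : ∀ i, s (i + k) = s i
  dvd : ∀ i j, F i ≡ F j [ZMOD n] → k ∣ i - j

section

variable {n : ℕ} {c : Equiv.Perm ℤ} {r : ℤ → ℤ → Prop} {A : Set Arc}

theorem next_congr (h : AvoidsPatterns n c r) (hA : IsSubdiagram n r A) {b b' x x' : ℤ}
    {l l' : Letter} (h1 : next c A b = some (l, x)) (h2 : next c A b' = some (l', x'))
    (e : b ≡ b' [ZMOD n]) : l = l' ∧ x - b = x' - b' := by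
  obtain ⟨k, rfl⟩ := exists_eq_add_mul e
  rw [hA.next_tr h k h1] at h2
  have := Option.some.inj h2
  rw [Prod.mk.injEq] at this
  exact ⟨this.1, by omega⟩

namespace IsSeq

variable {a : ℤ} {P : ℕ → ℤ} {s : ℕ → Letter} (hP : IsSeq c A a P s)

include hP in
-- The residue of a point determines the arrow that follows and the displacement, so two congruent
-- points have parallel futures.
theorem congr (h : AvoidsPatterns n c r) (hA : IsSubdiagram n r A) {i j : ℕ}
    (e : P i ≡ P j [ZMOD n]) (m : ℕ) :
    s (i + m) = s (j + m) ∧ P (i + m) - P i = P (j + m) - P j := by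
  have key : ∀ m, P (i + m) - P i = P (j + m) - P j := fun m => by
    induction m with
    | zero => simp
    | succ m ih =>
      have h1 : P (i + m) ≡ P (j + m) [ZMOD n] := by
        have := e.add_right (P (i + m) - P i)
        rw [ih] at this
        convert this using 1
        · omega
        · omega
      have := (next_congr h hA (hP.next (i + m)) (hP.next (j + m)) h1).2
      rw [← add_assoc, ← add_assoc]
      omega
  refine ⟨(next_congr h hA (hP.next (i + m)) (hP.next (j + m)) ?_).1, key m⟩
  have := e.add_right (P (i + m) - P i)
  rw [key m] at this
  convert this using 1
  · have := key m; omega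
  · omega

include hP in
-- Integers and arrows alternate, so a repeated word has even length and half of its length is a
-- period of the points modulo n.
theorem eventuallyRepeats_length {w : List Letter} (hw : EventuallyRepeats (seqCmod n c A a) w) :
    ∃ m, 0 < m ∧ w.length = 2 * m ∧ ∃ i, P i ≡ P (i + m) [ZMOD n] := by
  obtain ⟨hne, N, hN⟩ := hw
  have hper : ∀ j, seqCmod n c A a (N + j + w.length) = seqCmod n c A a (N + j) := fun j => by
    rw [add_assoc, hN, hN, Nat.add_mod_right]
  have h1 := hper N
  rw [← two_mul, hP.seqCmod_even] at h1
  have hpos := List.length_pos_iff.2 hne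
  obtain ⟨m, hm | hm⟩ := Nat.even_or_odd' w.length
  · refine ⟨m, by omega, hm, N, ?_⟩
    rw [hm, ← mul_add, hP.seqCmod_even] at h1
    have h2 := Option.some.inj h1
    injection h2 with h2
    exact h2.symm
  · rw [hm, ← add_assoc, ← mul_add, hP.seqCmod_odd] at h1
    exact (hP.s_ne_int _ _ (Option.some.inj h1)).elim

include hP in
-- Passing to a biinfinite orbit disposes of the preperiod. Minimality of k becomes the divisibility
-- condition of `IsOrbit`.
theorem exists_orbit_of_period (h : AvoidsPatterns n c r) (hA : IsSubdiagram n r A) {k t : ℕ}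
    (hk : 0 < k) (ht : P t ≡ P (t + k) [ZMOD n])
    (hmin : ∀ m, 0 < m → m < k → ∀ i, ¬ P i ≡ P (i + m) [ZMOD n]) :
    ∃ F σ d, IsOrbit n c A F σ k d ∧ ∀ i : ℕ, F i = P (t + i) ∧ σ i = s (t + i) := by
  obtain ⟨d, hd⟩ := exists_eq_add_mul ht
  have hQ : ∀ j, P (t + (j + k)) = P (t + j) + d * n := fun j => by
    have := (hP.congr h hA ht j).2
    rw [show t + (j + k) = t + k + j by ring]
    omega
  have hu : ∀ j, s (t + (j + k)) = s (t + j) := fun j => by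
    rw [show t + (j + k) = t + k + j by ring]
    exact ((hP.congr h hA ht j).1).symm
  obtain ⟨F, σ, hF⟩ := exists_int_extension (Q := fun j => P (t + j)) (u := fun j => s (t + j))
    hk hQ hu
  have hpos : ∀ i : ℤ, 0 ≤ i + k * (i.natAbs : ℕ) := fun i => by
    have h1 : (i.natAbs : ℤ) ≤ k * i.natAbs := le_mul_of_one_le_left (by positivity) (by omega)
    omega
  have hpos' : ∀ (i : ℤ) (m : ℕ), i.natAbs ≤ m → 0 ≤ i + k * (m : ℕ) := fun i m hm => by
    have h1 : (m : ℤ) ≤ k * m := le_mul_of_one_le_left (by positivity) (by omega)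
    omega
  refine ⟨F, σ, d, ⟨by omega, fun i => ?_, fun i => ?_, fun i => ?_, fun i j e => ?_⟩,
    fun i => ?_⟩
  · have h0 := hpos i
    obtain ⟨h1, h2⟩ := hF i _ h0
    obtain ⟨h3, h4⟩ := hF (i + 1) i.natAbs (by omega)
    rw [show (i + 1 + k * (i.natAbs : ℕ)).toNat = (i + k * (i.natAbs : ℕ)).toNat + 1 by omega] at h3
    have h5 := hA.next_tr h (-(i.natAbs * d)) (hP.next (t + (i + k * (i.natAbs : ℕ)).toNat))
    rw [h1, h2, h3]
    convert h5 using 2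
    · ring
    · ring_nf
  · obtain ⟨h1, -⟩ := hF i (i.natAbs + 1) (hpos' _ _ (by omega))
    obtain ⟨h3, -⟩ := hF (i + k) i.natAbs (by have := hpos i; omega)
    rw [show i + k + k * (i.natAbs : ℕ) = i + k * ((i.natAbs + 1 : ℕ) : ℤ) by push_cast; ring] at h3
    rw [h1, h3]
    push_cast
    ring
  · obtain ⟨-, h1⟩ := hF i (i.natAbs + 1) (hpos' _ _ (by omega))
    obtain ⟨-, h3⟩ := hF (i + k) i.natAbs (by have := hpos i; omega)
    rw [show i + k + k * (i.natAbs : ℕ) = i + k * ((i.natAbs + 1 : ℕ) : ℤ) by push_cast; ring] at h3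
    rw [h1, h3]
  · obtain ⟨m, hm⟩ : ∃ m : ℕ, m = i.natAbs + j.natAbs := ⟨_, rfl⟩
    obtain ⟨h1, -⟩ := hF i m (hpos' _ _ (by omega))
    obtain ⟨h2, -⟩ := hF j m (hpos' _ _ (by omega))
    have hi := hpos' i m (by omega)
    have hj := hpos' j m (by omega)
    have e' : P (t + (i + k * m).toNat) ≡ P (t + (j + k * m).toNat) [ZMOD n] := by
      rw [h1, h2] at e
      have := e.add_right (m * (d * n))
      simpa using this
    obtain ⟨I, hI⟩ := Int.eq_ofNat_of_zero_le hi
    obtain ⟨J, hJ⟩ := Int.eq_ofNat_of_zero_le hj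
    have hmod : ∀ x q : ℕ, P (t + x) ≡ P (t + (x + k * q)) [ZMOD n] := fun x q => by
      induction q with
      | zero => simp [Int.ModEq]
      | succ q ih =>
        refine ih.trans ?_
        rw [show x + k * (q + 1) = x + k * q + k by ring, hQ]
        simp [Int.ModEq]
    have main : ∀ I J : ℕ, I ≤ J → P (t + I) ≡ P (t + J) [ZMOD n] → k ∣ J - I := by
      intro I J hIJ e
      -- A nonzero remainder ρ of J - I modulo k would be a shorter period.
      obtain ⟨q, ρ, hq, hρ⟩ : ∃ q ρ, J - I = k * q + ρ ∧ ρ < k :=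
        ⟨_, _, (Nat.div_add_mod (J - I) k).symm, Nat.mod_lt _ hk⟩
      rcases Nat.eq_zero_or_pos ρ with h0 | h0
      · exact ⟨q, by omega⟩
      · refine (hmin ρ h0 hρ (t + (I + k * q)) ?_).elim
        rw [show t + (I + k * q) + ρ = t + J by omega]
        exact (hmod I q).symm.trans e
    rw [hI, hJ] at e'
    simp only [Int.toNat_natCast] at e' hI hJ
    rcases le_total I J with hle | hle
    · obtain ⟨q, hq⟩ := main I J hle e'
      refine ⟨-q, ?_⟩
      have : (J : ℤ) - I = k * q := by exact_mod_cast (by omega : (J : ℤ) - I = ((k * q : ℕ) : ℤ))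
      linarith
    · obtain ⟨q, hq⟩ := main J I hle e'.symm
      refine ⟨q, ?_⟩
      have : (I : ℤ) - J = k * q := by exact_mod_cast (by omega : (I : ℤ) - J = ((k * q : ℕ) : ℤ))
      linarith
  · obtain ⟨h1, h2⟩ := hF i 0 (by simp)
    simpa using And.intro h1 h2

end IsSeq

end

end AffineTITO

/-! ### The factor τ_a and its orbit -/

namespace AffineTITO

section

variable {n : ℕ} {c : Equiv.Perm ℤ} {r : ℤ → ℤ → Prop} {A : Set Arc} {a : ℤ} {P : ℕ → ℤ}
  {s : ℕ → Letter}

theorem tauStart_cases :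
    (tauStart n c A a = .down ∧ ∃ i w, IsPeriodicFactorAt n c A a .down i w) ∨
    (tauStart n c A a = .up ∧ (∃ i w, IsPeriodicFactorAt n c A a .up i w) ∧
      ¬ ∃ i w, IsPeriodicFactorAt n c A a .down i w) ∨
    (tauStart n c A a = .right ∧ (¬ ∃ i w, IsPeriodicFactorAt n c A a .up i w) ∧
      ¬ ∃ i w, IsPeriodicFactorAt n c A a .down i w) := by
  unfold tauStart
  split_ifs with h1 h2
  · exact Or.inl ⟨rfl, h1⟩
  · exact Or.inr (Or.inl ⟨rfl, h2, h1⟩)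
  · exact Or.inr (Or.inr ⟨rfl, h2, h1⟩)

theorem tauStart_ne_int (x : ℤ) : tauStart n c A a ≠ .int x := by
  rcases tauStart_cases (n := n) (c := c) (A := A) (a := a) with ⟨h, -⟩ | ⟨h, -⟩ | ⟨h, -⟩ <;>
    rw [h] <;> exact fun H => by cases H

namespace IsSeq

variable (h : AvoidsPatterns n c r) (hA : IsSubdiagram n r A) (hP : IsSeq c A a P s)
include h hA hP

/-- The word runs from the arrow that follows P t, at the odd position 2t + 1, to the integer P (t +
k): k arrows and k integers. No shorter word is repeated, because of `hmin`. -/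
theorem exists_isPeriodicFactorAt {k t : ℕ} (hk : 0 < k) (ht : P t ≡ P (t + k) [ZMOD n])
    (hmin : ∀ m, 0 < m → m < k → ∀ i, ¬ P i ≡ P (i + m) [ZMOD n]) :
    ∃ w, w.length = 2 * k ∧ IsPeriodicFactorAt n c A a (s t) (2 * t + 1) w := by
  have hC : ∀ m, ∃ l, seqC c A a m = some l := fun m => by
    rw [← Option.ne_none_iff_exists']
    exact fun H => hP.not_seqFinite ⟨m, H⟩
  choose C hC using hC
  have hper : ∀ j, seqCmod n c A a (2 * t + 1 + (j + 2 * k)) = seqCmod n c A a (2 * t + 1 + j) := by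
    intro j
    obtain ⟨m, rfl | rfl⟩ := Nat.even_or_odd' j
    · rw [show 2 * t + 1 + (2 * m + 2 * k) = 2 * (t + k + m) + 1 by ring,
        show 2 * t + 1 + 2 * m = 2 * (t + m) + 1 by ring, hP.seqCmod_odd, hP.seqCmod_odd,
        (hP.congr h hA ht m).1]
    · rw [show 2 * t + 1 + (2 * m + 1 + 2 * k) = 2 * (t + k + (m + 1)) by ring,
        show 2 * t + 1 + (2 * m + 1) = 2 * (t + (m + 1)) by ring, hP.seqCmod_even,
        hP.seqCmod_even]
      have h1 := (hP.congr h hA ht (m + 1)).2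
      have : P (t + (m + 1)) ≡ P (t + k + (m + 1)) [ZMOD n] := by
        have := ht.add_right (P (t + (m + 1)) - P t)
        rw [h1] at this
        convert this using 1 <;> omega
      rw [this.eq]
  have hper' : ∀ j, seqCmod n c A a (2 * t + 1 + j) =
      seqCmod n c A a (2 * t + 1 + j % (2 * k)) := by
    intro j
    conv_lhs => rw [← Nat.mod_add_div j (2 * k)]
    generalize j / (2 * k) = q
    induction q with
    | zero => simp
    | succ q ih =>
      rw [← ih, show j % (2 * k) + 2 * k * (q + 1) = j % (2 * k) + 2 * k * q + 2 * k by ring, hper]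
  have hlen : ((List.range (2 * k)).map fun j => C (2 * t + 1 + j)).length = 2 * k := by simp
  refine ⟨(List.range (2 * k)).map fun j => C (2 * t + 1 + j), hlen, ?_, ?_, ⟨?_, ?_⟩, ?_⟩
  · intro j hj
    rw [hlen] at hj
    rw [hC]
    simp [hj]
  · have h1 := hP.seqC_odd t
    rw [hC] at h1
    obtain ⟨q, hq⟩ : ∃ q, 2 * k = q + 1 := ⟨2 * k - 1, by omega⟩
    simp [hq, List.range_succ_eq_map, Option.some.inj h1]
  · intro H
    have := congrArg List.length H
    simp at this
    omega
  · refine ⟨2 * t + 1, fun j => ?_⟩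
    have : j % (2 * k) < 2 * k := Nat.mod_lt _ (by omega)
    rw [hper', seqCmod, hC]
    simp [this]
  · intro w' hw'
    obtain ⟨m, hm, hm', i, hi⟩ := hP.eventuallyRepeats_length hw'
    have : k ≤ m := by
      by_contra hlt
      exact hmin m hm (by omega) i hi
    simp only [List.length_map, List.length_range]
    omega

/-- A periodic factor may begin before the sequence has become periodic. Its letters agree modulo n
with those of the tail, so its first integer P (t + 1) is congruent to a point of the tail and is
periodic. The point P t before its first arrow need not be; this is why the periodicity is stated
from t + 1, and the letter l also at t + k. -/
theorem of_isPeriodicFactorAt {k t₀ : ℕ} (hk : 0 < k) (ht : P t₀ ≡ P (t₀ + k) [ZMOD n])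
    (hmin : ∀ m, 0 < m → m < k → ∀ i, ¬ P i ≡ P (i + m) [ZMOD n]) {l : Letter}
    (hl : ∀ x, l ≠ .int x) {i : ℕ} {w : List Letter} (hw : IsPeriodicFactorAt n c A a l i w) :
    ∃ t, s t = l ∧ P (t + 1) ≡ P (t + 1 + k) [ZMOD n] ∧ s (t + k) = l ∧
      (∀ x, Letter.int x ∈ w ↔ ∃ j < k, x = P (t + 1 + j)) ∧
      (∀ l', l' ∈ w → (∀ x, l' ≠ .int x) → ∃ j < k, l' = s (t + j)) ∧ l ∈ w := by
  obtain ⟨hw1, hw2, hw3, hw4⟩ := hw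
  have hlen : w.length = 2 * k := by
    obtain ⟨w', h1, -, -, h2, -⟩ := hP.exists_isPeriodicFactorAt h hA hk ht hmin
    have h3 := hw4 _ h2
    obtain ⟨m, hm, hm', i, hi⟩ := hP.eventuallyRepeats_length hw3
    have : k ≤ m := by
      by_contra hlt
      exact hmin m hm (by omega) i hi
    simp only [List.length_map] at h3 hm'
    omega
  have hw0 : w[0]? = some l := by rwa [List.head?_eq_getElem?] at hw2
  have h0 := hw1 0 (by omega)
  rw [hw0, add_zero] at h0
  obtain ⟨t, rfl | rfl⟩ := Nat.even_or_odd' i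
  · rw [hP.seqC_even] at h0
    exact (hl _ (Option.some.inj h0).symm).elim
  rw [hP.seqC_odd] at h0
  have hst := Option.some.inj h0
  obtain ⟨-, N, hN⟩ := hw3
  simp only [List.length_map, hlen, List.getElem?_map] at hN
  have hlmod : l.mod n = l := by rw [← hst, hP.mod_s]
  have hN0 := hN 0
  rw [Nat.zero_mod, hw0, add_zero, Option.map_some, hlmod] at hN0
  obtain ⟨x, rfl | rfl⟩ := Nat.even_or_odd' N
  · rw [hP.seqCmod_even] at hN0
    exact (hl _ (Option.some.inj hN0).symm).elim
  have hN1 := hN 1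
  have hN2 := hN (2 * k + 1)
  have hN3 := hN (2 * k)
  have hw11 := hw1 1 (by omega)
  rw [Nat.mod_self, hw0, show 2 * x + 1 + 2 * k = 2 * (x + k) + 1 by ring, hP.seqCmod_odd,
    Option.map_some, hlmod] at hN3
  rw [show 2 * t + 1 + 1 = 2 * (t + 1) by ring, hP.seqC_even] at hw11
  rw [show 2 * x + 1 + 1 = 2 * (x + 1) by ring, hP.seqCmod_even, Nat.mod_eq_of_lt (by omega),
    ← hw11] at hN1
  rw [show 2 * x + 1 + (2 * k + 1) = 2 * (x + 1 + k) by ring, hP.seqCmod_even,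
    Nat.add_mod_left, Nat.mod_eq_of_lt (by omega), ← hw11] at hN2
  have e1 : P (x + 1) ≡ P (t + 1) [ZMOD n] := by
    have := Option.some.inj hN1
    injection this
  have e2 : P (x + 1 + k) ≡ P (t + 1) [ZMOD n] := by
    have := Option.some.inj hN2
    injection this
  refine ⟨t, hst, ?_, ?_, ?_, ?_, List.mem_of_getElem? hw0⟩
  · have h1 := (hP.congr h hA e1 k).2
    have h2 := (e1.symm.trans (e1.trans e2.symm)).trans e2
    have h3 := (e1.trans e2.symm).add_right (P (t + 1) - P (x + 1))
    have h4 : P (x + 1 + k) + (P (t + 1) - P (x + 1)) = P (t + 1 + k) := by omega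
    rw [h4] at h3
    convert h3 using 1
    omega
  · have h1 := (hP.congr h hA e1 (k - 1)).1
    rw [show x + 1 + (k - 1) = x + k by omega, show t + 1 + (k - 1) = t + k by omega] at h1
    rw [← h1]
    exact Option.some.inj hN3
  · intro y
    rw [List.mem_iff_getElem?]
    constructor
    · rintro ⟨j, hj⟩
      have hjl : j < w.length := (List.getElem?_eq_some_iff.1 hj).1
      have h1 := hw1 j hjl
      rw [hj] at h1
      obtain ⟨m, rfl | rfl⟩ := Nat.even_or_odd' j
      · rw [show 2 * t + 1 + 2 * m = 2 * (t + m) + 1 by ring, hP.seqC_odd] at h1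
        exact (hP.s_ne_int _ _ (Option.some.inj h1)).elim
      · rw [show 2 * t + 1 + (2 * m + 1) = 2 * (t + 1 + m) by ring, hP.seqC_even] at h1
        have := Option.some.inj h1
        injection this with this
        exact ⟨m, by omega, this.symm⟩
    · rintro ⟨m, hm, rfl⟩
      refine ⟨2 * m + 1, ?_⟩
      rw [← hw1 _ (by omega), show 2 * t + 1 + (2 * m + 1) = 2 * (t + 1 + m) by ring, hP.seqC_even]
  · intro l' hl' hne
    obtain ⟨j, hj⟩ := List.mem_iff_getElem?.1 hl'
    have hjl : j < w.length := (List.getElem?_eq_some_iff.1 hj).1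
    have h1 := hw1 j hjl
    rw [hj] at h1
    obtain ⟨m, rfl | rfl⟩ := Nat.even_or_odd' j
    · rw [show 2 * t + 1 + 2 * m = 2 * (t + m) + 1 by ring, hP.seqC_odd] at h1
      exact ⟨m, by omega, (Option.some.inj h1).symm⟩
    · rw [show 2 * t + 1 + (2 * m + 1) = 2 * (t + 1 + m) by ring, hP.seqC_even] at h1
      exact (hne _ (Option.some.inj h1).symm).elim

/-- The orbit is indexed so that F 0 is the first integer of τ_a. The first arrow of τ_a is then σ
(-1), by periodicity, even though F (-1) need not occur in the sequence just before F 0. Any arrow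
of the orbit begins some periodic factor, so the priority ↓, ↑, → in the choice of the first letter
tells which arrows are absent. -/
theorem exists_orbit :
    ∃ F σ k d, IsOrbit n c A F σ k d ∧ tauInts n c A a = F '' Set.Ico 0 k ∧
      σ (-1) = tauStart n c A a ∧
      (Letter.down ∈ tau n c A a ↔ tauStart n c A a = .down) ∧
      (tauStart n c A a ≠ .down → ∀ i, σ i ≠ .down) ∧
      (tauStart n c A a = .right → ∀ i, σ i = .right) := by
  classical
  obtain ⟨i, j, hij, e⟩ := exists_modEq_of_fun h.pos P
  have hex : ∃ k, 0 < k ∧ ∃ t, P t ≡ P (t + k) [ZMOD n] :=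
    ⟨j - i, by omega, i, by rwa [show i + (j - i) = j by omega]⟩
  obtain ⟨hk, t₀, ht₀⟩ := Nat.find_spec hex
  have hmin : ∀ m, 0 < m → m < Nat.find hex → ∀ i, ¬ P i ≡ P (i + m) [ZMOD n] :=
    fun m hm hlt i e => Nat.find_min hex hlt ⟨hm, i, e⟩
  set k := Nat.find hex
  have htau : ∃ w, IsTau n c A a w := by
    have hex2 : ∃ i, ∃ w, IsPeriodicFactorAt n c A a (tauStart n c A a) i w := by
      rcases tauStart_cases (n := n) (c := c) (A := A) (a := a) with ⟨h1, h2⟩ | ⟨h1, h2, -⟩ |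
        ⟨h1, h2, h3⟩
      · rwa [h1]
      · rwa [h1]
      · obtain ⟨w, -, hw⟩ := hP.exists_isPeriodicFactorAt h hA hk ht₀ hmin
        rw [h1]
        refine ⟨2 * t₀ + 1, w, ?_⟩
        cases hs : s t₀ with
        | int x => exact (hP.s_ne_int _ _ hs).elim
        | right => rwa [hs] at hw
        | up => exact (h2 ⟨_, w, hs ▸ hw⟩).elim
        | down => exact (h3 ⟨_, w, hs ▸ hw⟩).elim
    obtain ⟨w, hw⟩ := Nat.find_spec hex2
    exact ⟨w, _, hw, fun i' w' hw' => Nat.find_min' hex2 ⟨w', hw'⟩⟩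
  obtain ⟨i₁, hi₁, -⟩ : IsTau n c A a (tau n c A a) := by
    unfold tau
    rw [dif_pos htau]
    exact htau.choose_spec
  obtain ⟨t, hst, hpt, hsk, hints, harr, hmem⟩ :=
    hP.of_isPeriodicFactorAt h hA hk ht₀ hmin tauStart_ne_int hi₁
  obtain ⟨F, σ, d, hF, hFP⟩ := hP.exists_orbit_of_period h hA hk hpt hmin
  have hσ : ∀ i, ∃ j, P (t + 1 + j) ≡ P (t + 1 + j + k) [ZMOD n] ∧ σ i = s (t + 1 + j) := by
    intro i
    have hadd : ∀ m : ℕ, σ (i + k * m) = σ i := fun m => by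
      induction m with
      | zero => simp
      | succ m ih => rw [← ih, ← hF.s_add (i + k * m)]; push_cast; ring_nf
    have h1 : (i.natAbs : ℤ) ≤ k * i.natAbs := le_mul_of_one_le_left (by positivity) (by omega)
    obtain ⟨j, hj⟩ := Int.eq_ofNat_of_zero_le (show 0 ≤ i + k * (i.natAbs : ℕ) by omega)
    refine ⟨j, ?_, ?_⟩
    · have h2 := (hP.congr h hA hpt j).2
      have h3 := hpt.add_right (P (t + 1 + j) - P (t + 1))
      rw [show t + 1 + j + k = t + 1 + k + j by ring]
      convert h3 using 1 <;> omega
    · rw [← hadd i.natAbs, hj]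
      exact (hFP j).2
  refine ⟨F, σ, k, d, hF, ?_, ?_, ⟨?_, ?_⟩, ?_, ?_⟩
  · ext x
    unfold tauInts
    rw [Set.mem_ofPred_eq, hints, Set.mem_image]
    constructor
    · rintro ⟨j, hj, rfl⟩
      exact ⟨j, ⟨by omega, by omega⟩, (hFP j).1⟩
    · rintro ⟨j, ⟨hj0, hj⟩, rfl⟩
      obtain ⟨j, rfl⟩ := Int.eq_ofNat_of_zero_le hj0
      exact ⟨j, by omega, (hFP j).1⟩
  · rw [← hF.s_add, show (-1 : ℤ) + k = ((k - 1 : ℕ) : ℤ) by omega, (hFP _).2, ← hsk]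
    congr 1
    omega
  · intro hd
    obtain ⟨j, hj, hd⟩ := harr _ hd (fun x H => by cases H)
    rcases Nat.eq_zero_or_pos j with rfl | h0
    · rw [add_zero, hst] at hd
      exact hd.symm
    · have h1 := (hFP (j - 1)).2
      rw [show t + 1 + (j - 1) = t + j by omega, ← hd] at h1
      obtain ⟨j', h2, h3⟩ := hσ ((j - 1 : ℕ) : ℤ)
      obtain ⟨w, -, hw⟩ := hP.exists_isPeriodicFactorAt h hA hk h2 hmin
      rw [← h3, h1] at hw
      rcases tauStart_cases (n := n) (c := c) (A := A) (a := a) with ⟨h1, h2⟩ | ⟨h1, -, h2⟩ |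
        ⟨h1, -, h2⟩
      · exact h1
      · exact (h2 ⟨_, w, hw⟩).elim
      · exact (h2 ⟨_, w, hw⟩).elim
  · intro hd
    rwa [hd] at hmem
  · intro hne i hi
    obtain ⟨j', h2, h3⟩ := hσ i
    obtain ⟨w, -, hw⟩ := hP.exists_isPeriodicFactorAt h hA hk h2 hmin
    rw [← h3, hi] at hw
    rcases tauStart_cases (n := n) (c := c) (A := A) (a := a) with ⟨h1, h2⟩ | ⟨h1, -, h2⟩ |
      ⟨h1, -, h2⟩
    · exact hne h1
    · exact (h2 ⟨_, w, hw⟩).elim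
    · exact (h2 ⟨_, w, hw⟩).elim
  · intro hr i
    obtain ⟨j', h2, h3⟩ := hσ i
    obtain ⟨w, -, hw⟩ := hP.exists_isPeriodicFactorAt h hA hk h2 hmin
    rcases tauStart_cases (n := n) (c := c) (A := A) (a := a) with ⟨h1, -⟩ | ⟨h1, -⟩ |
      ⟨-, h1, h2⟩
    · rw [h1] at hr; cases hr
    · rw [h1] at hr; cases hr
    · rw [h3]
      cases hs : s (t + 1 + j') with
      | int x => exact (hP.s_ne_int _ _ hs).elim
      | right => rfl
      | up => exact (h1 ⟨_, w, hs ▸ hw⟩).elim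
      | down => exact (h2 ⟨_, w, hs ▸ hw⟩).elim

end IsSeq

end

end AffineTITO

namespace AffineTITO

/-! ### Chains -/

/-- A path that never ends meets a residue twice; as the relation is invariant under translation and
injective in both directions, the path is periodic up to translation, hence extends backwards. -/
theorem exists_terminal_or_biinfinite {n : ℕ} (hn : 0 < n) {E : ℤ → ℤ → Prop}
    (htr : ∀ (k : ℤ) {x y}, E (x + k * n) (y + k * n) ↔ E x y)
    (hr : ∀ {x y y'}, E x y → E x y' → y = y') (hl : ∀ {x x' y}, E x y → E x' y → x = x') (x : ℤ) :
    (∃ T, Relation.ReflTransGen E x T ∧ ∀ y, ¬ E T y) ∨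
      ∃ f : ℤ → ℤ, f 0 = x ∧ ∀ i, E (f i) (f (i + 1)) := by
  by_contra! H
  obtain ⟨H1, H2⟩ := H
  choose! u hu using H1
  let g : ℕ → ℤ := fun k => u^[k] x
  have hg : ∀ k, Relation.ReflTransGen E x (g k) ∧ E (g k) (g (k + 1)) := fun k => by
    have : Relation.ReflTransGen E x (g k) := by
      induction k with
      | zero => exact .refl
      | succ k ih =>
        refine ih.tail ?_
        simp only [g, Function.iterate_succ_apply']
        exact hu _ ih
    refine ⟨this, ?_⟩
    simp only [g, Function.iterate_succ_apply'] at this ⊢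
    exact hu _ this
  obtain ⟨i, j, hij, e⟩ := exists_modEq_of_fun hn g
  obtain ⟨k, hk⟩ := exists_eq_add_mul e
  -- Uniqueness of predecessors carries the repetition back to the starting point, so that there is
  -- no preperiod and the extension passes through x.
  have hback : ∀ m, m ≤ i → g (j - m) = g (i - m) + k * n := fun m hm => by
    induction m with
    | zero => exact hk
    | succ m ih =>
      have h1 := (hg (i - (m + 1))).2
      have h2 := (hg (j - (m + 1))).2
      rw [show i - (m + 1) + 1 = i - m by omega] at h1
      rw [show j - (m + 1) + 1 = j - m by omega, ih (by omega)] at h2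
      exact hl h2 ((htr k).2 h1)
  have h0 := hback i le_rfl
  rw [Nat.sub_self] at h0
  have hfwd : ∀ m, g (m + (j - i)) = g m + k * n := fun m => by
    induction m with
    | zero => rw [zero_add]; exact h0
    | succ m ih =>
      have h2 := (hg (m + (j - i))).2
      rw [ih] at h2
      rw [show m + 1 + (j - i) = m + (j - i) + 1 by ring]
      exact hr h2 ((htr k).2 (hg m).2)
  obtain ⟨F, _, hF⟩ := exists_int_extension (u := fun _ => Letter.up) (k := j - i) (by omega) hfwd
    fun _ => rfl
  obtain ⟨t, ht⟩ := H2 F (by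
    have := (hF 0 0 (by simp)).1
    simpa [g] using this)
  have h1 : (t.natAbs : ℤ) ≤ (j - i : ℕ) * t.natAbs :=
    le_mul_of_one_le_left (by positivity) (by omega)
  refine ht ?_
  rw [(hF t t.natAbs (by omega)).1, (hF (t + 1) t.natAbs (by omega)).1,
    show (t + 1 + (j - i : ℕ) * (t.natAbs : ℕ)).toNat = (t + (j - i : ℕ) * (t.natAbs : ℕ)).toNat + 1 by
      omega]
  have := (htr (-(t.natAbs * k))).2 (hg (t + (j - i : ℕ) * (t.natAbs : ℕ)).toNat).2
  convert this using 1 <;> ring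

/-- The chain `γ` from `m` to `T`. -/
structure ChainData (r : ℤ → ℤ → Prop) (γ : Set ℤ) (m T : ℤ) : Prop where
  memT : T ∈ γ
  memm : m ∈ γ
  mem_iff : ∀ z, z ∈ γ ↔ (z = T ∨ r T z) ∧ (z = m ∨ r z m)
  le : ∀ z ∈ γ, m ≤ z ∧ z ≤ T
  bot : ∀ x, ¬ HasArc (ncad r) x m
  top : ∀ x, ¬ HasArc (ncad r) T x
  up : ∀ x ∈ γ, x = T ∨ ∃ y ∈ γ, HasArc (ncad r) x y
  down : ∀ x ∈ γ, x = m ∨ ∃ y ∈ γ, HasArc (ncad r) y x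
  anti : ∀ x ∈ γ, ∀ y ∈ γ, y < x → r x y
  fin : γ.Finite

section

variable {n : ℕ} {c : Equiv.Perm ℤ} {r : ℤ → ℤ → Prop} (h : AvoidsPatterns n c r)
include h

theorem arc_right_unique {p q q' : ℤ} (h1 : HasArc (ncad r) p q) (h2 : HasArc (ncad r) p q') :
    q = q' := h.toIsPeriodicOrder.isSubdiagram_ncad.right_unique h h1 h2

theorem arc_left_unique {p p' q : ℤ} (h1 : HasArc (ncad r) p q) (h2 : HasArc (ncad r) p' q) :
    p = p' := h.toIsPeriodicOrder.isSubdiagram_ncad.left_unique h h1 h2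

/-- Consecutive points of a chain are covering relations of r, so the chain is an interval of r,
traversed by decreasing values. -/
theorem exists_chainData {γ : Set ℤ} (hγ : IsArcChain (ncad r) γ) : ∃ m T, ChainData r γ m T := by
  obtain ⟨l, hl, hc, hb, ht, rfl⟩ := hγ
  suffices ∀ (l : List ℤ) (x : ℤ), (x :: l).IsChain (HasArc (ncad r)) →
      ∃ T, T = (x :: l).getLast (by simp) ∧ (T = x ∨ r T x) ∧
        (∀ z, z ∈ x :: l ↔ (z = T ∨ r T z) ∧ (z = x ∨ r z x)) ∧ (∀ z ∈ x :: l, x ≤ z ∧ z ≤ T) ∧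
        (∀ z ∈ x :: l, z = T ∨ ∃ y ∈ x :: l, HasArc (ncad r) z y) ∧
        (∀ z ∈ x :: l, z = x ∨ ∃ y ∈ x :: l, HasArc (ncad r) y z) ∧
        (∀ z ∈ x :: l, ∀ y ∈ x :: l, y < z → r z y) by
    obtain ⟨x, l, rfl⟩ := List.exists_cons_of_ne_nil hl
    obtain ⟨T, hT, h1, h2, h3, h4, h5, h6⟩ := this l x hc
    rw [← hT] at ht
    exact ⟨x, T, by rw [hT]; exact List.getLast_mem _, List.mem_cons_self, h2, h3, hb, ht, h4, h5,
      h6, List.finite_toSet _⟩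
  intro l
  induction l with
  | nil =>
    intro x _
    refine ⟨x, rfl, Or.inl rfl, fun z => ?_, ?_, ?_, ?_, ?_⟩
    · rw [List.mem_singleton]
      refine ⟨fun e => ⟨Or.inl e, Or.inl e⟩, ?_⟩
      rintro ⟨h1 | h1, h2 | h2⟩
      · exact h1
      · exact h1
      · exact h2
      · exact (h.asymm h1 h2).elim
    · simp
    · simp
    · simp
    · simp
  | cons y l ih =>
    intro x hx
    rw [List.isChain_cons_cons] at hx
    obtain ⟨T, hT, h1, h2, h3, h4, h5, h6⟩ := ih y hx.2
    obtain ⟨hlt, hcov⟩ := hasArc_ncad.1 hx.1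
    have hTx : r T x := by
      rcases h1 with rfl | h1
      · exact hcov.1
      · exact h.trans _ _ _ h1 hcov.1
    have hzx : ∀ z ∈ y :: l, r z x := fun z hz => by
      rcases ((h2 z).1 hz).2 with rfl | h7
      · exact hcov.1
      · exact h.trans _ _ _ h7 hcov.1
    refine ⟨T, by rw [hT]; rfl, Or.inr hTx, fun z => ?_, ?_, ?_, ?_, ?_⟩
    · rw [List.mem_cons]
      constructor
      · rintro (rfl | hz)
        · exact ⟨Or.inr hTx, Or.inl rfl⟩
        · exact ⟨((h2 z).1 hz).1, Or.inr (hzx z hz)⟩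
      · rintro ⟨h7, rfl | h8⟩
        · exact Or.inl rfl
        · exact Or.inr ((h2 z).2 ⟨h7, h.le_cover hcov h8⟩)
    · intro z hz
      rcases List.mem_cons.1 hz with rfl | hz
      · have := h3 y List.mem_cons_self
        omega
      · have := h3 z hz
        omega
    · intro z hz
      rcases List.mem_cons.1 hz with rfl | hz
      · exact Or.inr ⟨y, by simp, hx.1⟩
      · exact (h4 z hz).imp id fun ⟨w, hw, hw'⟩ => ⟨w, List.mem_cons_of_mem _ hw, hw'⟩
    · intro z hz
      rcases List.mem_cons.1 hz with rfl | hz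
      · exact Or.inl rfl
      · rcases h5 z hz with rfl | ⟨w, hw, hw'⟩
        · exact Or.inr ⟨x, by simp, hx.1⟩
        · exact Or.inr ⟨w, List.mem_cons_of_mem _ hw, hw'⟩
    · intro z hz w hw hwz
      rcases List.mem_cons.1 hz with hz' | hz'
      · rcases List.mem_cons.1 hw with hw' | hw'
        · omega
        · have := h3 w hw'
          omega
      · rcases List.mem_cons.1 hw with hw' | hw'
        · exact hw' ▸ hzx z hz'
        · exact h6 z hz' w hw' hwz

/-- The hypothesis says that x is on no loop, so following arcs forwards and backwards stops on both
sides. -/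
theorem exists_isArcChain (x : ℤ)
    (hx : ∀ f : ℤ → ℤ, (∀ i, HasArc (ncad r) (f i) (f (i + 1))) → f 0 ≠ x) :
    ∃ γ, IsArcChain (ncad r) γ ∧ x ∈ γ := by
  have hA := h.toIsPeriodicOrder.isSubdiagram_ncad
  rcases exists_terminal_or_biinfinite h.pos (E := HasArc (ncad r)) (fun k _ _ => hA.tr k)
    (fun h1 h2 => hA.right_unique h h1 h2) (fun h1 h2 => hA.left_unique h h1 h2) x with
    ⟨T, hT, hT'⟩ | ⟨f, hf, hf'⟩
  swap
  · exact (hx f hf' hf).elim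
  rcases exists_terminal_or_biinfinite h.pos (E := fun a b => HasArc (ncad r) b a)
    (fun k _ _ => hA.tr k) (fun h1 h2 => hA.left_unique h h1 h2)
    (fun h1 h2 => hA.right_unique h h1 h2) x with ⟨m, hm, hm'⟩ | ⟨f, hf, hf'⟩
  swap
  · refine (hx (fun i => f (-i)) (fun i => ?_) hf).elim
    have := hf' (-(i + 1))
    rwa [show -(i + 1) + 1 = -i by ring] at this
  have hm2 : Relation.ReflTransGen (HasArc (ncad r)) m x := Relation.reflTransGen_swap.1 hm
  obtain ⟨l₁, h1, h2⟩ := List.exists_isChain_cons_of_relationReflTransGen hm2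
  obtain ⟨l₂, h3, h4⟩ := List.exists_isChain_cons_of_relationReflTransGen hT
  refine ⟨{y | y ∈ m :: l₁ ++ l₂}, ⟨m :: l₁ ++ l₂, by simp, ?_, ?_, ?_, rfl⟩, ?_⟩
  · rw [List.isChain_append]
    refine ⟨h1, ?_, ?_⟩
    · exact h3.tail
    · intro a ha b hb
      rw [List.getLast?_eq_getLast_of_ne_nil (by simp)] at ha
      have : a = x := by rw [← h2]; exact (Option.some.inj ha).symm
      subst this
      cases l₂ with
      | nil => simp at hb
      | cons y l₂ =>
        rw [List.isChain_cons_cons] at h3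
        simp only [List.head?_cons, Option.mem_some_iff] at hb
        rw [← hb]
        exact h3.1
  · simpa using hm'
  · cases l₂ with
    | nil =>
      simp only [List.append_nil, h2]
      simpa [← h4] using hT'
    | cons y l₂ =>
      rw [List.getLast_append_of_ne_nil _ (by simp)]
      rw [List.getLast_cons (by simp)] at h4
      rwa [h4]
  · have : x ∈ m :: l₁ := h2 ▸ List.getLast_mem _
    exact List.mem_append_left _ this

end

end AffineTITO

namespace AffineTITO

/-! ### Comparing chains -/

section

variable {n : ℕ} {c : Equiv.Perm ℤ} {r : ℤ → ℤ → Prop} (h : AvoidsPatterns n c r)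

namespace ChainData

variable {γ γ' : Set ℤ} {m T m' T' : ℤ} (hγ : ChainData r γ m T)

include hγ

theorem not_loop : ¬ IsArcLoop (ncad r) γ := by
  rintro ⟨f, hf, rfl⟩
  obtain ⟨i, hi⟩ := hγ.memT
  exact hγ.top _ (hi ▸ hf i)

theorem sInf_eq : sInf γ = m :=
  IsLeast.csInf_eq ⟨hγ.memm, fun z hz => (hγ.le z hz).1⟩

theorem sSup_eq : sSup γ = T :=
  IsGreatest.csSup_eq ⟨hγ.memT, fun z hz => (hγ.le z hz).2⟩

/-- A point over which a chain passes is covered by an arc of the chain. -/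
theorem exists_arc {z : ℤ} (h1 : m ≤ z) (h2 : z < T) :
    ∃ p ∈ γ, ∃ q ∈ γ, HasArc (ncad r) p q ∧ p ≤ z ∧ z < q := by
  obtain ⟨p, hp, hmax⟩ := exists_isGreatest_of_le (S := {x | x ∈ γ ∧ x ≤ z}) ⟨m, hγ.memm, h1⟩
    (b := z) fun x hx => hx.2
  rcases hγ.up p hp.1 with rfl | ⟨q, hq, ha⟩
  · have := hp.2
    omega
  · refine ⟨p, hp.1, q, hq, ha, hp.2, ?_⟩
    by_contra hlt
    have h3 := hmax ⟨hq, by omega⟩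
    have h4 := (hasArc_ncad.1 ha).1
    omega

include h

theorem mem_of_arc {p q : ℤ} (ha : HasArc (ncad r) p q) (hp : p ∈ γ) : q ∈ γ := by
  rcases hγ.up p hp with rfl | ⟨q', hq, ha'⟩
  · exact (hγ.top _ ha).elim
  · rwa [arc_right_unique h ha ha']

theorem mem_of_arc' {p q : ℤ} (ha : HasArc (ncad r) p q) (hq : q ∈ γ) : p ∈ γ := by
  rcases hγ.down q hq with rfl | ⟨q', hq, ha'⟩
  · exact (hγ.bot _ ha).elim
  · rwa [arc_left_unique h ha ha']

omit h in
theorem eq_T_of_top {x : ℤ} (hx : x ∈ γ) (ht : ∀ y, ¬ HasArc (ncad r) x y) : x = T :=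
  (hγ.up x hx).resolve_right fun ⟨y, _, hy⟩ => ht y hy

omit h in
theorem eq_m_of_bot {x : ℤ} (hx : x ∈ γ) (ht : ∀ y, ¬ HasArc (ncad r) y x) : x = m :=
  (hγ.down x hx).resolve_right fun ⟨y, _, hy⟩ => ht y hy

theorem not_mem_iff {z : ℤ} (hz : z ∉ γ) : r z T ∨ r m z := by
  by_contra! H
  have h1 : z ≠ T := fun e => hz (e ▸ hγ.memT)
  have h2 : z ≠ m := fun e => hz (e ▸ hγ.memm)
  exact hz ((hγ.mem_iff z).2 ⟨Or.inr ((h.not_iff h1).1 H.1), Or.inr ((h.not_iff h2.symm).1 H.2)⟩)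

/-- The chain is an interval of r, so an element outside of it is on one side of all of it. -/
theorem lt_all_of_lt {x z : ℤ} (hz : z ∉ γ) (hx : x ∈ γ) (hzx : r z x) {y : ℤ} (hy : y ∈ γ) :
    r z y := by
  have h1 : r z T := by
    rcases hγ.not_mem_iff h hz with h1 | h1
    · exact h1
    · rcases ((hγ.mem_iff x).1 hx).2 with rfl | h2
      · exact (h.asymm h1 hzx).elim
      · exact (h.asymm hzx (h.trans _ _ _ h2 h1)).elim
  rcases ((hγ.mem_iff y).1 hy).1 with rfl | h2
  · exact h1
  · exact h.trans _ _ _ h1 h2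

theorem all_lt_of_lt {x z : ℤ} (hz : z ∉ γ) (hx : x ∈ γ) (hxz : r x z) {y : ℤ} (hy : y ∈ γ) :
    r y z := by
  have h1 : z ≠ y := fun e => hz (e ▸ hy)
  by_contra h2
  exact h.asymm hxz (hγ.lt_all_of_lt h hz hy ((h.not_iff h1.symm).1 h2) hx)

/-- Some arc of the chain passes over z, and the color of z places it before the final point of that
arc, hence before the chain. -/
theorem lt_of_mem_L {z : ℤ} (hz : z ∉ γ) (h1 : m < z) (h2 : z < T) (hL : z ∈ Lbar c) {y : ℤ}
    (hy : y ∈ γ) : r z y := by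
  obtain ⟨p, hp, q, hq, ha, h3, h4⟩ := hγ.exists_arc h1.le h2
  have : p ≠ z := fun e => hz (e ▸ hp)
  exact hγ.lt_all_of_lt h hz hq (h.arc_L (hasArc_ncad.1 ha).2 (by omega) h4 hL) hy

theorem lt_of_mem_R {z : ℤ} (hz : z ∉ γ) (h1 : m < z) (h2 : z < T) (hR : z ∈ Rbar c) {y : ℤ}
    (hy : y ∈ γ) : r y z := by
  obtain ⟨p, hp, q, hq, ha, h3, h4⟩ := hγ.exists_arc h1.le h2
  have : p ≠ z := fun e => hz (e ▸ hp)
  exact hγ.all_lt_of_lt h hz hp (h.arc_R (hasArc_ncad.1 ha).2 (by omega) h4 hR) hy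

theorem eq_of_mem (hγ' : ChainData r γ' m' T') {x : ℤ} (hx : x ∈ γ) (hx' : x ∈ γ') :
    γ = γ' := by
  have hT : T = T' := by
    by_cases hT : T' ∈ γ
    · exact (hγ.eq_T_of_top hT hγ'.top).symm
    · have h1 : T ∉ γ' := fun hT' => hT ((hγ'.eq_T_of_top hT' hγ.top) ▸ hγ.memT)
      rcases ((hγ'.mem_iff x).1 hx').1 with rfl | h2
      · exact (hT hx).elim
      · have h3 := hγ.lt_all_of_lt h hT hx h2 hγ.memT
        exact (h1 ((hγ'.mem_iff T).2 ⟨Or.inr h3, by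
          rcases ((hγ.mem_iff x).1 hx).1 with rfl | h4
          · exact ((hγ'.mem_iff x).1 hx').2
          · rcases ((hγ'.mem_iff x).1 hx').2 with rfl | h5
            · exact Or.inr h4
            · exact Or.inr (h.trans _ _ _ h4 h5)⟩)).elim
  have hm : m = m' := by
    by_cases hm : m' ∈ γ
    · exact (hγ.eq_m_of_bot hm hγ'.bot).symm
    · have h1 : m ∉ γ' := fun hm' => hm ((hγ'.eq_m_of_bot hm' hγ.bot) ▸ hγ.memm)
      rcases ((hγ'.mem_iff x).1 hx').2 with rfl | h2
      · exact (hm hx).elim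
      · have h3 := hγ.all_lt_of_lt h hm hx h2 hγ.memm
        exact (h1 ((hγ'.mem_iff m).2 ⟨by
          rcases ((hγ.mem_iff x).1 hx).2 with rfl | h4
          · exact ((hγ'.mem_iff x).1 hx').1
          · rcases ((hγ'.mem_iff x).1 hx').1 with rfl | h5
            · exact Or.inr h4
            · exact Or.inr (h.trans _ _ _ h5 h4), Or.inr h3⟩)).elim
  subst hT hm
  ext z
  rw [hγ.mem_iff, hγ'.mem_iff]

theorem sep (hγ' : ChainData r γ' m' T') (hne : γ ≠ γ') {x y x' y' : ℤ} (hx : x ∈ γ)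
    (hy : y ∈ γ') (hxy : r x y) (hx' : x' ∈ γ) (hy' : y' ∈ γ') : r x' y' := by
  have h1 : ∀ z ∈ γ, z ∉ γ' := fun z hz hz' => hne (hγ.eq_of_mem h hγ' hz hz')
  exact hγ'.lt_all_of_lt h (h1 x' hx') hy
    (hγ.all_lt_of_lt h (fun H => h1 _ H hy) hx hxy hx') hy'

/-- Hiding means that one minimum is between the extreme values of the other chain, with the color
that places it on the required side. -/
theorem lt_of_hides (hγ' : ChainData r γ' m' T') (hne : γ ≠ γ') (hh : Hides c (ncad r) γ γ')
    {x y : ℤ} (hx : x ∈ γ) (hy : y ∈ γ') : r x y := by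
  have h1 : ∀ z ∈ γ, z ∉ γ' := fun z hz hz' => hne (hγ.eq_of_mem h hγ' hz hz')
  unfold Hides at hh
  rw [hγ.sInf_eq, hγ'.sInf_eq, hγ.sSup_eq, hγ'.sSup_eq] at hh
  rcases hh with ⟨hh, -⟩ | ⟨hh, -⟩ | ⟨-, -, ⟨h2, h3, h4⟩ | ⟨h2, h3, h4⟩⟩
  · exact (hγ.not_loop hh).elim
  · exact (hγ'.not_loop hh).elim
  · exact hγ.sep h hγ' hne hγ.memm hγ'.memm
      (hγ.lt_of_mem_R h (fun H => h1 _ H hγ'.memm) h2 h4 h3 hγ.memm) hx hy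
  · exact hγ.sep h hγ' hne hγ.memm hγ'.memm
      (hγ'.lt_of_mem_L h (h1 _ hγ.memm) h2 h4 h3 hγ'.memm) hx hy

theorem tr (k : ℤ) : ChainData r ((fun x => x + k * (n : ℤ)) '' γ) (m + k * n) (T + k * n) := by
  have hA := h.toIsPeriodicOrder.isSubdiagram_ncad
  have hm : ∀ x, x ∈ (fun x => x + k * (n : ℤ)) '' γ ↔ x - k * n ∈ γ := fun x => by
    constructor
    · rintro ⟨y, hy, rfl⟩
      simpa using hy
    · exact fun H => ⟨_, H, by ring⟩
  refine ⟨⟨T, hγ.memT, rfl⟩, ⟨m, hγ.memm, rfl⟩, fun z => ?_, fun z hz => ?_, fun x hx => ?_,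
    fun x hx => ?_, fun x hx => ?_, fun x hx => ?_, fun x hx y hy hlt => ?_, hγ.fin.image _⟩
  · rw [hm, hγ.mem_iff, ← h.tr k T, ← h.tr k _ m]
    simp [sub_eq_iff_eq_add]
  · have := hγ.le _ ((hm z).1 hz)
    constructor <;> linarith
  · refine hγ.bot (x - k * n) ((hA.tr k).1 ?_)
    simpa using hx
  · refine hγ.top (x - k * n) ((hA.tr k).1 ?_)
    simpa using hx
  · rcases hγ.up _ ((hm x).1 hx) with e | ⟨y, hy, ha⟩
    · exact Or.inl (by linarith)
    · refine Or.inr ⟨y + k * n, ⟨y, hy, rfl⟩, ?_⟩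
      simpa using (hA.tr k).2 ha
  · rcases hγ.down _ ((hm x).1 hx) with e | ⟨y, hy, ha⟩
    · exact Or.inl (by linarith)
    · refine Or.inr ⟨y + k * n, ⟨y, hy, rfl⟩, ?_⟩
      simpa using (hA.tr k).2 ha
  · have := hγ.anti _ ((hm x).1 hx) _ ((hm y).1 hy) (by omega)
    rw [← h.tr k] at this
    simpa using this

omit h in
theorem pairwise_descending : (descending γ).Pairwise r ∧ ∀ x, x ∈ descending γ ↔ x ∈ γ := by
  classical
  unfold descending
  rw [dif_pos hγ.fin]
  have hmem : ∀ x, x ∈ (hγ.fin.toFinset.sort (· ≥ ·)) ↔ x ∈ γ := fun x => by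
    rw [Finset.mem_sort, Set.Finite.mem_toFinset]
  refine ⟨?_, hmem⟩
  have h1 := (Finset.pairwise_sort hγ.fin.toFinset (· ≥ ·)).and (Finset.sort_nodup _ _)
  refine List.Pairwise.imp_of_mem (fun hx hy hxy => ?_) h1
  exact hγ.anti _ ((hmem _).1 hx) _ ((hmem _).1 hy) (lt_of_le_of_ne hxy.1 (Ne.symm hxy.2))

end ChainData

/-! ### The selection procedure -/

include h

/-- The first chain for r is unhidden since hiding implies preceding. Convexity of the union is what
makes its maximum smaller than that of every other unhidden chain. -/
theorem select_eq {N : Set (Set ℤ)} (hN : ∀ γ ∈ N, IsArcChain (ncad r) γ) (hfin : (⋃₀ N).Finite)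
    (hconv : ∀ x ∈ ⋃₀ N, ∀ z ∈ ⋃₀ N, ∀ y, r x y → r y z → y ∈ ⋃₀ N) {γ : Set ℤ} (hγ : γ ∈ N)
    (hfirst : ∀ γ' ∈ N, γ' ≠ γ → ∀ x ∈ γ, ∀ y ∈ γ', r x y) : select c (ncad r) N = γ := by
  obtain ⟨m, T, hc⟩ := exists_chainData h (hN γ hγ)
  have hun : γ ∈ unhidden c (ncad r) N := by
    refine ⟨hγ, fun γ' hγ' hne hh => ?_⟩
    obtain ⟨m', T', hc'⟩ := exists_chainData h (hN γ' hγ')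
    exact h.asymm (hc'.lt_of_hides h hc hne hh hc'.memT hc.memT)
      (hfirst γ' hγ' hne _ hc.memT _ hc'.memT)
  have hmaxOf : ∀ γ' ∈ N, ∀ {m' T'}, ChainData r γ' m' T' → maxOf (ncad r) γ' = (T' : ℤ) := by
    intro γ' _ m' T' hc'
    unfold maxOf
    rw [if_neg hc'.not_loop, hc'.sSup_eq]
  -- If T' < T although T ≺ T', some descent between T and T' goes below the level T'. By convexity
  -- its arc belongs to a chain γ'' of N. That chain passes over T' and precedes γ', and comparing
  -- the two minima and their colors shows that it hides γ'.
  have hmax : ∀ γ' ∈ unhidden c (ncad r) N, γ' ≠ γ → ∀ {m' T'}, ChainData r γ' m' T' → T < T' := by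
    intro γ' hγ' hne m' T' hc'
    have h1 := hfirst γ' hγ'.1 hne
    by_contra hle
    have hTT := h1 _ hc.memT _ hc'.memT
    have hlt : T' < T := by
      have := h.ne hTT
      omega
    obtain ⟨u, v, huv, hu, hv, hu', hv'⟩ := h.exists_cover_of_finite hTT
      (hfin.subset fun z hz => hconv _ ⟨γ, hγ, hc.memT⟩ _ ⟨γ', hγ'.1, hc'.memT⟩ z hz.1 hz.2)
      (fun z => T' < z) hlt (by simp)
    have ha : HasArc (ncad r) v u := hasArc_ncad.2 ⟨by omega, huv⟩
    have hvT : v ≠ T' := fun e => hc'.top _ (e ▸ ha)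
    have hvT' : r v T' := hv'.resolve_left hvT
    have hTv : r T v := by
      rcases hu' with rfl | hu'
      · exact huv.1
      · exact h.trans _ _ _ hu' huv.1
    obtain ⟨γ'', hγ'', hvγ⟩ := hconv _ ⟨γ, hγ, hc.memT⟩ _ ⟨γ', hγ'.1, hc'.memT⟩ v hTv hvT'
    obtain ⟨m'', T'', hc''⟩ := exists_chainData h (hN γ'' hγ'')
    have hne'' : γ'' ≠ γ' := fun e => by
      rcases ((hc'.mem_iff v).1 (e ▸ hvγ)).1 with h2 | h2
      · exact hvT h2
      · exact h.asymm hvT' h2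
    have hdis : ∀ z ∈ γ'', z ∉ γ' := fun z hz hz' => hne'' (hc''.eq_of_mem h hc' hz hz')
    have huγ := hc''.mem_of_arc h ha hvγ
    have hlt2 : ∀ x ∈ γ'', ∀ y ∈ γ', r x y := fun x hx y hy =>
      hc''.sep h hc' hne'' hvγ hc'.memT hvT' hx hy
    have hm'' := hc''.le v hvγ
    have hu'' := hc''.le u huγ
    have hm' := hc'.le m' hc'.memm
    refine hγ'.2 γ'' hγ'' hne'' (Or.inr (Or.inr ⟨hc''.not_loop, hc'.not_loop, ?_⟩))
    rw [hc''.sInf_eq, hc'.sInf_eq, hc''.sSup_eq, hc'.sSup_eq]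
    rcases lt_trichotomy m'' m' with e | e | e
    · refine Or.inl ⟨e, ?_, by omega⟩
      rw [← h.col.not_mem_L]
      intro hL
      exact h.asymm (hlt2 _ hc''.memm _ hc'.memm)
        (hc''.lt_of_mem_L h (fun H => hdis _ H hc'.memm) e (by omega) hL hc''.memm)
    · exact (hdis _ hc''.memm (e ▸ hc'.memm)).elim
    · refine Or.inr ⟨e, ?_, by omega⟩
      rw [← h.col.not_mem_R]
      intro hR
      exact h.asymm (hlt2 _ hc''.memm _ hc'.memm)
        (hc'.lt_of_mem_R h (hdis _ hc''.memm) e (by omega) hR hc'.memm)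
  have hspec : select c (ncad r) N ∈ unhidden c (ncad r) N ∧
      ∀ γ' ∈ unhidden c (ncad r) N, maxOf (ncad r) (select c (ncad r) N) ≤ maxOf (ncad r) γ' := by
    refine Classical.epsilon_spec (p := fun γ => γ ∈ unhidden c (ncad r) N ∧
      ∀ γ' ∈ unhidden c (ncad r) N, maxOf (ncad r) γ ≤ maxOf (ncad r) γ') ⟨γ, hun, ?_⟩
    intro γ' hγ'
    by_cases e : γ' = γ
    · rw [e]
    · obtain ⟨m', T', hc'⟩ := exists_chainData h (hN γ' hγ'.1)
      rw [hmaxOf γ hγ hc, hmaxOf γ' hγ'.1 hc']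
      exact_mod_cast (hmax γ' hγ' e hc').le
  by_contra hne
  obtain ⟨m', T', hc'⟩ := exists_chainData h (hN _ hspec.1.1)
  have h2 := hspec.2 γ hun
  rw [hmaxOf γ hγ hc, hmaxOf _ hspec.1.1 hc'] at h2
  have h3 := hmax _ hspec.1 hne hc'
  have h4 : T' ≤ T := by exact_mod_cast h2
  omega

/-- The selection procedure lists a convex union of chains in increasing order. -/
theorem windowOf_spec (a : ℤ) {N : Set (Set ℤ)} (hN : ∀ γ ∈ N, IsArcChain (ncad r) γ)
    (hfin : (⋃₀ N).Finite)
    (hconv : ∀ x ∈ ⋃₀ N, ∀ z ∈ ⋃₀ N, ∀ y, r x y → r y z → y ∈ ⋃₀ N) :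
    (windowOf n c (ncad r) a N).Pairwise r ∧
      ∀ x, x ∈ windowOf n c (ncad r) a N ↔ x ∈ ⋃₀ N := by
  have hNfin : N.Finite := Set.Finite.subset hfin.finite_subsets fun γ hγ =>
    Set.subset_sUnion_of_mem hγ
  induction hk : N.ncard generalizing N with
  | zero =>
    have : N = ∅ := (Set.ncard_eq_zero hNfin).1 hk
    subst this
    unfold windowOf
    simp [selectList]
  | succ k ih =>
    have hNne : N.Nonempty := by
      rw [Set.nonempty_iff_ne_empty]
      rintro rfl
      simp at hk
    obtain ⟨γ, hγ, hfirst⟩ : ∃ γ ∈ N, ∀ γ' ∈ N, γ' ≠ γ → ∀ x ∈ γ, ∀ y ∈ γ', r x y := by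
      obtain ⟨γ₁, hγ₁⟩ := hNne
      obtain ⟨m₁, T₁, hc₁⟩ := exists_chainData h (hN _ hγ₁)
      have : ∃ x ∈ ⋃₀ N, ∀ y ∈ ⋃₀ N, y ≠ x → r x y := by
        let S := hfin.toFinset
        have hS : S.Nonempty := ⟨T₁, by simpa [S] using ⟨γ₁, hγ₁, hc₁.memT⟩⟩
        have : ∀ S : Finset ℤ, S.Nonempty → ∃ x ∈ S, ∀ y ∈ S, y ≠ x → r x y := by
          intro S hS
          induction hS using Finset.Nonempty.cons_induction with
          | singleton a => exact ⟨a, by simp, by simp⟩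
          | cons a s ha hs ih =>
            obtain ⟨x, hx, hx'⟩ := ih
            rcases h.total a x (fun e => ha (e ▸ hx)) with h1 | h1
            · refine ⟨a, by simp, fun y hy hya => ?_⟩
              rcases Finset.mem_cons.1 hy with rfl | hy
              · exact (hya rfl).elim
              · by_cases e : y = x
                · rwa [e]
                · exact h.trans _ _ _ h1 (hx' y hy e)
            · refine ⟨x, by simp [hx], fun y hy hyx => ?_⟩
              rcases Finset.mem_cons.1 hy with rfl | hy
              · exact h1
              · exact hx' y hy hyx
        obtain ⟨x, hx, hx'⟩ := this S hS
        exact ⟨x, by simpa only [S, Set.Finite.mem_toFinset] using hx, fun y hy =>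
          hx' y (by simpa only [S, Set.Finite.mem_toFinset] using hy)⟩
      obtain ⟨x, ⟨γ, hγ, hx⟩, hx'⟩ := this
      refine ⟨γ, hγ, fun γ' hγ' hne => ?_⟩
      obtain ⟨m, T, hc⟩ := exists_chainData h (hN _ hγ)
      obtain ⟨m', T', hc'⟩ := exists_chainData h (hN _ hγ')
      intro y hy z hz
      exact hc.sep h hc' hne.symm hx hc'.memT (hx' _ ⟨γ', hγ', hc'.memT⟩ fun e =>
        hne (hc'.eq_of_mem h hc hc'.memT (e ▸ hx))) hy hz
    obtain ⟨m, T, hc⟩ := exists_chainData h (hN _ hγ)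
    have hsel := select_eq h hN hfin hconv hγ hfirst
    have hcard : (N \ {γ}).ncard = k := by
      rw [Set.ncard_sdiff_singleton_of_mem hγ, hk]
      rfl
    have hsub : ⋃₀ (N \ {γ}) ⊆ ⋃₀ N := Set.sUnion_subset_sUnion Set.sdiff_subset
    obtain ⟨ih1, ih2⟩ := ih (N := N \ {γ}) (fun γ' hγ' => hN γ' hγ'.1) (hfin.subset hsub) (by
      rintro x ⟨γ₁, ⟨h1, h1'⟩, hx⟩ z hz y hxy hyz
      obtain ⟨γ₂, h2, hy⟩ := hconv x ⟨γ₁, h1, hx⟩ z (hsub hz) y hxy hyz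
      refine ⟨γ₂, ⟨h2, ?_⟩, hy⟩
      rintro rfl
      exact h.asymm hxy (hfirst γ₁ h1 h1' y hy x hx)) (hNfin.subset Set.sdiff_subset) hcard
    have hwin : windowOf n c (ncad r) a N = descending γ ++ windowOf n c (ncad r) a (N \ {γ}) := by
      unfold windowOf
      rw [hk, hcard, selectList, hsel, List.flatMap_cons, supportWord, if_pos hc.fin]
    obtain ⟨hd1, hd2⟩ := hc.pairwise_descending
    rw [hwin]
    constructor
    · rw [List.pairwise_append]
      refine ⟨hd1, ih1, fun x hx y hy => ?_⟩
      obtain ⟨γ', hγ', hy'⟩ := (ih2 y).1 hy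
      exact hfirst γ' hγ'.1 hγ'.2 x ((hd2 x).1 hx) y hy'
    · intro x
      rw [List.mem_append, hd2, ih2]
      constructor
      · rintro (hx | hx)
        · exact ⟨γ, hγ, hx⟩
        · exact hsub hx
      · rintro ⟨γ', hγ', hx⟩
        by_cases e : γ' = γ
        · exact Or.inl (e ▸ hx)
        · exact Or.inr ⟨γ', ⟨hγ', e⟩, hx⟩

end

end AffineTITO

namespace AffineTITO

/-! ### Window notations -/

/-- The direction of the window `w` of a block of `r`. -/
def IsWindow (n : ℕ) (r : ℤ → ℤ → Prop) : Direction → List ℤ → Prop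
  | .waxing, w => w.Pairwise r ∧ ∀ u ∈ w, ∀ v ∈ w, r u (v + n)
  | .waning, w => w.Pairwise r ∧ ∀ u ∈ w, ∀ v ∈ w, r (u + n) v

section

variable {n : ℕ} {r : ℤ → ℤ → Prop} (h : IsPeriodicOrder n r)
include h

theorem lt_of_blockLT {d : Direction} {w : List ℤ} (hw : IsWindow n r d w) {x y : ℤ}
    (hxy : BlockLT n d w x y) : r x y := by
  obtain ⟨i, j, k, l, rfl, rfl, hkl⟩ := hxy
  have hp : w.Pairwise r := by
    cases d
    · exact hw.1
    · exact hw.1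
  rcases hkl with hkl | ⟨rfl, hij⟩
  · cases d with
    | waxing =>
      simp only at hkl
      have h1 := hw.2 _ (List.get_mem w i) _ (List.get_mem w j)
      have h2 := fun {k : ℤ} => h.wax_mul (hw.2 _ (List.get_mem w j) _ (List.get_mem w j)) (k := k)
      have h3 : r (w.get i) (w.get j + (l - k) * n) := by
        rcases eq_or_lt_of_le (show 1 ≤ l - k by omega) with e | e
        · rw [← e, one_mul]; exact h1
        · have := (h.tr 1 _ _).2 (h2 (k := l - k - 1) (by omega))
          rw [one_mul] at this
          refine h.trans _ _ _ h1 ?_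
          convert this using 1
          ring
      rw [← h.tr k] at h3
      convert h3 using 1
      ring
    | waning =>
      simp only at hkl
      have h1 := hw.2 _ (List.get_mem w i) _ (List.get_mem w j)
      have h2 := fun {k : ℤ} => h.wane_mul (hw.2 _ (List.get_mem w i) _ (List.get_mem w i)) (k := k)
      have h3 : r (w.get i + (k - l) * n) (w.get j) := by
        rcases eq_or_lt_of_le (show 1 ≤ k - l by omega) with e | e
        · rw [← e, one_mul]; exact h1
        · have := (h.tr 1 _ _).2 (h2 (k := k - l - 1) (by omega))
          rw [one_mul] at this
          refine h.trans _ _ _ ?_ h1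
          convert this using 1
          ring
      rw [← h.tr l] at h3
      convert h3 using 1
      ring
  · rw [h.tr]
    exact List.pairwise_iff_get.1 hp i j hij

omit h in
theorem blockLT_total {d : Direction} {w : List ℤ} {x y : ℤ} (hx : InBlock n w x)
    (hy : InBlock n w y) (hne : x ≠ y) : BlockLT n d w x y ∨ BlockLT n d w y x := by
  obtain ⟨u, hu, hxu⟩ := hx
  obtain ⟨v, hv, hyv⟩ := hy
  obtain ⟨i, rfl⟩ := List.get_of_mem hu
  obtain ⟨j, rfl⟩ := List.get_of_mem hv
  obtain ⟨k, rfl⟩ := exists_eq_add_mul hxu.symm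
  obtain ⟨l, rfl⟩ := exists_eq_add_mul hyv.symm
  rcases lt_trichotomy k l with e | rfl | e
  · cases d
    · exact Or.inl ⟨i, j, k, l, rfl, rfl, Or.inl e⟩
    · exact Or.inr ⟨j, i, l, k, rfl, rfl, Or.inl e⟩
  · rcases lt_trichotomy i j with e | rfl | e
    · exact Or.inl ⟨i, j, k, k, rfl, rfl, Or.inr ⟨rfl, e⟩⟩
    · exact (hne rfl).elim
    · exact Or.inr ⟨j, i, k, k, rfl, rfl, Or.inr ⟨rfl, e⟩⟩
  · cases d
    · exact Or.inr ⟨j, i, l, k, rfl, rfl, Or.inl e⟩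
    · exact Or.inl ⟨i, j, k, l, rfl, rfl, Or.inl e⟩

/-- Only the inclusion in r has to be checked: the relation given by the windows is total when the
blocks cover ℤ. -/
theorem windowNotation_eq {bs : List (Direction × List ℤ)}
    (hw : ∀ b ∈ bs, IsWindow n r b.1 b.2)
    (hlt : ∀ i j : Fin bs.length, i < j → ∀ x y, InBlock n (bs.get i).2 x →
      InBlock n (bs.get j).2 y → r x y)
    (hcov : ∀ x, ∃ b ∈ bs, InBlock n b.2 x) : windowNotation n bs = r := by
  have h1 : ∀ x y, windowNotation n bs x y → r x y := by
    rintro x y (⟨i, j, hij, hx, hy⟩ | ⟨b, hb, hxy⟩)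
    · exact hlt i j hij x y hx hy
    · exact lt_of_blockLT h (hw b hb) hxy
  funext x y
  refine propext ⟨h1 x y, fun hxy => ?_⟩
  obtain ⟨b, hb, hx⟩ := hcov x
  obtain ⟨b', hb', hy⟩ := hcov y
  obtain ⟨i, rfl⟩ := List.get_of_mem hb
  obtain ⟨j, rfl⟩ := List.get_of_mem hb'
  rcases lt_trichotomy i j with e | rfl | e
  · exact Or.inl ⟨i, j, e, hx, hy⟩
  · rcases blockLT_total hx hy (h.ne hxy) with H | H
    · exact Or.inr ⟨_, hb, H⟩
    · exact (h.asymm hxy (h1 _ _ (Or.inr ⟨_, hb, H⟩))).elim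
  · exact (h.asymm hxy (hlt j i e y x hy hx)).elim

theorem windowNotation_singleton {w : List ℤ} (hw : IsWindow n r .waxing w)
    (hcov : ∀ x, InBlock n w x) : windowNotation n [(.waxing, w)] = r := by
  refine windowNotation_eq h ?_ ?_ fun x => ⟨_, List.mem_singleton_self _, hcov x⟩
  · intro b hb
    obtain rfl := List.mem_singleton.1 hb
    exact hw
  · intro i j hij
    have h1 := i.2
    have h2 := j.2
    simp only [List.length_singleton] at h1 h2
    omega

theorem windowNotation_triple {w₁ w₂ w₃ : List ℤ} (hw₁ : IsWindow n r .waxing w₁)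
    (hw₂ : IsWindow n r .waning w₂) (hw₃ : IsWindow n r .waxing w₃)
    (h12 : ∀ x y, InBlock n w₁ x → InBlock n w₂ y → r x y)
    (h13 : ∀ x y, InBlock n w₁ x → InBlock n w₃ y → r x y)
    (h23 : ∀ x y, InBlock n w₂ x → InBlock n w₃ y → r x y)
    (hcov : ∀ x, InBlock n w₁ x ∨ InBlock n w₂ x ∨ InBlock n w₃ x) :
    windowNotation n [(.waxing, w₁), (.waning, w₂), (.waxing, w₃)] = r := by
  refine windowNotation_eq h ?_ ?_ fun x => ?_
  · simpa using ⟨hw₁, hw₂, hw₃⟩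
  · intro i j hij
    have h1 := i.2
    have h2 := j.2
    simp only [List.length_cons, List.length_nil] at h1 h2
    obtain ⟨i, hi⟩ := i
    obtain ⟨j, hj⟩ := j
    rw [Fin.mk_lt_mk] at hij
    have : (i = 0 ∧ j = 1) ∨ (i = 0 ∧ j = 2) ∨ (i = 1 ∧ j = 2) := by
      simp only at h1 h2
      omega
    rcases this with ⟨rfl, rfl⟩ | ⟨rfl, rfl⟩ | ⟨rfl, rfl⟩
    · exact h12
    · exact h13
    · exact h23
  · simpa using hcov x

end

/-! ### Waxing blocks on which the sequence is finite -/

section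

variable {n : ℕ} {c : Equiv.Perm ℤ} {r : ℤ → ℤ → Prop} (h : AvoidsPatterns n c r)
include h

theorem exists_isArcChain_of_wax {x : ℤ} (hx : r x (x + n)) :
    ∃ γ, IsArcChain (ncad r) γ ∧ x ∈ γ := by
  refine exists_isArcChain h x fun f hf e => ?_
  have := (h.loop_wane hf 0).1
  rw [e] at this
  exact h.asymm hx this

/-- `B` is a union of waxing blocks, at finite distance of each other. -/
structure IsWaxing (n : ℕ) (r : ℤ → ℤ → Prop) (B : Set ℤ) : Prop where
  wax : ∀ x ∈ B, r x (x + n)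
  fd : ∀ x ∈ B, ∀ y, y ∈ B ↔ FiniteDistance r x y

end

section

variable {n : ℕ} {c : Equiv.Perm ℤ} {r : ℤ → ℤ → Prop} (h : AvoidsPatterns n c r) {B : Set ℤ}
  (hB : IsWaxing n r B)
include h hB

theorem IsWaxing.tr (x k : ℤ) : x + k * n ∈ B ↔ x ∈ B := by
  have key : ∀ x k : ℤ, x ∈ B → x + k * n ∈ B := fun x k hx =>
    (hB.fd x hx _).2 (h.finiteDistance_tr h.pos x k)
  refine ⟨fun H => ?_, key x k⟩
  have := key _ (-k) H
  simpa using this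

theorem IsWaxing.arc {p q : ℤ} (ha : HasArc (ncad r) p q) : p ∈ B ↔ q ∈ B := by
  have hc := (hasArc_ncad.1 ha).2
  have hf : FiniteDistance r q p := by
    have e1 : {z | r q z ∧ r z p} = ∅ := Set.eq_empty_of_forall_notMem fun z hz => hc.2 z hz
    have e2 : {z | r p z ∧ r z q} = ∅ := Set.eq_empty_of_forall_notMem fun z hz =>
      h.asymm hc.1 (h.trans _ _ _ hz.1 hz.2)
    exact ⟨by rw [e1]; exact Set.finite_empty, by rw [e2]; exact Set.finite_empty⟩
  constructor
  · intro hp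
    exact (hB.fd p hp q).2 ⟨hf.2, hf.1⟩
  · intro hq
    exact (hB.fd q hq p).2 hf

theorem IsWaxing.chain_subset {γ : Set ℤ} {m T x : ℤ} (hγ : ChainData r γ m T) (hx : x ∈ γ)
    (hxB : x ∈ B) : γ ⊆ B := by
  have hfd : ∀ y ∈ γ, ∀ z ∈ γ, {w | r y w ∧ r w z}.Finite := fun y hy z hz => by
    refine hγ.fin.subset fun w hw => (hγ.mem_iff w).2 ⟨?_, ?_⟩
    · rcases ((hγ.mem_iff y).1 hy).1 with rfl | h1
      · exact Or.inr hw.1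
      · exact Or.inr (h.trans _ _ _ h1 hw.1)
    · rcases ((hγ.mem_iff z).1 hz).2 with rfl | h1
      · exact Or.inr hw.2
      · exact Or.inr (h.trans _ _ _ hw.2 h1)
  exact fun y hy => (hB.fd x hxB y).2 ⟨hfd x hx y hy, hfd y hy x hx⟩

/-- A window of a waxing block: the fundamental domain `D \ (D - n)` of an initial segment `D` that
is a union of chains. -/
theorem IsWaxing.isWindow (a : ℤ) {N : Set (Set ℤ)} (hN : ∀ γ ∈ N, IsArcChain (ncad r) γ)
    {D : Set ℤ} (hDB : D ⊆ B) (hD : ∀ x ∈ D, ∀ y ∈ B, r y x → y ∈ D)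
    (hne : ∀ x ∈ B, (∃ k : ℤ, x + k * n ∈ D) ∧ ∃ k : ℤ, x + k * n ∉ D)
    (hU : ∀ x, x ∈ ⋃₀ N ↔ x ∈ D ∧ x + n ∉ D) :
    IsWindow n r .waxing (windowOf n c (ncad r) a N) ∧
      ∀ x, InBlock n (windowOf n c (ncad r) a N) x ↔ x ∈ B := by
  -- In a waxing block, an initial segment is stable under subtraction of multiples of n.
  have hmul : ∀ x ∈ D, ∀ k : ℤ, 0 ≤ k → x - k * n ∈ D := fun x hx k hk => by
    rcases hk.eq_or_lt with rfl | hk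
    · simpa using hx
    · have hxB : x - k * n ∈ B := (hB.tr h _ k).1 (by simpa using hDB hx)
      refine hD x hx _ hxB ?_
      have := h.wax_mul (hB.wax _ hxB) hk
      simpa using this
  have hdist : ∀ x y, x ∈ ⋃₀ N → y ∈ ⋃₀ N → x ≡ y [ZMOD n] → ¬ x < y := fun x y hx hy e hlt => by
    obtain ⟨k, hk, rfl⟩ := exists_eq_add_mul_pos e hlt
    refine ((hU x).1 hx).2 ?_
    convert hmul _ ((hU _).1 hy).1 (k - 1) (by omega) using 1
    ring
  have hfin : (⋃₀ N).Finite := by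
    refine Set.Finite.of_finite_image (f := fun z => z % (n : ℤ)) ?_ ?_
    · refine (Set.finite_Ico (0 : ℤ) n).subset ?_
      rintro _ ⟨z, -, rfl⟩
      have := h.pos
      exact ⟨Int.emod_nonneg _ (by omega), Int.emod_lt_of_pos _ (by omega)⟩
    · intro x hx y hy e
      rcases lt_trichotomy x y with h1 | h1 | h1
      · exact (hdist x y hx hy e h1).elim
      · exact h1
      · exact (hdist y x hy hx e.symm h1).elim
  obtain ⟨hw, hmem⟩ := windowOf_spec h a hN hfin (by
    intro x hx z hz y hxy hyz
    have hx' := (hU x).1 hx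
    have hz' := (hU z).1 hz
    have hyB : y ∈ B := by
      have hf := (hB.fd x (hDB hx'.1) z).1 (hDB hz'.1)
      refine (hB.fd x (hDB hx'.1) y).2 ⟨hf.1.subset fun w hw => ⟨hw.1, h.trans _ _ _ hw.2 hyz⟩, ?_⟩
      convert Set.finite_empty using 1
      exact Set.eq_empty_of_forall_notMem fun w hw => h.asymm hxy (h.trans _ _ _ hw.1 hw.2)
    refine (hU y).2 ⟨hD z hz'.1 y hyB hyz, fun H => hx'.2 (hD _ H _ ?_ ?_)⟩
    · simpa using (hB.tr h x 1).2 (hDB hx'.1)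
    · simpa using (h.tr 1 x y).2 hxy)
  refine ⟨⟨hw, fun u hu v hv => ?_⟩, fun x => ⟨?_, fun hx => ?_⟩⟩
  · have hu' := (hU u).1 ((hmem u).1 hu)
    have hv' := (hU v).1 ((hmem v).1 hv)
    by_contra hcon
    have hne : u ≠ v + n := fun e => hv'.2 (e ▸ hu'.1)
    exact hv'.2 (hD u hu'.1 _ (by simpa using (hB.tr h v 1).2 (hDB hv'.1)) ((h.not_iff hne).1 hcon))
  · rintro ⟨y, hy, e⟩
    obtain ⟨k, rfl⟩ := exists_eq_add_mul e.symm
    exact (hB.tr h y k).2 (hDB ((hU y).1 ((hmem y).1 hy)).1)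
  · obtain ⟨⟨k, hk⟩, l, hl⟩ := hne x hx
    -- The representative of x in the window is its last translate that belongs to D.
    obtain ⟨K, hK, hK'⟩ := exists_isGreatest_of_le (S := {k : ℤ | x + k * n ∈ D}) ⟨k, hk⟩ (b := l)
      (fun j hj => by
        by_contra hlt
        refine hl ?_
        convert hmul _ hj (j - l) (by omega) using 1
        ring)
    refine ⟨x + K * n, (hmem _).2 ((hU _).2 ⟨hK, fun H => ?_⟩), by simp [Int.ModEq]⟩
    have : K + 1 ≤ K := hK' (show x + (K + 1) * n ∈ D by convert H using 1; ring)
    omega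

/-- The window of a waxing block when no arc passes over `b`. -/
theorem IsWaxing.isWindow_of_le (a b : ℤ)
    (hb : ∀ p q, HasArc (ncad r) p q → p ∈ B → p ≤ b → b < q → False) {N : Set (Set ℤ)}
    (hN : ∀ γ, γ ∈ N ↔ IsArcChain (ncad r) γ ∧ γ ⊆ B ∧ γ ⊆ Set.Ioc (b - n) b) :
    IsWindow n r .waxing (windowOf n c (ncad r) a N) ∧
      ∀ x, InBlock n (windowOf n c (ncad r) a N) x ↔ x ∈ B := by
  have hA := h.toIsPeriodicOrder.isSubdiagram_ncad
  refine hB.isWindow h a (fun γ hγ => ((hN γ).1 hγ).1) (D := {x | x ∈ B ∧ x ≤ b}) (fun x hx => hx.1)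
    ?_ ?_ ?_
  · rintro x ⟨hxB, hx⟩ y hyB hyx
    refine ⟨hyB, ?_⟩
    by_contra hlt
    -- Going from a value above b to a value at most b takes a descent, which is an arc of B
    -- crossing b.
    obtain ⟨u, v, huv, hu, hv, hu', hv'⟩ := h.exists_cover_of_finite hyx
      ((hB.fd y hyB x).1 hxB).1 (fun z => b < z) (by omega) (by omega)
    have ha : HasArc (ncad r) v u := hasArc_ncad.2 ⟨by omega, huv⟩
    refine hb v u ha ?_ (by omega) hu
    rcases hv' with rfl | hv'
    · exact hxB
    · have hf := (hB.fd y hyB x).1 hxB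
      have hyv : r y v := by
        rcases hu' with rfl | hu'
        · exact huv.1
        · exact h.trans _ _ _ hu' huv.1
      refine (hB.fd y hyB v).2 ⟨hf.1.subset fun w hw => ⟨hw.1, h.trans _ _ _ hw.2 hv'⟩, ?_⟩
      convert Set.finite_empty using 1
      exact Set.eq_empty_of_forall_notMem fun w hw => h.asymm hyv (h.trans _ _ _ hw.1 hw.2)
  · intro x hx
    obtain ⟨k, -, hk⟩ := exists_int_mul_lt h.pos x b
    obtain ⟨l, -, hl⟩ := exists_int_mul_gt h.pos x b
    refine ⟨⟨-k, (hB.tr h x _).2 hx, by linarith⟩, l, fun H => ?_⟩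
    have := H.2
    omega
  · intro x
    constructor
    · rintro ⟨γ, hγ, hx⟩
      obtain ⟨-, h1, h2⟩ := (hN γ).1 hγ
      have := h2 hx
      exact ⟨⟨h1 hx, this.2⟩, fun H => by linarith [this.1, H.2]⟩
    · rintro ⟨⟨hxB, hx⟩, hx'⟩
      have hx2 : b < x + n := by
        by_contra hle
        exact hx' ⟨by simpa using (hB.tr h x 1).2 hxB, by omega⟩
      obtain ⟨γ, hγ, hxγ⟩ := exists_isArcChain_of_wax h (hB.wax x hxB)
      obtain ⟨m, T, hc⟩ := exists_chainData h hγ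
      have hsub := hB.chain_subset h hc hxγ hxB
      have h1 := hc.le x hxγ
      refine ⟨γ, (hN γ).2 ⟨hγ, hsub, fun z hz => ?_⟩, hxγ⟩
      have h2 := hc.le z hz
      have hT : T ≤ b := by
        by_contra hlt
        obtain ⟨p, hp, q, hq, ha, h3, h4⟩ := hc.exists_arc (z := b) (by omega) (by omega)
        exact hb p q ha (hsub hp) h3 h4
      -- An arc of the chain that crosses b - n would have a translate crossing b.
      have hm : b - n < m := by
        by_contra hlt
        obtain ⟨p, hp, q, hq, ha, h3, h4⟩ := hc.exists_arc (z := b - n) (by omega) (by omega)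
        refine hb (p + 1 * n) (q + 1 * n) ((hA.tr 1).2 ha) ((hB.tr h p 1).2 (hsub hp)) ?_ ?_ <;>
          linarith
      exact ⟨by omega, by omega⟩

end

end AffineTITO

namespace AffineTITO

/-! ### Biinfinite sequences of steps -/

theorem exists_int_switch {P : ℤ → Prop} {i j : ℤ} (hij : i ≤ j) (hi : P i) (hj : ¬ P j) :
    ∃ t, i ≤ t ∧ t < j ∧ P t ∧ ¬ P (t + 1) := by
  obtain ⟨t, ⟨h1, h2, h3⟩, h4⟩ := exists_isGreatest_of_le (S := {t | i ≤ t ∧ t ≤ j ∧ P t})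
    ⟨i, le_rfl, hij, hi⟩ (b := j) fun x hx => hx.2.1
  have h5 : t ≠ j := fun e => hj (e ▸ h3)
  refine ⟨t, h1, by omega, h3, fun h6 => ?_⟩
  have : t + 1 ≤ t := h4 ⟨by omega, by omega, h6⟩
  omega

section

variable {n : ℕ} {c : Equiv.Perm ℤ} {r : ℤ → ℤ → Prop} {A : Set Arc}

namespace Step

variable (h : AvoidsPatterns n c r) (hA : IsSubdiagram n r A) {b p b' : ℤ} (hs : Step c r A b p b')
include h hA hs

omit h in
theorem lt_of_arc (hp : p = b) : r b' b := hp ▸ (hA.arc hs.arc).2.1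

theorem lt_of_mem_R (hb : b ∈ Rbar c) : r b' b := by
  rcases hs.le.eq_or_lt with e | e
  · exact hs.lt_of_arc hA e
  · exact h.trans _ _ _ (hA.arc hs.arc).2.1 (h.arc_R (hA.arc hs.arc).2 e hs.lt hb)

theorem of_lt (hlt : r b b') : b ∈ Lbar c ∧ p < b ∧ ∀ q, ¬ HasArc A b q := by
  have h1 : p ≠ b := fun e => h.asymm hlt (hs.lt_of_arc hA e)
  refine ⟨?_, lt_of_le_of_ne hs.le h1, hs.out.resolve_left h1⟩
  rw [← h.col.not_mem_R]
  exact fun hR => h.asymm hlt (hs.lt_of_mem_R h hA hR)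

theorem of_gt (hlt : r b' b) : p = b ∨ b ∈ Rbar c ∧ p < b ∧ ∀ q, ¬ HasArc A b q := by
  rcases hs.le.eq_or_lt with e | e
  · exact Or.inl e
  · refine Or.inr ⟨?_, e, hs.out.resolve_left e.ne⟩
    rw [← h.col.not_mem_L]
    exact fun hL => h.asymm hlt (h.arc_L (hA.arc hs.arc).2 e hs.lt hL)

/-- Passing over a point. -/
theorem pass {z : ℤ} (h1 : b < z) (h2 : z < b') :
    (z ∈ Lbar c → r z b') ∧ (z ∈ Rbar c → r b' z) := by
  have hc := (hA.arc hs.arc).2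
  have hp := hs.le
  exact ⟨fun hz => h.arc_L hc (by omega) h2 hz,
    fun hz => h.trans _ _ _ hc.1 (h.arc_R hc (by omega) h2 hz)⟩

end Step

/-- Moving to the left over a larger number would give a closer covering arc. -/
theorem Step.not_lt_of_gt (h : AvoidsPatterns n c r) {b p b' d : ℤ} (hs : Step c r (ncad r) b p b')
    (hd : b < d) (hf : {z | r d z ∧ r z b}.Finite) (h1 : r b' d) (h2 : r d b) : False := by
  have hA := h.toIsPeriodicOrder.isSubdiagram_ncad
  rcases hs.of_gt h hA (h.trans _ _ _ h1 h2) with e | ⟨hR, hp, ho⟩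
  · have hc := (hA.arc hs.arc).2
    rw [e] at hc
    exact hc.2 _ ⟨h1, h2⟩
  · obtain ⟨u, v, huv, hu, hv, hu', hv'⟩ := h.exists_cover_of_finite h2 hf (fun z => b < z) hd
      (lt_irrefl _)
    have ha : HasArc (ncad r) v u := hasArc_ncad.2 ⟨by omega, huv⟩
    have hvb : v ≠ b := fun e => ho _ (e ▸ ha)
    have hu2 : r b' u := by
      rcases hu' with rfl | hu'
      · exact h1
      · exact h.trans _ _ _ h1 hu'
    rcases hs.closeR hp hR v u ha (by omega) hu with e | e
    · exact h.ne hu2 e.symm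
    · exact h.asymm hu2 e

/-- A biinfinite sequence of steps that is unbounded on both sides. -/
structure StepSeq (c : Equiv.Perm ℤ) (r : ℤ → ℤ → Prop) (A : Set Arc) (F : ℤ → ℤ) : Prop where
  step : ∀ i, ∃ p, Step c r A (F i) p (F (i + 1))
  exists_lt : ∀ z, ∃ i, F i < z
  exists_gt : ∀ z, ∃ i, z < F i

namespace StepSeq

variable {F G : ℤ → ℤ} (hF : StepSeq c r A F)
include hF

theorem strictMono : StrictMono F :=
  strictMono_int_of_lt_succ fun i => (hF.step i).choose_spec.lt

theorem exists_pass {z : ℤ} (hz : z ∉ Set.range F) : ∃ i, F i < z ∧ z < F (i + 1) := by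
  obtain ⟨i, hi⟩ := hF.exists_lt z
  obtain ⟨j, hj⟩ := hF.exists_gt z
  have hij : i ≤ j := (hF.strictMono.lt_iff_lt.1 (hi.trans hj)).le
  obtain ⟨t, -, -, h1, h2⟩ := exists_int_switch (P := fun t => F t < z) hij hi (by omega)
  refine ⟨t, h1, ?_⟩
  have : F (t + 1) ≠ z := fun e => hz ⟨_, e⟩
  omega

variable (h : AvoidsPatterns n c r) (hA : IsSubdiagram n r A)
include h hA

theorem pass {z : ℤ} (hz : z ∉ Set.range F) : ∃ i, F i < z ∧ z < F (i + 1) ∧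
    (z ∈ Lbar c → r z (F (i + 1))) ∧ (z ∈ Rbar c → r (F (i + 1)) z) := by
  obtain ⟨i, h1, h2⟩ := hF.exists_pass hz
  obtain ⟨p, hp⟩ := hF.step i
  obtain ⟨h3, h4⟩ := hp.pass h hA h1 h2
  exact ⟨i, h1, h2, h3, h4⟩

variable (hG : StepSeq c r A G) (hdis : ∀ i j, F i ≠ G j)
include hG hdis

/-- Where G passes over F i it lands, by closeness, after F (i + 1), at a point of color R over the
arc p → F (i + 1) used by F. When G later passes over F (i + 1) it lands before F (i + 1). So in the
meantime it jumps over the descent F (i + 1) ⋖ p, from a point covered by this arc, which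
contradicts the choice of the neighbor arc. -/
theorem not_L_R {i : ℤ} (hL : F i ∈ Lbar c) (hR : F (i + 1) ∈ Rbar c) : False := by
  obtain ⟨p, hs⟩ := hF.step i
  obtain ⟨j, h1, h2, h3, -⟩ := hG.pass h hA (z := F i) fun ⟨j, hj⟩ => hdis i j hj.symm
  obtain ⟨p', hs'⟩ := hG.step j
  have hc := (hA.arc hs.arc).2
  have hc' := (hA.arc hs'.arc).2
  have hle := hs.le
  have hle' := hs'.le
  specialize h3 hL
  -- The arc used by G covers F i, so it cannot be closer to F i than the arc chosen by F.
  have key : ¬ r (G (j + 1)) (F (i + 1)) := fun H => by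
    rcases hle.eq_or_lt with e | e
    · exact h.asymm (h.trans _ _ _ h3 H) (e ▸ hc.1)
    · rcases hs.closeL e hL _ _ hs'.arc (by omega) h2 with e' | e'
      · exact hdis _ _ e'.symm
      · exact h.asymm H e'
  have hlt : G (j + 1) < F (i + 1) := by
    by_contra hge
    have h4 : F (i + 1) < G (j + 1) := by
      have := hdis (i + 1) (j + 1)
      omega
    have := hs.lt
    exact key (h.trans _ _ _ hc'.1 (h.arc_R hc' (by omega) h4 hR))
  have hGR : G (j + 1) ∈ Rbar c := by
    rw [← h.col.not_mem_L]
    exact fun H => key (h.arc_L hc (by omega) hlt H)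
  have hpG := h.arc_R hc (by omega) hlt hGR
  obtain ⟨j', h4, h5, -, h6⟩ := hG.pass h hA (z := F (i + 1)) fun ⟨j, hj⟩ => hdis _ j hj.symm
  specialize h6 hR
  have hjj : j + 1 ≤ j' + 1 := by
    refine hG.strictMono.le_iff_le.1 ?_
    omega
  -- The last point of G after p, before the jump over the descent F (i + 1) ⋖ p.
  obtain ⟨t, ht1, ht2, ht3, ht4⟩ := exists_int_switch (P := fun t => r p (G t)) hjj hpG
    (fun H => h.asymm h6 (h.trans _ _ _ hc.1 H))
  have h7 : G (j + 1) ≤ G t := hG.strictMono.monotone ht1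
  have h8 : G t ≤ G j' := hG.strictMono.monotone (by omega)
  obtain ⟨p'', hs''⟩ := hG.step t
  have hlt'' := hs''.lt
  have h9 : r (G (t + 1)) p := (h.not_iff (by omega)).1 ht4
  have h10 : r (G (t + 1)) (F (i + 1)) :=
    (h.le_cover hc h9).resolve_left fun e => hdis _ _ e.symm
  rcases hs''.of_gt h hA (h.trans _ _ _ h9 ht3) with e | ⟨e1, e2, e3⟩
  · have := (hA.arc hs''.arc).2.2 p
    rw [e] at this
    exact this ⟨h9, ht3⟩
  · rcases hs''.closeR e2 e1 p (F (i + 1)) hs.arc (by omega) (by omega) with e | e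
    · exact hdis _ _ e
    · exact h.asymm e h10

/-- The arc used by G covers F i. If it ended below F (i + 1), its end, of color L, would lie over
the arc chosen by F and precede F (i + 1), contradicting closeness or the covering relation. -/
theorem nested {i : ℤ} (hL : F i ∈ Lbar c) (hGL : ∀ j, G j ∈ Lbar c) :
    ∃ j, G j < F i ∧ F (i + 1) < G (j + 1) := by
  obtain ⟨p, hs⟩ := hF.step i
  obtain ⟨j, h1, h2, h3, -⟩ := hG.pass h hA (z := F i) fun ⟨j, hj⟩ => hdis i j hj.symm
  obtain ⟨p', hs'⟩ := hG.step j
  have hc := (hA.arc hs.arc).2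
  have hle := hs.le
  have hle' := hs'.le
  specialize h3 hL
  refine ⟨j, h1, ?_⟩
  by_contra hge
  have hlt : G (j + 1) < F (i + 1) := by
    have := hdis (i + 1) (j + 1)
    omega
  have H := h.arc_L hc (by omega) hlt (hGL _)
  rcases hle.eq_or_lt with e | e
  · exact h.asymm (h.trans _ _ _ h3 H) (e ▸ hc.1)
  · rcases hs.closeL e hL _ _ hs'.arc (by omega) h2 with e' | e'
    · exact hdis _ _ e'.symm
    · exact h.asymm H e'

end StepSeq

namespace IsOrbit

variable (h : AvoidsPatterns n c r) (hA : IsSubdiagram n r A) {F : ℤ → ℤ} {σ : ℤ → Letter}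
  {k d : ℤ} (hF : IsOrbit n c A F σ k d)
include h hA hF

theorem exists_step (i : ℤ) : ∃ p, Step c r A (F i) p (F (i + 1)) ∧
    (σ i = .right ↔ HasArc A (F i) (F (i + 1))) ∧
    (σ i = .down ↔ F i ∈ Lbar c ∧ ∀ q, ¬ HasArc A (F i) q) ∧
    (σ i = .up ↔ F i ∈ Rbar c ∧ ∀ q, ¬ HasArc A (F i) q) :=
  hA.step_of_next h (hF.next i)

theorem lt_succ (i : ℤ) : F i < F (i + 1) := by
  obtain ⟨p, hp, -⟩ := hF.exists_step h hA i
  exact hp.lt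

omit h hA in
theorem add_mul (i e : ℤ) : F (i + e * k) = F i + e * d * n := by
  induction e using Int.induction_on with
  | zero => simp
  | succ e ih =>
    rw [show i + ((e : ℤ) + 1) * k = i + e * k + k by ring, hF.add, ih]; ring
  | pred e ih =>
    have := hF.add (i + (-(e : ℤ) - 1) * k)
    rw [show i + (-(e : ℤ) - 1) * k + k = i + -(e : ℤ) * k by ring, ih] at this
    linarith

theorem d_pos : 0 < d := by
  have h1 : StrictMono F := strictMono_int_of_lt_succ (hF.lt_succ h hA)
  have h2 := h1 (show (0 : ℤ) < 0 + k by have := hF.pos; omega)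
  rw [hF.add] at h2
  have h3 : 0 < d * n := by omega
  have h4 := h.pos
  by_contra h5
  have : d * n ≤ 0 := mul_nonpos_of_nonpos_of_nonneg (by omega) (by omega)
  omega

theorem stepSeq : StepSeq c r A F := by
  have hd := hF.d_pos h hA
  have hn := h.pos
  refine ⟨fun i => ?_, fun z => ?_, fun z => ?_⟩
  · obtain ⟨p, hp, -⟩ := hF.exists_step h hA i
    exact ⟨p, hp⟩
  · obtain ⟨l, hl, hl'⟩ := exists_int_mul_lt hn (F 0) z
    refine ⟨0 + (-l) * k, ?_⟩
    rw [hF.add_mul]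
    have : l * n ≤ l * d * n := by
      have : l * 1 ≤ l * d := mul_le_mul_of_nonneg_left (by omega) (by omega)
      rw [mul_one] at this
      exact mul_le_mul_of_nonneg_right this (by omega)
    linarith
  · obtain ⟨l, hl, hl'⟩ := exists_int_mul_gt hn (F 0) z
    refine ⟨0 + l * k, ?_⟩
    rw [hF.add_mul]
    have : l * n ≤ l * d * n := by
      have : l * 1 ≤ l * d := mul_le_mul_of_nonneg_left (by omega) (by omega)
      rw [mul_one] at this
      exact mul_le_mul_of_nonneg_right this (by omega)
    linarith

theorem stepSeq_add : StepSeq c r A fun i => F i + n := by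
  have hF1 : IsOrbit n c A (fun i => F i + n) σ k d := by
    refine ⟨hF.pos, fun i => ?_, fun i => ?_, hF.s_add, fun i j e => hF.dvd i j ?_⟩
    · have := hA.next_tr h 1 (hF.next i)
      rwa [one_mul] at this
    · simp only [hF.add]; ring
    · simpa using e
  exact hF1.stepSeq h hA

omit h hA in
-- Any index is reached from i₀ after adding enough periods, and periods are translations.
theorem mem_of_lt_periodic {X : Set ℤ} (hX : ∀ x (l : ℤ), x + l * n ∈ X ↔ x ∈ X) {i₀ : ℤ} (h0 : F i₀ ∈ X)
    (hs : ∀ i, F i ∈ X → F (i + 1) ∈ X) (i : ℤ) : F i ∈ X := by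
  have h1 : ∀ m : ℕ, F (i₀ + m) ∈ X := fun m => by
    induction m with
    | zero => simpa using h0
    | succ m ih => push_cast; rw [← add_assoc]; exact hs _ ih
  have hk := hF.pos
  have h2 : ((i₀ - i).natAbs : ℤ) ≤ (i₀ - i).natAbs * k :=
    le_mul_of_one_le_right (by positivity) (by omega)
  obtain ⟨m, hm⟩ := Int.eq_ofNat_of_zero_le (show 0 ≤ i - i₀ + (i₀ - i).natAbs * k by omega)
  have h3 := h1 m
  rw [show i₀ + (m : ℤ) = i + (i₀ - i).natAbs * k by linarith,
    hF.add_mul, hX] at h3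
  exact h3

omit h hA in
theorem add_lt_of_left (h : IsPeriodicOrder n r) (hleft : ∀ i, r (F (i + 1)) (F i)) :
    r (F 0 + d * n) (F 0) := by
  have hleft' : ∀ m : ℕ, r (F (m + 1)) (F 0) := fun m => by
    induction m with
    | zero => exact hleft 0
    | succ m ih => exact h.trans _ _ _ (by exact_mod_cast hleft (m + 1)) ih
  obtain ⟨m, hm⟩ := Int.eq_ofNat_of_zero_le (show 0 ≤ k - 1 by have := hF.pos; omega)
  have h1 := hleft' m
  rwa [show ((m : ℕ) : ℤ) + 1 = 0 + k by rw [zero_add]; exact (eq_add_of_sub_eq hm).symm,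
    hF.add] at h1

/-- The displacement is one if some translate of a point by `n` is visited too. -/
theorem d_eq_one_of_mem {i j : ℤ} (e : F i = F j + n) : d = 1 := by
  have hd := hF.d_pos h hA
  have hn := h.pos
  obtain ⟨l, hl⟩ := hF.dvd i j (by simp [e])
  have h1 := hF.add_mul j l
  rw [show j + l * k = i by linarith, e] at h1
  have h2 : (n : ℤ) * (l * d) = n * 1 := by linarith
  have h3 := mul_left_cancel₀ (by omega) h2
  exact Int.eq_one_of_mul_eq_one_left hd.le h3

/-- Otherwise the orbit and its translate by n are disjoint. By `not_L_R` the orbit has color L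
throughout. Then each step is strictly nested in a step of the translate, and conversely, so a step
of the orbit would be strictly nested in another step of the same orbit. -/
theorem d_eq_one_of_down (hdown : ∃ i, F i ∈ Lbar c) : d = 1 := by
  by_contra hd1
  have hdis : ∀ i j, F i ≠ F j + n := fun i j e => hd1 (hF.d_eq_one_of_mem h hA e)
  have hS := hF.stepSeq h hA
  have hS' := hF.stepSeq_add h hA
  obtain ⟨i₀, hi₀⟩ := hdown
  have hall := hF.mem_of_lt_periodic (X := Lbar c) (fun x l => h.col.mem_L_add x l) hi₀ (by
    intro i hi
    rw [← h.col.not_mem_R]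
    exact fun hR => hS.not_L_R h hA hS' hdis hi hR)
  have hall' : ∀ i, F i + n ∈ Lbar c := fun i => by
    have := (h.col.mem_L_add (F i) 1).2 (hall i)
    rwa [one_mul] at this
  obtain ⟨j, h1, h2⟩ := hS.nested h hA hS' hdis (hall 0) hall'
  obtain ⟨i, h3, h4⟩ := hS'.nested h hA hS (fun i j e => hdis j i e.symm) (hall' j) hall
  have h5 := hS.strictMono.lt_iff_lt.1 (h3.trans h1)
  have h6 := hS.strictMono.lt_iff_lt.1 (h2.trans h4)
  omega

end IsOrbit

end

end AffineTITO

namespace AffineTITO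

/-! ### A single waxing block on which the sequence is infinite -/

/-- An orbit of `ncad r` that is invariant under translation by `n`, where no arc starts from
`F (-1)`. -/
structure TopOrbit (n : ℕ) (c : Equiv.Perm ℤ) (r : ℤ → ℤ → Prop) (F : ℤ → ℤ) (k : ℤ) : Prop where
  seq : StepSeq c r (ncad r) F
  pos : 0 < k
  add : ∀ i, F (i + k) = F i + n
  last_top : ∀ q, ¬ HasArc (ncad r) (F (-1)) q

namespace TopOrbit

variable {n : ℕ} {c : Equiv.Perm ℤ} {r : ℤ → ℤ → Prop} (h : AvoidsPatterns n c r) {F : ℤ → ℤ}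
  {k : ℤ} (hF : TopOrbit n c r F k)
include h hF

omit h in
theorem last : F (k - 1) = F (-1) + n := by
  rw [← hF.add]; congr 1; ring

theorem last_top' (q : ℤ) : ¬ HasArc (ncad r) (F (k - 1)) q := by
  rw [hF.last]
  intro H
  refine hF.last_top (q - n) ?_
  rw [← h.toIsPeriodicOrder.isSubdiagram_ncad.tr 1]
  simpa using H

omit h in
theorem mem_range_add (x j : ℤ) : x + j * n ∈ Set.range F ↔ x ∈ Set.range F := by
  have key : ∀ x j : ℤ, x ∈ Set.range F → x + j * n ∈ Set.range F := by
    rintro _ j ⟨i, rfl⟩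
    refine ⟨i + j * k, ?_⟩
    induction j using Int.induction_on with
    | zero => simp
    | succ j ih => rw [show i + ((j : ℤ) + 1) * k = i + j * k + k by ring, hF.add, ih]; ring
    | pred j ih =>
      have := hF.add (i + (-(j : ℤ) - 1) * k)
      rw [show i + (-(j : ℤ) - 1) * k + k = i + -(j : ℤ) * k by ring, ih] at this
      linarith
  refine ⟨fun H => ?_, key x j⟩
  have := key _ (-j) H
  simpa using this

theorem succ_mem {γ : Set ℤ} {m T i : ℤ} (hγ : ChainData r γ m T) (hi : F i ∈ γ) :
    F i = T ∨ F (i + 1) ∈ γ := by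
  rcases hγ.up _ hi with e | ⟨y, hy, ha⟩
  · exact Or.inl e
  · obtain ⟨p, hp⟩ := hF.seq.step i
    rcases hp.out with e | e
    · rw [arc_right_unique h ha (e ▸ hp.arc)] at hy
      exact Or.inr hy
    · exact (e _ ha).elim

/-- The end of a chain that meets the orbit is in the orbit. -/
theorem exists_top {γ : Set ℤ} {m T i : ℤ} (hγ : ChainData r γ m T) (hi : F i ∈ γ) :
    ∃ t, i ≤ t ∧ T = F t ∧ ∀ j, i ≤ j → (∀ q, ¬ HasArc (ncad r) (F j) q) → t ≤ j := by
  obtain ⟨j, hj⟩ := hF.seq.exists_gt T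
  have hle := hγ.le _ hi
  have hij : i ≤ j := (hF.seq.strictMono.lt_iff_lt.1 (by omega)).le
  obtain ⟨t, ht, hT, hmem⟩ : ∃ t, i ≤ t ∧ T = F t ∧ ∀ s, i ≤ s → s ≤ t → F s ∈ γ := by
    obtain ⟨t, ht1, ht2, ht3, ht4⟩ := exists_int_switch
      (P := fun t => ∀ s, i ≤ s → s ≤ t → F s ∈ γ) hij
      (fun s h1 h2 => by rwa [le_antisymm h2 h1])
      (fun H => by
        have := hγ.le _ (H j hij le_rfl)
        omega)
    refine ⟨t, ht1, ?_, ht3⟩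
    by_contra hne
    have h1 := (hF.succ_mem h hγ (ht3 t ht1 le_rfl)).resolve_left (Ne.symm hne)
    refine ht4 fun s h2 h3 => ?_
    rcases h3.eq_or_lt with rfl | h3
    · exact h1
    · exact ht3 s h2 (by omega)
  refine ⟨t, ht, hT, fun j' h1 h2 => ?_⟩
  by_contra hlt
  have h3 := hγ.eq_T_of_top (hmem j' h1 (by omega)) h2
  have := hF.seq.strictMono (show j' < t by omega)
  omega

theorem not_mem_of_top {γ : Set ℤ} {m T i : ℤ} (hγ : ChainData r γ m T) (hT : T ∉ Set.range F) :
    F i ∉ γ := fun hi => by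
  obtain ⟨t, -, ht, -⟩ := hF.exists_top h hγ hi
  exact hT ⟨t, ht.symm⟩

omit h in
/-- The index of the period in which a chain of the orbit ends. -/
theorem exists_period (t : ℤ) : ∃ j t', t = t' + j * k ∧ 0 ≤ t' ∧ t' < k ∧ F t = F t' + j * n := by
  have hk := hF.pos
  have hadd : ∀ i j : ℤ, F (i + j * k) = F i + j * n := fun i j => by
    induction j using Int.induction_on with
    | zero => simp
    | succ j ih => rw [show i + ((j : ℤ) + 1) * k = i + j * k + k by ring, hF.add, ih]; ring
    | pred j ih =>
      have := hF.add (i + (-(j : ℤ) - 1) * k)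
      rw [show i + (-(j : ℤ) - 1) * k + k = i + -(j : ℤ) * k by ring, ih] at this
      linarith
  have e : t = t % k + t / k * k := by rw [mul_comm]; exact (Int.emod_add_mul_ediv t k).symm
  exact ⟨t / k, t % k, e, Int.emod_nonneg _ (by omega), Int.emod_lt_of_pos _ hk, by
    conv_lhs => rw [e]
    exact hadd _ _⟩

/-- From a point of τ_a, a chain follows the orbit to its end, and it cannot go past F (k - 1),
where no arc starts. For the same reason no loop meets τ_a. -/
theorem mem_middleNumbering {a : ℤ} (htau : tauInts n c (ncad r) a = F '' Set.Ico 0 k)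
    (γ : Set ℤ) : γ ∈ middleNumbering n c (ncad r) a ↔
    IsArcChain (ncad r) γ ∧ ∃ m t, ChainData r γ m (F t) ∧ 0 ≤ t ∧ t < k := by
  unfold middleNumbering
  rw [Set.mem_ofPred_eq, htau]
  constructor
  · rintro ⟨hγ | ⟨f, hf, rfl⟩, x, hx, i, hi, rfl⟩
    · obtain ⟨m, T, hc⟩ := exists_chainData h hγ
      obtain ⟨t, h1, rfl, h2⟩ := hF.exists_top h hc hx
      have := h2 (k - 1) (by have := hi.2; omega) (hF.last_top' h)
      exact ⟨hγ, m, t, hc, hi.1.trans h1, by omega⟩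
    · have key : ∀ j : ℕ, F (i + j) ∈ Set.range f := fun j => by
        induction j with
        | zero => simpa using hx
        | succ j ih =>
          obtain ⟨l, hl⟩ := ih
          have ha := hf l
          rw [hl] at ha
          obtain ⟨p, hp⟩ := hF.seq.step (i + j)
          have e := hp.out.resolve_right fun H => H _ ha
          refine ⟨l + 1, ?_⟩
          rw [arc_right_unique h ha (e ▸ hp.arc)]
          push_cast
          ring_nf
      obtain ⟨j, hj⟩ := Int.eq_ofNat_of_zero_le (show 0 ≤ k - 1 - i by have := hi.2; omega)
      obtain ⟨l, hl⟩ := key j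
      have ha := hf l
      rw [hl, show i + (j : ℤ) = k - 1 by linarith] at ha
      exact (hF.last_top' h _ ha).elim
  · rintro ⟨hγ, m, t, hc, h1, h2⟩
    exact ⟨Or.inl hγ, F t, hc.memT, t, ⟨h1, h2⟩, rfl⟩

end TopOrbit

/-- The case of a single waxing block, with `F (-1)` in `Lbar c`. -/
structure WaxingOrbit (n : ℕ) (c : Equiv.Perm ℤ) (r : ℤ → ℤ → Prop) (F : ℤ → ℤ) (k : ℤ) : Prop
    extends TopOrbit n c r F k where
  last_mem : F (-1) ∈ Lbar c
  wax : ∀ x, r x (x + n)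
  fd : ∀ x y, FiniteDistance r x y

namespace WaxingOrbit

variable {n : ℕ} {c : Equiv.Perm ℤ} {r : ℤ → ℤ → Prop} (h : AvoidsPatterns n c r) {F : ℤ → ℤ}
  {k : ℤ} (hF : WaxingOrbit n c r F k)
include h hF

theorem last_mem' : F (k - 1) ∈ Lbar c := by
  rw [hF.last]
  have := (h.col.mem_L_add (F (-1)) 1).2 hF.last_mem
  rwa [one_mul] at this

theorem exists_chain (x : ℤ) : ∃ γ m T, IsArcChain (ncad r) γ ∧ ChainData r γ m T ∧ x ∈ γ := by
  obtain ⟨γ, h1, h2⟩ := exists_isArcChain_of_wax h (hF.wax x)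
  obtain ⟨m, T, h3⟩ := exists_chainData h h1
  exact ⟨γ, m, T, h1, h3, h2⟩

/-! #### Arcs outside of the orbit -/

section Arcs

variable {p q : ℤ} (ha : HasArc (ncad r) p q) (hq : q ∉ Set.range F)
include ha hq

/-- The orbit passes over q by landing after q. If it was before q at an earlier point over the arc,
it jumps over q to the right somewhere over the arc, ignoring an arc that is closer than the one it
uses. -/
theorem not_lt_of_arc_L (hqL : q ∈ Lbar c) {i : ℤ} (h1 : p < F i) (h2 : F i < q)
    (h3 : r (F i) q) : False := by
  have hA := h.toIsPeriodicOrder.isSubdiagram_ncad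
  obtain ⟨j, h4, h5, h6, -⟩ := hF.seq.pass h hA hq
  specialize h6 hqL
  have hij : i ≤ j + 1 := (hF.seq.strictMono.lt_iff_lt.1 (h2.trans h5)).le
  obtain ⟨t, ht1, ht2, ht3, ht4⟩ := exists_int_switch (P := fun t => r (F t) q) hij h3
    (fun H => h.asymm h6 H)
  have h7 : F i ≤ F t := hF.seq.strictMono.monotone ht1
  have h8 : F t ≤ F j := hF.seq.strictMono.monotone (by omega)
  have h9 := (h.not_iff fun e => hq ⟨_, e⟩).1 ht4
  obtain ⟨p', hs⟩ := hF.seq.step t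
  obtain ⟨hL, hp', -⟩ := hs.of_lt h hA (h.trans _ _ _ ht3 h9)
  rcases hs.closeL hp' hL p q ha (by omega) (by omega) with e | e
  · exact hq ⟨_, e.symm⟩
  · exact h.asymm e h9

omit ha in
-- The orbit passes over q by landing before q. If it was after q at a smaller point, some step goes
-- left for r over the larger number q, contrary to `Step.not_lt_of_gt`.
theorem not_lt_of_arc_R (hqR : q ∈ Rbar c) {i : ℤ} (h2 : F i < q)
    (h3 : r q (F i)) : False := by
  have hA := h.toIsPeriodicOrder.isSubdiagram_ncad
  obtain ⟨j, h4, h5, -, h6⟩ := hF.seq.pass h hA hq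
  specialize h6 hqR
  have hij : i ≤ j + 1 := (hF.seq.strictMono.lt_iff_lt.1 (h2.trans h5)).le
  obtain ⟨t, ht1, ht2, ht3, ht4⟩ := exists_int_switch (P := fun t => r q (F t)) hij h3
    (fun H => h.asymm h6 H)
  have h8 : F t ≤ F j := hF.seq.strictMono.monotone (by omega)
  have h9 := (h.not_iff fun e => hq ⟨_, e.symm⟩).1 ht4
  obtain ⟨p', hs⟩ := hF.seq.step t
  exact hs.not_lt_of_gt h (by omega) (hF.fd _ _).1 h9 ht3

/-- Where the orbit passes over a point, it lands after it or before it according to its color.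
Different colors at p and q would put the orbit on the wrong side of q at a point over the arc. -/
theorem mem_L_iff_of_arc (hp : p ∉ Set.range F) : p ∈ Lbar c ↔ q ∈ Lbar c := by
  have hA := h.toIsPeriodicOrder.isSubdiagram_ncad
  obtain ⟨hlt, hc⟩ := hasArc_ncad.1 ha
  obtain ⟨i, h1, h2, h3, h3'⟩ := hF.seq.pass h hA hp
  obtain ⟨j, h4, h5, h6, h6'⟩ := hF.seq.pass h hA hq
  have hij : i ≤ j := by
    have := hF.seq.strictMono.lt_iff_lt.1 (show F i < F (j + 1) by omega)
    omega
  have hlt' : i ≠ j → F (i + 1) < q := fun e => by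
    have : F (i + 1) ≤ F j := hF.seq.strictMono.monotone (by omega)
    omega
  constructor
  · intro hL
    rw [← h.col.not_mem_R]
    intro hR
    specialize h3 hL
    specialize h6' hR
    have h7 : r q (F (i + 1)) := h.trans _ _ _ hc.1 h3
    have hne : i ≠ j := fun e => h.asymm h7 (e ▸ h6')
    exact hF.not_lt_of_arc_R h hq hR (hlt' hne) h7
  · intro hL
    rw [← h.col.not_mem_R]
    intro hR
    specialize h3' hR
    specialize h6 hL
    have h7 : r (F (i + 1)) q :=
      (h.le_cover hc h3').resolve_left fun e => hq ⟨_, e⟩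
    have hne : i ≠ j := fun e => h.asymm h7 (e ▸ h6)
    exact hF.not_lt_of_arc_L h ha hq hL h2 (hlt' hne) h7

theorem not_straddle_L (hqL : q ∈ Lbar c) {i : ℤ} (hi : F i ∈ Lbar c) (h1 : p < F i)
    (h2 : F i < q) : False :=
  hF.not_lt_of_arc_L h ha hq hqL h1 h2 (h.arc_L (hasArc_ncad.1 ha).2 h1 h2 hi)

end Arcs

end WaxingOrbit

end AffineTITO

/-! ### The initial segment cut out by the orbit -/

namespace AffineTITO

/-- `γ` is a chain that meets the period `F 0, …, F (k - 1)` and whose minimum `μ` is minimal. -/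
structure LeastChain (r : ℤ → ℤ → Prop) (F : ℤ → ℤ) (k : ℤ) (γ : Set ℤ) (μ t : ℤ) : Prop where
  data : ChainData r γ μ (F t)
  nonneg : 0 ≤ t
  lt : t < k
  le : ∀ γ' m' t', ChainData r γ' m' (F t') → 0 ≤ t' → t' < k → μ ≤ m'

/-- The initial segment of `r` that ends with the window of the orbit `F`. -/
def initialSegment (n : ℕ) (c : Equiv.Perm ℤ) (r : ℤ → ℤ → Prop) (F : ℤ → ℤ) (k μ : ℤ) : Set ℤ :=
  {x | ∃ γ m T, ChainData r γ m T ∧ x ∈ γ ∧ (T ∈ Set.range F ∧ T ≤ F (k - 1) ∨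
    T ∉ Set.range F ∧ (x ∈ Lbar c ∧ x ≤ F (k - 1) ∨ x ∈ Rbar c ∧ x < μ + n))}

theorem ChainData.T_eq {n : ℕ} {c : Equiv.Perm ℤ} {r : ℤ → ℤ → Prop} (h : AvoidsPatterns n c r)
    {γ γ' : Set ℤ} {m T m' T' x : ℤ} (hγ : ChainData r γ m T) (hγ' : ChainData r γ' m' T')
    (hx : x ∈ γ) (hx' : x ∈ γ') : T = T' := by
  obtain rfl := hγ.eq_of_mem h hγ' hx hx'
  exact hγ'.eq_T_of_top hγ.memT hγ.top

namespace WaxingOrbit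

variable {n : ℕ} {c : Equiv.Perm ℤ} {r : ℤ → ℤ → Prop} (h : AvoidsPatterns n c r) {F : ℤ → ℤ}
  {k : ℤ} (hF : WaxingOrbit n c r F k)
include h hF

theorem exists_leastChain : ∃ γ μ t, LeastChain r F k γ μ t := by
  obtain ⟨γ, m, T, -, hγ, h0⟩ := hF.exists_chain h (F 0)
  obtain ⟨t, ht, rfl, ht'⟩ := hF.exists_top h hγ h0
  have ht2 := ht' (k - 1) (by have := hF.pos; omega) (hF.last_top' h)
  have hfin : {m | ∃ γ t, ChainData r γ m (F t) ∧ 0 ≤ t ∧ t < k}.Finite := by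
    refine ((Set.finite_Ico (0 : ℤ) k).biUnion (t := fun t => {m | ∃ γ, ChainData r γ m (F t)})
      fun t _ => Set.Subsingleton.finite ?_).subset ?_
    · rintro m ⟨γ, hγ⟩ m' ⟨γ', hγ'⟩
      have := hγ.eq_of_mem h hγ' hγ.memT hγ'.memT
      subst this
      exact hγ'.eq_m_of_bot hγ.memm hγ.bot
    · rintro m ⟨γ, t, h1, h2, h3⟩
      exact Set.mem_biUnion (show t ∈ Set.Ico 0 k from ⟨h2, h3⟩) ⟨γ, h1⟩
  obtain ⟨μ, ⟨γ', t', h1, h2, h3⟩, hmin⟩ := Set.exists_min_image _ id hfin ⟨m, γ, t, hγ, ht, by omega⟩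
  exact ⟨γ', μ, t', h1, h2, h3, fun γ'' m'' t'' h4 h5 h6 => hmin m'' ⟨γ'', t'', h4, h5, h6⟩⟩

variable {γ₀ : Set ℤ} {μ t₀ : ℤ} (hμ : LeastChain r F k γ₀ μ t₀)
include hμ

/-- No arc starts at F (-1), so F 0 is reached by an arc whose initial point is smaller than F (-1)
and belongs to a chain of τ_a. -/
theorem mu_lt : μ < F (-1) := by
  have hk := hF.pos
  obtain ⟨p, hp⟩ := hF.seq.step (-1)
  rw [show (-1 : ℤ) + 1 = 0 by norm_num] at hp
  obtain ⟨γ, m, T, -, hγ, h0⟩ := hF.exists_chain h (F 0)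
  obtain ⟨t, ht, rfl, ht'⟩ := hF.exists_top h hγ h0
  have ht2 := ht' (k - 1) (by omega) (hF.last_top' h)
  have h1 := (hγ.le p (hγ.mem_of_arc' h hp.arc h0)).1
  have h2 := hμ.le γ m t hγ ht (by omega)
  have h3 : p ≠ F (-1) := fun e => hF.last_top _ (e ▸ hp.arc)
  have := hp.le
  omega

omit h in
theorem last_lt_top : F (-1) < F t₀ := hF.seq.strictMono (by have := hμ.nonneg; omega)

/-- If μ had color L, the orbit would land after μ when passing over it. But F (-1), of color L and
over γ₀, precedes γ₀. In between, the orbit would jump over μ from a point covered by an arc of γ₀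
that is closer than the arc it uses. -/
theorem mu_mem_R : μ ∈ Rbar c := by
  have hA := h.toIsPeriodicOrder.isSubdiagram_ncad
  have hlt := hF.mu_lt h hμ
  have hlt2 := hF.last_lt_top hμ
  have ht0 := hμ.nonneg
  have hdis : ∀ i ≤ -1, F i ∉ γ₀ := fun i hi hmem => by
    obtain ⟨t, h1, h2, h3⟩ := hF.exists_top h hμ.data hmem
    have := h3 (-1) hi hF.last_top
    have := hF.seq.strictMono.injective h2
    omega
  rw [← h.col.not_mem_L]
  intro hL
  have hO : μ ∉ Set.range F := by
    rintro ⟨i, hi⟩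
    exact hdis i ((hF.seq.strictMono.lt_iff_lt.1 (hi ▸ hlt)).le) (hi ▸ hμ.data.memm)
  obtain ⟨i, h1, h2, h3, -⟩ := hF.seq.pass h hA hO
  specialize h3 hL
  have hi : i + 1 ≤ -1 := by
    have := hF.seq.strictMono.lt_iff_lt.1 (h1.trans hlt)
    omega
  have h4 : r (F (-1)) μ := hμ.data.lt_of_mem_L h (hdis _ le_rfl) hlt hlt2 hF.last_mem hμ.data.memm
  obtain ⟨t, ht1, ht2, ht3, ht4⟩ := exists_int_switch (P := fun t => r μ (F t)) hi h3
    (fun H => h.asymm h4 H)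
  have h5 := (h.not_iff fun e => hO ⟨_, e.symm⟩).1 ht4
  obtain ⟨p, hs⟩ := hF.seq.step t
  have h6 : F (i + 1) ≤ F t := hF.seq.strictMono.monotone ht1
  have h7 : F t < F (-1) := hF.seq.strictMono ht2
  rcases hs.of_gt h hA (h.trans _ _ _ h5 ht3) with e | ⟨hR, hp, -⟩
  · have := (hA.arc hs.arc).2.2 μ
    rw [e] at this
    exact this ⟨h5, ht3⟩
  · obtain ⟨p', hp', q', hq', ha, h8, h9⟩ := hμ.data.exists_arc (z := F t) (by omega) (by omega)
    have h10 : p' ≠ F t := fun e => hdis t (by omega) (e ▸ hp')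
    have h11 := hμ.data.lt_all_of_lt h (hdis (t + 1) (by omega)) hμ.data.memm h5 hq'
    rcases hs.closeR hp hR p' q' ha (by omega) h9 with e | e
    · exact h.ne h11 e.symm
    · exact h.asymm e h11

theorem mu_add_mem_R : μ + n ∈ Rbar c := by
  have := (h.col.mem_R_add μ 1).2 (hF.mu_mem_R h hμ)
  rwa [one_mul] at this

omit hF in
theorem data_add : ChainData r ((fun x => x + 1 * (n : ℤ)) '' γ₀) (μ + n) (F t₀ + n) := by
  have := hμ.data.tr h 1
  simpa only [one_mul] using this

omit h hμ in
theorem top_add_mem : F t₀ + n ∈ Set.range F := by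
  have := (hF.mem_range_add (F t₀) 1).2 ⟨_, rfl⟩
  rwa [one_mul] at this

omit h in
theorem last_lt_top_add : F (k - 1) < F t₀ + n := by
  have := hF.last_lt_top hμ
  rw [hF.last]
  omega

/-- The color of μ + n puts p, hence q, before the translated chain γ₀ + n. If q is under the top of
this chain its color puts it after the chain; if q is above the top, `not_lt_of_arc_R` applies to
that top, which is on the orbit. -/
theorem not_straddle_R {p q : ℤ} (ha : HasArc (ncad r) p q)
    (hq : q ∉ Set.range F) (hqR : q ∈ Rbar c) (h1 : p < μ + n) (h2 : μ + n < q) : False := by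
  have hγ' := data_add h hμ
  have hc := (hasArc_ncad.1 ha).2
  have hpγ : p ∉ (fun x => x + 1 * (n : ℤ)) '' γ₀ := fun H => by
    have := (hγ'.le p H).1
    omega
  have hqγ : q ∉ (fun x => x + 1 * (n : ℤ)) '' γ₀ := fun H => hpγ (hγ'.mem_of_arc' h ha H)
  have h3 := h.arc_R hc h1 h2 (hF.mu_add_mem_R h hμ)
  have h4 := h.trans _ _ _ hc.1 (hγ'.lt_all_of_lt h hpγ hγ'.memm h3 hγ'.memT)
  rcases lt_or_ge (F t₀ + n) q with h5 | h5
  · obtain ⟨i, hi⟩ := hF.top_add_mem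
    rw [← hi] at h4 h5
    exact hF.not_lt_of_arc_R h hq hqR h5 h4
  · have h6 : q ≠ F t₀ + n := fun e => hq (e ▸ hF.top_add_mem)
    have h7 := hγ'.lt_of_mem_R h hqγ h2 (by omega) hqR hγ'.memT
    exact h.asymm h4 h7

omit hF hμ in
theorem mem_initialSegment {γ : Set ℤ} {m T x : ℤ} (hγ : ChainData r γ m T) (hx : x ∈ γ) :
    x ∈ initialSegment n c r F k μ ↔ (T ∈ Set.range F ∧ T ≤ F (k - 1) ∨
    T ∉ Set.range F ∧ (x ∈ Lbar c ∧ x ≤ F (k - 1) ∨ x ∈ Rbar c ∧ x < μ + n)) := by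
  constructor
  · rintro ⟨γ', m', T', h1, h2, h3⟩
    rwa [hγ.T_eq h h1 hx h2]
  · exact fun H => ⟨γ, m, T, hγ, hx, H⟩

theorem ne_mu_add_of_top {γ : Set ℤ} {m T x : ℤ} (hγ : ChainData r γ m T) (hx : x ∈ γ)
    (hT : T ∉ Set.range F) : x ≠ μ + n := by
  rintro rfl
  have hγ' := data_add h hμ
  exact hT (hγ.T_eq h hγ' hx hγ'.memm ▸ hF.top_add_mem)

/-- On a chain of the orbit, membership depends only on the top. Elsewhere the two ends of an arc
have the same color and do not straddle the threshold for this color. -/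
theorem arc_mem_initialSegment {p q : ℤ} (ha : HasArc (ncad r) p q) :
    p ∈ initialSegment n c r F k μ ↔ q ∈ initialSegment n c r F k μ := by
  obtain ⟨γ, m, T, -, hγ, hp⟩ := hF.exists_chain h p
  have hq := hγ.mem_of_arc h ha hp
  rw [mem_initialSegment h hγ hp, mem_initialSegment h hγ hq]
  by_cases hT : T ∈ Set.range F
  · simp [hT]
  · have hlt := (hasArc_ncad.1 ha).1
    have hpO : p ∉ Set.range F := by
      rintro ⟨i, rfl⟩
      exact hF.not_mem_of_top h hγ hT hp
    have hqO : q ∉ Set.range F := by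
      rintro ⟨i, rfl⟩
      exact hF.not_mem_of_top h hγ hT hq
    have hcol := hF.mem_L_iff_of_arc h ha hqO hpO
    have hpμ := hF.ne_mu_add_of_top h hμ hγ hp hT
    have hqμ := hF.ne_mu_add_of_top h hμ hγ hq hT
    have hpM : p ≠ F (k - 1) := fun e => hpO ⟨_, e.symm⟩
    simp only [hT, false_and, not_false_eq_true, true_and, false_or]
    rcases h.col.L_or_R q with hL | hR
    · have hR := h.col.not_mem_R.2 hL
      have hpL := hcol.2 hL
      have hpR := h.col.not_mem_R.2 hpL
      simp only [hL, hR, hpL, hpR, true_and, false_and, or_false]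
      refine ⟨fun h1 => ?_, fun h1 => by omega⟩
      by_contra h2
      exact hF.not_straddle_L h ha hqO hL (hF.last_mem' h) (by omega) (by omega)
    · have hL := h.col.not_mem_L.2 hR
      have hpL : p ∉ Lbar c := fun H => hL (hcol.1 H)
      have hpR := h.col.not_mem_L.1 hpL
      simp only [hL, hR, hpL, hpR, true_and, false_and, false_or]
      refine ⟨fun h1 => ?_, fun h1 => by omega⟩
      by_contra h2
      exact hF.not_straddle_R h hμ ha hqO hR h1 (by omega)

/-- This makes `initialSegment` an initial segment of r. Descents cause no trouble since it is a
union of chains, so z is the bottom of its chain and d the top of its own. In each case, either the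
colors contradict the order of z and d, or a step of the orbit contradicts the closeness of its arc.
-/
theorem initialSegment_cover {z d : ℤ} (hc : CoverRel r z d)
    (hz : z ∉ initialSegment n c r F k μ) (hd : d ∈ initialSegment n c r F k μ) : False := by
  have hA := h.toIsPeriodicOrder.isSubdiagram_ncad
  have hzd : z < d := by
    by_contra hlt
    have h1 := h.ne hc.1
    exact hz ((hF.arc_mem_initialSegment h hμ (hasArc_ncad.2 ⟨by omega, hc⟩)).1 hd)
  obtain ⟨γz, mz, Tz, -, hγz, hzγ⟩ := hF.exists_chain h z
  obtain ⟨γd, md, Td, -, hγd, hdγ⟩ := hF.exists_chain h d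
  have hzbot : ∀ x, ¬ HasArc (ncad r) x z := fun x hx => by
    have h1 := hasArc_ncad.1 hx
    have := h.cover_right_unique h1.2 hc
    omega
  have hdtop : ∀ x, ¬ HasArc (ncad r) d x := fun x hx => by
    have h1 := hasArc_ncad.1 hx
    have := h.cover_left_unique h1.2 hc
    omega
  obtain rfl := hγz.eq_m_of_bot hzγ hzbot
  obtain rfl := hγd.eq_T_of_top hdγ hdtop
  have hz' := hz
  rw [mem_initialSegment h hγz hzγ] at hz
  rw [mem_initialSegment h hγd hdγ] at hd
  have hdz : d ∉ γz := fun H => by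
    rcases ((hγz.mem_iff d).1 H).2 with e | e
    · omega
    · exact h.asymm hc.1 e
  have hM := hF.last_mem' h
  have hγ' := data_add h hμ
  have hTM := hF.last_lt_top_add hμ
  by_cases hTz : Tz ∈ Set.range F
  -- The chain of z ends on the orbit beyond F (k - 1). When d ≤ F (k - 1), the point d is over this
  -- chain, and following it forces the color R.
  · have hTzM : F (k - 1) < Tz := by
      by_contra hle
      exact hz (Or.inl ⟨hTz, by omega⟩)
    -- `d` is below the end of the chain of `z`
    have key : d ≤ F (k - 1) → d ∈ Rbar c := fun hle => by
      rw [← h.col.not_mem_L]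
      intro hL
      exact h.asymm hc.1 (hγz.lt_of_mem_L h hdz hzd (by omega) hL hzγ)
    rcases hd with ⟨⟨t, rfl⟩, hdM⟩ | ⟨-, ⟨hdL, hdM⟩ | ⟨hdR, hdμ⟩⟩
    · have hdR := key hdM
      have hne : F t ≠ F (k - 1) := fun e => not_L_and_R hM (e ▸ hdR)
      have htk := hF.seq.strictMono.lt_iff_lt.1 (lt_of_le_of_ne hdM hne)
      obtain ⟨p, hs⟩ := hF.seq.step t
      have hp : p ≠ F t := fun e => hdtop _ (e ▸ hs.arc)
      have hle := hs.le
      have hlt := hs.lt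
      have h1 : r (F (t + 1)) z :=
        (h.le_cover hc (hs.lt_of_mem_R h hA hdR)).resolve_left (by omega)
      have h2 : F (t + 1) ∉ γz := fun H => by
        obtain ⟨t', h3, h4, h5⟩ := hF.exists_top h hγz H
        have := hF.seq.strictMono.monotone (h5 (k - 1) (by omega) (hF.last_top' h))
        omega
      obtain ⟨p', hp', q', hq', ha, h3, h4⟩ := hγz.exists_arc (z := F t) hzd.le (by omega)
      have h5 := hγz.lt_all_of_lt h h2 hzγ h1 hq'
      have h6 : p' ≠ F t := fun e => hdz (e ▸ hp')
      rcases hs.closeR (by omega) hdR p' q' ha (by omega) h4 with e | e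
      · exact h.ne h5 e.symm
      · exact h.asymm h5 e
    · exact not_L_and_R hdL (key hdM)
    -- The chain of z is a translate of a chain of τ_a by at least n, so its minimum z is at least μ
    -- + n.
    · obtain ⟨t, rfl⟩ := hTz
      obtain ⟨j, t', -, ht0, htk, ht⟩ := hF.exists_period t
      have hj : 1 ≤ j := by
        by_contra hj
        have h1 : F t' ≤ F (k - 1) := hF.seq.strictMono.monotone (by omega)
        have h2 : j * n ≤ 0 := mul_nonpos_of_nonpos_of_nonneg (by omega) (by omega)
        omega
      have h1 := hγz.tr h (-j)
      rw [show F t + -j * n = F t' by rw [ht]; ring] at h1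
      have h2 := hμ.le _ _ _ h1 ht0 htk
      have h3 : 1 * (n : ℤ) ≤ j * n := mul_le_mul_of_nonneg_right hj (by omega)
      rw [neg_mul] at h2
      omega
  · have hzO : z ∉ Set.range F := by
      rintro ⟨i, rfl⟩
      exact hF.not_mem_of_top h hγz hTz hzγ
    have hzγ' : z ∉ (fun x => x + 1 * (n : ℤ)) '' γ₀ := fun H =>
      hTz (hγz.T_eq h hγ' hzγ H ▸ hF.top_add_mem)
    obtain ⟨i, hi1, hi2, hi3, hi4⟩ := hF.seq.pass h hA hzO
    rcases h.col.L_or_R z with hL | hR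
    -- Here d has color R. The orbit lands after z when it passes over z, and before d when it
    -- passes over d, so one step moves left over the larger number d.
    · have hzM : F (k - 1) < z := by
        by_contra hle
        exact hz (Or.inr ⟨hTz, Or.inl ⟨hL, by omega⟩⟩)
      rcases hd with ⟨-, hdM⟩ | ⟨hdO, ⟨-, hdM⟩ | ⟨hdR, hdμ⟩⟩
      · omega
      · omega
      specialize hi3 hL
      obtain ⟨j, hj1, hj2, -, hj4⟩ := hF.seq.pass h hA hdO
      specialize hj4 hdR
      have hj5 : r (F (j + 1)) z := (h.le_cover hc hj4).resolve_left (by omega)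
      have hij : i ≤ j := by
        have := hF.seq.strictMono.lt_iff_lt.1 (show F i < F (j + 1) by omega)
        omega
      obtain ⟨t, ht1, ht2, ht3, ht4⟩ := exists_int_switch (P := fun t => r z (F t))
        (show i + 1 ≤ j + 1 by omega) hi3 (fun H => h.asymm hj5 H)
      have h1 := (h.not_iff fun e => hzO ⟨_, e.symm⟩).1 ht4
      have h2 : F t ≤ F j := hF.seq.strictMono.monotone (by omega)
      obtain ⟨p, hs⟩ := hF.seq.step t
      refine hs.not_lt_of_gt h (d := d) (by omega) (hF.fd _ _).1 (h.trans _ _ _ h1 hc.1) ?_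
      exact (h.cover_le hc ht3).resolve_left fun e => hdO ⟨_, e.symm⟩
    -- Here z is over γ₀ + n with color R, so it follows this chain. If d is on the orbit, some step
    -- jumps to the right over z from a point covered by an arc of γ₀ + n, which is closer.
    · have hzμ : μ + n < z := by
        have := hF.ne_mu_add_of_top h hμ hγz hzγ hTz
        by_contra hle
        exact hz (Or.inr ⟨hTz, Or.inr ⟨hR, by omega⟩⟩)
      specialize hi4 hR
      have hdM : d ≤ F (k - 1) := by
        rcases hd with ⟨-, hdM⟩ | ⟨-, ⟨-, hdM⟩ | ⟨-, hdμ⟩⟩ <;> omega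
      have hz1 := fun y hy => hγ'.lt_of_mem_R h hzγ' hzμ (by omega) hR (y := y) hy
      have hdγ' : d ∉ (fun x => x + 1 * (n : ℤ)) '' γ₀ := fun H => by
        have := hγ'.eq_T_of_top H hdtop
        omega
      have hdR : d ∈ Rbar c := by
        rw [← h.col.not_mem_L]
        intro hL
        exact h.asymm hc.1 (h.trans _ _ _
          (hγ'.lt_of_mem_L h hdγ' (by omega) (by omega) hL hγ'.memm) (hz1 _ hγ'.memm))
      rcases hd with ⟨⟨t, rfl⟩, -⟩ | ⟨-, ⟨hdL, -⟩ | ⟨-, hdμ⟩⟩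
      · have hit : i + 1 ≤ t := by
          have := hF.seq.strictMono.lt_iff_lt.1 (hi1.trans hzd)
          omega
        obtain ⟨s, hs1, hs2, hs3, hs4⟩ := exists_int_switch (P := fun t => r (F t) z) hit hi4
          (fun H => h.asymm hc.1 H)
        have h1 := (h.not_iff fun e => hzO ⟨_, e⟩).1 hs4
        have h2 : F (i + 1) ≤ F s := hF.seq.strictMono.monotone hs1
        have h3 : F s < F t := hF.seq.strictMono hs2
        obtain ⟨p, hs⟩ := hF.seq.step s
        obtain ⟨hsL, hp, htop⟩ := hs.of_lt h hA (h.trans _ _ _ hs3 h1)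
        have h4 : F s ∉ (fun x => x + 1 * (n : ℤ)) '' γ₀ := fun H => by
          have := hγ'.eq_T_of_top H htop
          omega
        obtain ⟨p', hp', q', hq', ha, h5, h6⟩ := hγ'.exists_arc (z := F s) (by omega) (by omega)
        have h7 : p' ≠ F s := fun e => h4 (e ▸ hp')
        have h8 := h.trans _ _ _ (hz1 _ hq') h1
        rcases hs.closeL hp hsL p' q' ha (by omega) h6 with e | e
        · exact h.ne h8 e
        · exact h.asymm h8 e
      · exact not_L_and_R hdL hdR
      · omega

end WaxingOrbit

end AffineTITO

/-! ### The window of a single waxing block -/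

namespace AffineTITO

theorem ChainData.forall_of_arc {r : ℤ → ℤ → Prop} {γ : Set ℤ} {m T : ℤ}
    (hγ : ChainData r γ m T) {Q : ℤ → Prop}
    (hQ : ∀ p ∈ γ, ∀ q ∈ γ, HasArc (ncad r) p q → (Q p ↔ Q q)) {x y : ℤ} (hx : x ∈ γ) (hy : y ∈ γ)
    (hxQ : Q x) : Q y := by
  have key : ∀ (l : ℕ) (z : ℤ), z ∈ γ → T - z ≤ l → (Q z ↔ Q T) := fun l => by
    induction l with
    | zero =>
      intro z hz hle
      have := (hγ.le z hz).2
      rw [show z = T by omega]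
    | succ l ih =>
      intro z hz hle
      rcases hγ.up z hz with rfl | ⟨w, hw, ha⟩
      · rfl
      · have := (hasArc_ncad.1 ha).1
        exact (hQ z hz w hw ha).trans (ih w hw (by push_cast at hle; omega))
  exact (key (T - y).toNat y hy (by omega)).2 ((key (T - x).toNat x hx (by omega)).1 hxQ)

namespace WaxingOrbit

variable {n : ℕ} {c : Equiv.Perm ℤ} {r : ℤ → ℤ → Prop} (h : AvoidsPatterns n c r) {F : ℤ → ℤ}
  {k : ℤ} (hF : WaxingOrbit n c r F k) {γ₀ : Set ℤ} {μ t₀ : ℤ} (hμ : LeastChain r F k γ₀ μ t₀)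
  {a : ℤ} (htau : tauInts n c (ncad r) a = F '' Set.Ico 0 k)
include h hF

section

include htau

theorem isGreatest_middle : IsGreatest (⋃₀ middleNumbering n c (ncad r) a) (F (k - 1)) := by
  have hk := hF.pos
  constructor
  · obtain ⟨γ, m, T, hγ, hc, hx⟩ := hF.exists_chain h (F (k - 1))
    refine ⟨γ, (hF.mem_middleNumbering h htau γ).2 ⟨hγ, m, k - 1, ?_, by omega, by omega⟩, hx⟩
    rwa [hc.eq_T_of_top hx (hF.last_top' h)]
  · rintro x ⟨γ, hγ, hx⟩
    obtain ⟨-, m, t, hc, h1, h2⟩ := (hF.mem_middleNumbering h htau γ).1 hγ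
    exact (hc.le x hx).2.trans (hF.seq.strictMono.monotone (by omega))

include hμ in
theorem isLeast_middle : IsLeast (⋃₀ middleNumbering n c (ncad r) a) μ := by
  constructor
  · obtain ⟨γ, m, T, hγ, hc, hx⟩ := hF.exists_chain h μ
    obtain rfl := hc.eq_of_mem h hμ.data hx hμ.data.memm
    exact ⟨_, (hF.mem_middleNumbering h htau _).2 ⟨hγ, μ, t₀, hμ.data, hμ.nonneg, hμ.lt⟩, hx⟩
  · rintro x ⟨γ, hγ, hx⟩
    obtain ⟨-, m, t, hc, h1, h2⟩ := (hF.mem_middleNumbering h htau γ).1 hγ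
    exact (hμ.le γ m t hc h1 h2).trans (hc.le x hx).1

omit h in
theorem tauClasses_eq : tauClasses n c (ncad r) a = Set.range F := by
  ext x
  unfold tauClasses
  rw [Set.mem_ofPred_eq, htau]
  constructor
  · rintro ⟨_, ⟨i, -, rfl⟩, e⟩
    obtain ⟨j, rfl⟩ := exists_eq_add_mul e.symm
    exact (hF.mem_range_add _ _).2 ⟨i, rfl⟩
  · rintro ⟨t, rfl⟩
    obtain ⟨j, t', -, h1, h2, h3⟩ := hF.exists_period t
    exact ⟨F t', ⟨t', ⟨h1, h2⟩, rfl⟩, by rw [h3]; simp [Int.ModEq]⟩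

end

include hμ

/-- With D the initial segment, the numbering covers D \ (D - n). The thresholds for tops on the
orbit and for color L are F (k - 1) and F (-1) = F (k - 1) - n; those for color R are μ + n and μ.
The thresholds lie on chains of the orbit, so the intervals are open for the other chains, and these
do not straddle them. -/
theorem isWindow (hst : tauStart n c (ncad r) a = .down)
    (htau : tauInts n c (ncad r) a = F '' Set.Ico 0 k) :
    IsWindow n r .waxing (windowOf n c (ncad r) a (leftNumbering n c (ncad r) a ∪
      middleNumbering n c (ncad r) a ∪ rightNumbering n c (ncad r) a)) ∧
    ∀ x, InBlock n (windowOf n c (ncad r) a (leftNumbering n c (ncad r) a ∪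
      middleNumbering n c (ncad r) a ∪ rightNumbering n c (ncad r) a)) x := by
  have hA := h.toIsPeriodicOrder.isSubdiagram_ncad
  have hW : IsWaxing n r Set.univ :=
    ⟨fun x _ => hF.wax x, fun x _ y => iff_of_true trivial (hF.fd x y)⟩
  have hlast := hF.last
  have hleft : ∀ γ, γ ∈ leftNumbering n c (ncad r) a ↔ IsArcChain (ncad r) γ ∧
      γ ⊆ (Lbar c ∩ Set.Ioo (F (k - 1) - n) (F (k - 1))) \ Set.range F := fun γ => by
    rw [leftNumbering, if_pos hst, (hF.isGreatest_middle h htau).csSup_eq, hF.tauClasses_eq htau]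
    rfl
  have hright : ∀ γ, γ ∈ rightNumbering n c (ncad r) a ↔ IsArcChain (ncad r) γ ∧
      γ ⊆ (Rbar c ∩ Set.Ioo μ (μ + n)) \ Set.range F := fun γ => by
    rw [rightNumbering, if_pos hst, (hF.isLeast_middle h hμ htau).csInf_eq, hF.tauClasses_eq htau]
    rfl
  have hmid := hF.mem_middleNumbering h htau
  have htr : ∀ {γ : Set ℤ} {m T x : ℤ}, ChainData r γ m T → x ∈ γ → ∀ j : ℤ,
      (x + j * n ∈ initialSegment n c r F k μ ↔ (T ∈ Set.range F ∧ T + j * n ≤ F (k - 1) ∨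
      T ∉ Set.range F ∧ (x ∈ Lbar c ∧ x + j * n ≤ F (k - 1) ∨
        x ∈ Rbar c ∧ x + j * n < μ + n))) := fun {γ m T x} hc hx j => by
    rw [mem_initialSegment h (hc.tr h j) ⟨x, hx, rfl⟩, hF.mem_range_add, h.col.mem_L_add,
      h.col.mem_R_add]
  have hspec := hW.isWindow h a (D := initialSegment n c r F k μ) (N :=
    leftNumbering n c (ncad r) a ∪ middleNumbering n c (ncad r) a ∪ rightNumbering n c (ncad r) a)
    ?_ (Set.subset_univ _) ?_ ?_ ?_
  · exact ⟨hspec.1, fun x => (hspec.2 x).2 trivial⟩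
  · rintro γ ((hγ | hγ) | hγ)
    · exact ((hleft γ).1 hγ).1
    · exact ((hmid γ).1 hγ).1
    · exact ((hright γ).1 hγ).1
  · rintro x hx y - hyx
    by_contra hy
    obtain ⟨u, v, huv, hu, hv, -, -⟩ := h.exists_cover_of_finite hyx (hF.fd y x).1
      (fun z => z ∉ initialSegment n c r F k μ) hy (not_not.2 hx)
    exact hF.initialSegment_cover h hμ huv hu (not_not.1 hv)
  · intro x _
    obtain ⟨γ, m, T, -, hc, hx⟩ := hF.exists_chain h x
    have h1 := hc.le x hx
    by_cases hT : T ∈ Set.range F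
    · obtain ⟨i, -, hi⟩ := exists_int_mul_lt h.pos T (F (k - 1))
      obtain ⟨j, -, hj⟩ := exists_int_mul_gt h.pos T (F (k - 1))
      refine ⟨⟨-i, (htr hc hx _).2 (Or.inl ⟨hT, by linarith⟩)⟩, j, fun H => ?_⟩
      rcases (htr hc hx _).1 H with H | H
      · linarith [H.2]
      · exact H.1 hT
    · rcases h.col.L_or_R x with hL | hR
      · obtain ⟨i, -, hi⟩ := exists_int_mul_lt h.pos x (F (k - 1))
        obtain ⟨j, -, hj⟩ := exists_int_mul_gt h.pos x (F (k - 1))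
        refine ⟨⟨-i, (htr hc hx _).2 (Or.inr ⟨hT, Or.inl ⟨hL, by linarith⟩⟩)⟩, j, fun H => ?_⟩
        rcases (htr hc hx _).1 H with H | ⟨-, H | H⟩
        · exact hT H.1
        · linarith [H.2]
        · exact not_L_and_R hL H.1
      · obtain ⟨i, -, hi⟩ := exists_int_mul_lt h.pos x (μ + n)
        obtain ⟨j, -, hj⟩ := exists_int_mul_gt h.pos x (μ + n)
        refine ⟨⟨-i, (htr hc hx _).2 (Or.inr ⟨hT, Or.inr ⟨hR, by linarith⟩⟩)⟩, j, fun H => ?_⟩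
        rcases (htr hc hx _).1 H with H | ⟨-, H | H⟩
        · exact hT H.1
        · exact not_L_and_R H.1 hR
        · linarith [H.2]
  · intro x
    have hx1 : ∀ {γ : Set ℤ} {m T : ℤ}, ChainData r γ m T → x ∈ γ → _ := fun hc hx => htr hc hx 1
    simp only [one_mul] at hx1
    constructor
    · rintro ⟨γ, (hγ | hγ) | hγ, hx⟩
      · obtain ⟨hγ, hsub⟩ := (hleft γ).1 hγ
        obtain ⟨m, T, hc⟩ := exists_chainData h hγ
        have hT := (hsub hc.memT).2
        obtain ⟨⟨hxL, hx2⟩, -⟩ := hsub hx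
        rw [mem_initialSegment h hc hx, hx1 hc hx]
        have hxR := h.col.not_mem_R.2 hxL
        simp only [hT, hxL, hxR, false_and, true_and, not_false_eq_true, false_or, or_false]
        exact ⟨hx2.2.le, by have := hx2.1; omega⟩
      · obtain ⟨hγ, m, t, hc, ht0, htk⟩ := (hmid γ).1 hγ
        rw [mem_initialSegment h hc hx, hx1 hc hx]
        have hT : F t ∈ Set.range F := ⟨t, rfl⟩
        simp only [hT, true_and, not_true_eq_false, false_and, or_false]
        have h1 : F t ≤ F (k - 1) := hF.seq.strictMono.monotone (by omega)
        have h2 : F (-1) < F t := hF.seq.strictMono (by omega)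
        omega
      · obtain ⟨hγ, hsub⟩ := (hright γ).1 hγ
        obtain ⟨m, T, hc⟩ := exists_chainData h hγ
        have hT := (hsub hc.memT).2
        obtain ⟨⟨hxR, hx2⟩, -⟩ := hsub hx
        rw [mem_initialSegment h hc hx, hx1 hc hx]
        have hxL := h.col.not_mem_L.2 hxR
        simp only [hT, hxL, hxR, false_and, true_and, not_false_eq_true, false_or]
        exact ⟨hx2.2, by have := hx2.1; omega⟩
    · rintro ⟨hxD, hxD'⟩
      obtain ⟨γ, m, T, hγ, hc, hx⟩ := hF.exists_chain h x
      rw [mem_initialSegment h hc hx] at hxD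
      rw [hx1 hc hx] at hxD'
      have hnO : T ∉ Set.range F → ∀ y ∈ γ, y ∉ Set.range F := by
        rintro hT y hy ⟨i, rfl⟩
        exact hF.not_mem_of_top h hc hT hy
      rcases hxD with ⟨⟨t, rfl⟩, hT⟩ | ⟨hT, ⟨hxL, hxM⟩ | ⟨hxR, hxμ⟩⟩
      · have h1 : F (-1) < F t := by
          by_contra hle
          refine hxD' (Or.inl ⟨⟨t, rfl⟩, ?_⟩)
          omega
        have h2 := hF.seq.strictMono.lt_iff_lt.1 h1
        have h3 := hF.seq.strictMono.le_iff_le.1 hT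
        exact ⟨γ, Or.inl (Or.inr ((hmid γ).2 ⟨hγ, m, t, hc, by omega, by omega⟩)), hx⟩
      · have hx2 : F (-1) < x := by
          by_contra hle
          exact hxD' (Or.inr ⟨hT, Or.inl ⟨hxL, by omega⟩⟩)
        have hx3 : x ≠ F (k - 1) := fun e => hnO hT x hx ⟨_, e.symm⟩
        refine ⟨γ, Or.inl (Or.inl ((hleft γ).2 ⟨hγ, fun y hy => ⟨?_, hnO hT y hy⟩⟩)), hx⟩
        have : y ∈ Lbar c ∧ F (-1) < y ∧ y < F (k - 1) := by
          refine hc.forall_of_arc (Q := fun y => y ∈ Lbar c ∧ F (-1) < y ∧ y < F (k - 1)) ?_ hx hy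
            ⟨hxL, hx2, by omega⟩
          intro p hp q hq ha
          have hlt := (hasArc_ncad.1 ha).1
          have hcol := hF.mem_L_iff_of_arc h ha (hnO hT q hq) (hnO hT p hp)
          have h1 := fun hqL i hi => hF.not_straddle_L h ha (hnO hT q hq) hqL (i := i) hi
          have hp1 : p ≠ F (-1) := fun e => hnO hT p hp ⟨_, e.symm⟩
          have hp2 : p ≠ F (k - 1) := fun e => hnO hT p hp ⟨_, e.symm⟩
          have hq1 : q ≠ F (-1) := fun e => hnO hT q hq ⟨_, e.symm⟩
          have hq2 : q ≠ F (k - 1) := fun e => hnO hT q hq ⟨_, e.symm⟩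
          rw [hcol]
          refine and_congr_right fun hqL => ?_
          have h2 := h1 hqL _ hF.last_mem
          have h3 := h1 hqL _ (hF.last_mem' h)
          constructor
          · rintro ⟨h4, h5⟩
            refine ⟨by omega, ?_⟩
            by_contra h6
            exact h3 h5 (by omega)
          · rintro ⟨h4, h5⟩
            refine ⟨?_, by omega⟩
            by_contra h6
            exact h2 (by omega) h4
        exact ⟨this.1, by have := this.2.1; omega, this.2.2⟩
      · have hx2 : μ ≤ x := by
          by_contra hle
          exact hxD' (Or.inr ⟨hT, Or.inr ⟨hxR, by omega⟩⟩)
        have hneμ : ∀ y ∈ γ, y ≠ μ := fun y hy e =>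
          hT (hc.T_eq h hμ.data hy (e ▸ hμ.data.memm) ▸ ⟨_, rfl⟩)
        have hneμ' := fun y hy => hF.ne_mu_add_of_top h hμ hc (x := y) hy hT
        refine ⟨γ, Or.inr ((hright γ).2 ⟨hγ, fun y hy => ⟨?_, hnO hT y hy⟩⟩), hx⟩
        have : y ∈ Rbar c ∧ μ < y ∧ y < μ + n := by
          refine hc.forall_of_arc (Q := fun y => y ∈ Rbar c ∧ μ < y ∧ y < μ + n) ?_ hx hy
            ⟨hxR, by have := hneμ x hx; omega, hxμ⟩
          intro p hp q hq ha
          have hlt := (hasArc_ncad.1 ha).1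
          have hcol := hF.mem_L_iff_of_arc h ha (hnO hT q hq) (hnO hT p hp)
          have h1 := fun hqR => hF.not_straddle_R h hμ ha (hnO hT q hq) hqR
          have h2 := fun hqR => hF.not_straddle_R h hμ (p := p + 1 * n) (q := q + 1 * n)
            ((hA.tr 1).2 ha) (fun H => hnO hT q hq ((hF.mem_range_add _ _).1 H))
            ((h.col.mem_R_add q 1).2 hqR)
          have hp1 := hneμ p hp
          have hp2 := hneμ' p hp
          have hq1 := hneμ q hq
          have hq2 := hneμ' q hq
          have hcolR : p ∈ Rbar c ↔ q ∈ Rbar c := by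
            rw [← h.col.not_mem_L, ← h.col.not_mem_L, hcol]
          rw [hcolR]
          refine and_congr_right fun hqR => ?_
          specialize h1 hqR
          specialize h2 hqR
          constructor
          · rintro ⟨h4, h5⟩
            refine ⟨by omega, ?_⟩
            by_contra h6
            exact h1 h5 (by omega)
          · rintro ⟨h4, h5⟩
            refine ⟨?_, by omega⟩
            by_contra h6
            exact h2 (by omega) (by omega)
        exact ⟨this.1, this.2.1, this.2.2⟩

end WaxingOrbit

/-! ### The map `tito` for a single waxing block -/

section

variable {n : ℕ} {c : Equiv.Perm ℤ} {r : ℤ → ℤ → Prop} (h : AvoidsPatterns n c r)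
include h

theorem tito_ncad_of_wax (hwax : ∀ x, r x (x + n)) (hfd : ∀ x y, FiniteDistance r x y) (a : ℤ) :
    tito n c a (ncad r) = r := by
  have hA := h.toIsPeriodicOrder.isSubdiagram_ncad
  unfold tito
  by_cases hfin : SeqFinite c (ncad r) a
  · rw [if_pos (Or.inl hfin)]
    have hW : IsWaxing n r Set.univ :=
      ⟨fun x _ => hwax x, fun x _ y => iff_of_true trivial (hfd x y)⟩
    obtain ⟨b, hb, hN⟩ := hfin.finiteNumbering_eq n
    obtain ⟨h1, h2⟩ := hA.next_none_spec h hb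
    obtain ⟨h3, h4⟩ := hW.isWindow_of_le h a b (fun p q ha _ hp hq => by
      rcases hp.eq_or_lt with rfl | hp
      · exact h1 _ ha
      · exact h2 p q ha hp hq) (N := numbering n c (ncad r) a) (fun γ => by
        rw [numbering, if_pos hfin, hN]
        simp)
    exact windowNotation_singleton h.toIsPeriodicOrder h3 fun x => (h4 x).2 trivial
  · obtain ⟨P, s, hP⟩ := exists_isSeq hfin
    obtain ⟨F, σ, k, d, hF, htau, hσ, hdown, hne, -⟩ := hP.exists_orbit h hA
    have hst : tauStart n c (ncad r) a = .down := by
      by_contra hcon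
      -- A step to the right for r is an arrow ↓. Without it a whole period would move to the left,
      -- which is impossible in a waxing block.
      have hleft : ∀ i, r (F (i + 1)) (F i) := fun i => by
        obtain ⟨p, hp, -, h2, -⟩ := hF.exists_step h hA i
        by_contra hr
        have h3 := (h.not_iff hp.lt.ne').1 hr
        obtain ⟨h4, -, h5⟩ := hp.of_lt h hA h3
        exact hne hcon i (h2.2 ⟨h4, h5⟩)
      exact h.asymm (hF.add_lt_of_left h.toIsPeriodicOrder hleft) (h.wax_mul (hwax _) (hF.d_pos h hA))
    rw [hst] at hσ
    obtain ⟨p, -, -, hp, -⟩ := hF.exists_step h hA (-1)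
    obtain ⟨hL, htop⟩ := hp.1 hσ
    obtain rfl := hF.d_eq_one_of_down h hA ⟨_, hL⟩
    have hW : WaxingOrbit n c r F k := ⟨⟨hF.stepSeq h hA, hF.pos, fun i => by
      rw [hF.add, one_mul], htop⟩, hL, hwax, hfd⟩
    obtain ⟨γ₀, μ, t₀, hμ⟩ := hW.exists_leastChain h
    obtain ⟨h1, h2⟩ := hW.isWindow h hμ hst htau
    rw [if_pos (Or.inr (hdown.2 hst)), numbering, if_neg hfin]
    exact windowNotation_singleton h.toIsPeriodicOrder h1 h2

end

end AffineTITO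

namespace AffineTITO

/-! ### Sortable orders with a waning block -/

/-- On a waxing block contained in `Lbar c`, sequences are finite: the minimum of the chain cannot
increase. -/
theorem IsOrbit.not_forall_mem_L {n : ℕ} {c : Equiv.Perm ℤ} {r : ℤ → ℤ → Prop} {A : Set Arc}
    {F : ℤ → ℤ} {σ : ℤ → Letter} {k d : ℤ} {B : Set ℤ} (h : AvoidsPatterns n c r)
    (hA : IsSubdiagram n r A) (hF : IsOrbit n c A F σ k d) (hB : IsWaxing n r B)
    (hBL : B ⊆ Lbar c) (hAB : ∀ p q, HasArc (ncad r) p q → p ∈ B → HasArc A p q)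
    (hFB : ∀ i, F i ∈ B) : False := by
  have hch : ∀ i, ∃ γ m T, ChainData r γ m T ∧ F i ∈ γ := fun i => by
    obtain ⟨γ, h1, h2⟩ := exists_isArcChain_of_wax h (hB.wax _ (hFB i))
    obtain ⟨m, T, h3⟩ := exists_chainData h h1
    exact ⟨γ, m, T, h3, h2⟩
  choose γ m T hc hmem using hch
  -- Along an arc the chain does not change. At the end F i of a chain, the next point is reached by
  -- an arc p → F (i + 1) over F i. If the minimum increased, p would be over the old chain with
  -- color L, hence precede F i, whereas F i ≺ F (i + 1) ≺ p.
  have hle : ∀ i, m (i + 1) ≤ m i := fun i => by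
    obtain ⟨p, hs, -⟩ := hF.exists_step h hA i
    have ha := hasArc_ncad.2 (hA.arc hs.arc)
    have hcov := (hA.arc hs.arc).2
    have hp' := (hc (i + 1)).mem_of_arc' h ha (hmem (i + 1))
    have hpm := (hc (i + 1)).le p hp'
    rcases hs.le.eq_or_lt with e | e
    · have h1 := (hc i).eq_of_mem h (hc (i + 1)) (hmem i) (e ▸ hp')
      have h2 := (hc i).memm
      rw [h1] at h2
      rw [(hc (i + 1)).eq_m_of_bot h2 (hc i).bot]
    · have htop : F i = T i := (hc i).eq_T_of_top (hmem i) fun q hq =>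
        hs.out.elim (fun e' => e.ne e') fun H => H q (hAB _ _ hq (hFB i))
      by_contra hlt
      have hpγ : p ∉ γ i := fun H => by
        have h1 := ((hc i).le _ ((hc i).mem_of_arc h ha H)).2
        have := hs.lt
        omega
      have hpB : p ∈ B := (hB.arc h ha).2 (hFB _)
      have h1 := (hc i).lt_of_mem_L h hpγ (by omega) (by omega) (hBL hpB) (hmem i)
      have h2 := h.arc_L hcov e hs.lt (hBL (hFB i))
      exact h.asymm (h.trans _ _ _ h1 h2) hcov.1
  have hle' : ∀ l : ℕ, m (0 + l) ≤ m 0 := fun l => by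
    induction l with
    | zero => simp
    | succ l ih =>
      refine le_trans ?_ ih
      push_cast
      rw [← add_assoc]
      exact hle _
  obtain ⟨l, hl⟩ := Int.eq_ofNat_of_zero_le hF.pos.le
  have h1 := hle' l
  rw [show (l : ℤ) = k from hl.symm] at h1
  -- After a period the chain has been translated by d n > 0, so its minimum has increased.
  have h2 := (hc 0).tr h d
  have h3 : F (0 + k) ∈ (fun x => x + d * (n : ℤ)) '' γ 0 := ⟨F 0, hmem 0, (hF.add 0).symm⟩
  have h4 := h2.eq_of_mem h (hc (0 + k)) h3 (hmem _)
  have h5 := h2.memm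
  rw [h4] at h5
  have h6 := (hc (0 + k)).eq_m_of_bot h5 h2.bot
  have h7 : 0 < d * n := mul_pos (hF.d_pos h hA) (by have := h.pos; omega)
  omega

/-- On a waxing block contained in `Rbar c`, sequences are finite: they move to the left. -/
theorem IsOrbit.not_forall_mem_R {n : ℕ} {c : Equiv.Perm ℤ} {r : ℤ → ℤ → Prop} {A : Set Arc}
    {F : ℤ → ℤ} {σ : ℤ → Letter} {k d : ℤ} {B : Set ℤ} (h : AvoidsPatterns n c r)
    (hA : IsSubdiagram n r A) (hF : IsOrbit n c A F σ k d) (hB : IsWaxing n r B)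
    (hBR : B ⊆ Rbar c) (hFB : ∀ i, F i ∈ B) : False := by
  refine h.asymm (hF.add_lt_of_left h.toIsPeriodicOrder fun i => ?_)
    (h.wax_mul (hB.wax _ (hFB 0)) (hF.d_pos h hA))
  obtain ⟨p, hs, -⟩ := hF.exists_step h hA i
  exact hs.lt_of_mem_R h hA (hBR (hFB i))

namespace HasBlocks

variable {n : ℕ} {c : Equiv.Perm ℤ} {r : ℤ → ℤ → Prop} {L M R : Set ℤ} (h : AvoidsPatterns n c r)
  (H : HasBlocks n c r L M R)
include h H

omit h in
theorem isWaxing_L : IsWaxing n r L := ⟨H.waxL, H.fdL⟩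

omit h in
theorem isWaxing_R : IsWaxing n r R := ⟨H.waxR, H.fdR⟩

theorem mem_M_add (x j : ℤ) : x + j * n ∈ M ↔ x ∈ M := by
  have key : ∀ x j : ℤ, x ∈ M → x + j * n ∈ M := fun x j hx =>
    (H.fdM x hx _).2 (h.finiteDistance_tr h.pos x j)
  refine ⟨fun H' => ?_, key x j⟩
  have := key _ (-j) H'
  simpa using this

theorem not_mem_M_of_L {x : ℤ} (hx : x ∈ L) : x ∉ M := fun hx' => h.asymm (H.waxL x hx) (H.waneM x hx')

theorem not_mem_M_of_R {x : ℤ} (hx : x ∈ R) : x ∉ M := fun hx' => h.asymm (H.waxR x hx) (H.waneM x hx')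

theorem mem_M_of_lt {x y z : ℤ} (hx : x ∈ M) (hz : z ∈ M) (hxy : r x y) (hyz : r y z) : y ∈ M := by
  rcases H.cases y with hy | hy | hy
  · exact (h.asymm hxy (H.LM y hy x hx)).elim
  · exact hy
  · exact (h.asymm hyz (H.MR z hz y hy)).elim

theorem mem_M_of_arc {p q : ℤ} (ha : HasArc (ncad r) p q) : p ∈ M ↔ q ∈ M := by
  have hc := (hasArc_ncad.1 ha).2
  constructor
  · intro hp
    obtain ⟨u, hu, hf⟩ := h.exists_pred h.pos p
    rw [h.cover_left_unique hc hu]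
    exact (H.fdM p hp u).2 hf
  · intro hq
    obtain ⟨u, hu, hf⟩ := h.exists_succ h.pos q
    rw [h.cover_right_unique hc hu]
    exact (H.fdM q hq u).2 hf

theorem chain_subset_M {γ : Set ℤ} {m T x : ℤ} (hc : ChainData r γ m T) (hx : x ∈ γ) (hxM : x ∈ M) :
    γ ⊆ M := fun _ hy =>
  hc.forall_of_arc (Q := (· ∈ M)) (fun _ _ _ _ ha => H.mem_M_of_arc h ha) hx hy hxM

/-- The waning block contains an arc over `b` or starting from `b`. -/
theorem exists_arc (b : ℤ) : ∃ p q, HasArc (ncad r) p q ∧ p ≤ b ∧ b < q ∧ p ∈ M ∧ q ∈ M := by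
  obtain ⟨w, hw, -⟩ := H.ML
  obtain ⟨j, -, hj⟩ := exists_int_mul_lt h.pos w b
  obtain ⟨u, v, h1, h2, h3, h4, h5, -⟩ := h.exists_cover_of_wane (H.waneM w hw) (x := b)
    (h.finiteDistance_tr h.pos w (-j)) (by linarith)
  exact ⟨v, u, hasArc_ncad.2 ⟨by omega, h1⟩, h3, h2, (H.fdM w hw v).2 h5, (H.fdM w hw u).2 h4⟩

/-- With color L, the covering relation that ends at b would be a descent, hence an arc starting
from b. Consequently the sequence never meets ↓ in the waning block. -/
theorem mem_R_of_top {b : ℤ} (hb : b ∈ M) (ht : ∀ q, ¬ HasArc (ncad r) b q) : b ∈ Rbar c := by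
  rw [← h.col.not_mem_L]
  intro hL
  obtain ⟨u, hu, -⟩ := h.exists_pred h.pos b
  exact ht u (hasArc_ncad.2 ⟨h.lt_of_cover_of_wane hu (H.waneM b hb) (Or.inl hL), hu⟩)

theorem mem_L_of_bot {b : ℤ} (hb : b ∈ M) (ht : ∀ p, ¬ HasArc (ncad r) p b) : b ∈ Lbar c := by
  rw [← h.col.not_mem_R]
  intro hR
  obtain ⟨u, hu, hf⟩ := h.exists_succ h.pos b
  exact ht u (hasArc_ncad.2
    ⟨h.lt_of_cover_of_wane hu (H.waneM u ((H.fdM b hb u).2 hf)) (Or.inr hR), hu⟩)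

theorem not_seqFinite (a : ℤ) : ¬ SeqFinite c (ncad r) a := fun hfin => by
  obtain ⟨b, hb, -⟩ := hfin.finiteNumbering_eq n
  obtain ⟨h1, h2⟩ := h.toIsPeriodicOrder.isSubdiagram_ncad.next_none_spec h hb
  obtain ⟨p, q, ha, hp, hq, -⟩ := H.exists_arc h b
  rcases hp.eq_or_lt with rfl | hp
  · exact h1 _ ha
  · exact h2 p q ha hp hq

/-- From the middle and right blocks, a step does not lead to the left block. -/
theorem not_mem_L_of_step {b p b' : ℤ} (hs : Step c r (ncad r) b p b') (hb : b ∉ L) : b' ∉ L := by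
  intro hL
  have hp := (H.isWaxing_L.arc h hs.arc).2 hL
  rcases hs.le.eq_or_lt with e | e
  · exact hb (e ▸ hp)
  · have ht := hs.out.resolve_left e.ne
    have hbR : b ∈ Rbar c := by
      rcases H.cases b with h1 | h1 | h1
      · exact (hb h1).elim
      · exact H.mem_R_of_top h h1 ht
      · exact H.subR h1
    obtain ⟨u, v, ha, hu, hv, huM, hvM⟩ := H.exists_arc h b
    have hub : u ≠ b := fun e => ht _ (e ▸ ha)
    have h1 := H.LM b' hL v hvM
    rcases hs.closeR e hbR u v ha (by omega) hv with e' | e'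
    · exact H.not_mem_M_of_L h hL (e' ▸ hvM)
    · exact h.asymm h1 e'

theorem step_of_mem_M {b p b' : ℤ} (hs : Step c r (ncad r) b p b') (hb : b ∈ M) :
    b' ∈ M ∧ r b' b := by
  have hA := h.toIsPeriodicOrder.isSubdiagram_ncad
  rcases hs.le.eq_or_lt with e | e
  · exact ⟨(H.mem_M_of_arc h (e ▸ hs.arc)).1 hb, hs.lt_of_arc hA e⟩
  · have hlt := hs.lt_of_mem_R h hA (H.mem_R_of_top h hb (hs.out.resolve_left e.ne))
    refine ⟨?_, hlt⟩
    rcases H.cases b' with h1 | h1 | h1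
    · exact (H.not_mem_L_of_step h hs (fun h2 => H.not_mem_M_of_L h h2 hb) h1).elim
    · exact h1
    · exact (h.asymm hlt (H.MR b hb b' h1)).elim

/-- A periodic orbit that leaves the left block cannot return to it, so it would have to stay there
forever; the waxing blocks, of one color each, carry no orbit. Hence it meets the waning block,
which it does not leave. -/
theorem orbit_mem_M {F : ℤ → ℤ} {σ : ℤ → Letter} {k d : ℤ} (hF : IsOrbit n c (ncad r) F σ k d)
    (i : ℤ) : F i ∈ M := by
  have hA := h.toIsPeriodicOrder.isSubdiagram_ncad
  have hstep := fun i => hF.exists_step h hA i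
  have h1 : ∀ i, F i ∉ L := by
    by_contra! hex
    obtain ⟨i, hi⟩ := hex
    refine hF.not_forall_mem_L h hA H.isWaxing_L H.subL (fun p q ha _ => ha) fun j => ?_
    by_contra hj
    have := hF.mem_of_lt_periodic (X := Lᶜ) (fun x l => not_congr (H.isWaxing_L.tr h x l)) hj
      (fun i hi => H.not_mem_L_of_step h (hstep i).choose_spec.1 hi) i
    exact this hi
  have h2 : ∃ i, F i ∈ M := by
    by_contra! hex
    exact hF.not_forall_mem_R h hA H.isWaxing_R H.subR fun j =>
      ((H.cases (F j)).resolve_left (h1 j)).resolve_left (hex j)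
  obtain ⟨j, hj⟩ := h2
  exact hF.mem_of_lt_periodic (X := M) (H.mem_M_add h) hj
    (fun i hi => (H.step_of_mem_M h (hstep i).choose_spec.1 hi).1) i

end HasBlocks

section

variable {n : ℕ} {c : Equiv.Perm ℤ} {r : ℤ → ℤ → Prop} (h : AvoidsPatterns n c r)
  {B X : Set ℤ} {a : ℤ}
include h

/-- The window of a waxing block `B` whose chains are the kept chains. -/
theorem isWindow_kept (hB : IsWaxing n r B) (hBX : B ⊆ Lbar c ∨ B ⊆ Rbar c)
    (hkept : ∀ γ, γ ∈ keptChains n c (ncad r) a X ↔ IsArcChain (ncad r) γ ∧ γ ⊆ B) {N : Set (Set ℤ)}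
    (hN : N = keptChains n c (ncad r) a X ∩
      finiteNumbering n c (subdiagram n c (ncad r) a X) a) :
    IsWindow n r .waxing (windowOf n c (ncad r) a N) ∧
      ∀ x, InBlock n (windowOf n c (ncad r) a N) x ↔ x ∈ B := by
  have hA := h.toIsPeriodicOrder.isSubdiagram_ncad
  have harc : ∀ {p q}, HasArc (subdiagram n c (ncad r) a X) p q ↔ HasArc (ncad r) p q ∧ p ∈ B := by
    intro p q
    constructor
    · rintro ⟨α, ⟨h1, γ, hγ, hp, -⟩, rfl, rfl⟩
      exact ⟨⟨α, h1, rfl, rfl⟩, ((hkept γ).1 hγ).2 hp⟩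
    · rintro ⟨⟨α, h1, rfl, rfl⟩, hp⟩
      obtain ⟨γ, hγ, hpγ⟩ := exists_isArcChain_of_wax h (hB.wax _ hp)
      obtain ⟨m, T, hc⟩ := exists_chainData h hγ
      exact ⟨α, ⟨h1, γ, (hkept γ).2 ⟨hγ, hB.chain_subset h hc hpγ hp⟩, hpγ,
        hc.mem_of_arc h ⟨α, h1, rfl, rfl⟩ hpγ⟩, rfl, rfl⟩
  have hAB : IsSubdiagram n r (subdiagram n c (ncad r) a X) :=
    ⟨fun ha => hA.arc (harc.1 ha).1, fun k {p q} => by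
      rw [harc, harc, hA.tr, hB.tr h]⟩
  -- Even if a is not in B, the points of an orbit are final points of arcs of the subdiagram, hence
  -- belong to B.
  have hfin : SeqFinite c (subdiagram n c (ncad r) a X) a := by
    by_contra hfin
    obtain ⟨P, s, hP⟩ := exists_isSeq hfin
    obtain ⟨F, σ, k, d, hF, -⟩ := hP.exists_orbit h hAB
    have hFB : ∀ i, F i ∈ B := fun i => by
      obtain ⟨p, hs, -⟩ := hF.exists_step h hAB (i - 1)
      have ha := harc.1 hs.arc
      have := (hB.arc h ha.1).1 ha.2
      rwa [sub_add_cancel] at this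
    rcases hBX with hBL | hBR
    · exact hF.not_forall_mem_L h hAB hB hBL (fun p q ha hp => harc.2 ⟨ha, hp⟩) hFB
    · exact hF.not_forall_mem_R h hAB hB hBR hFB
  obtain ⟨b, hb, hbN⟩ := hfin.finiteNumbering_eq n
  obtain ⟨h1, h2⟩ := hAB.next_none_spec h hb
  refine hB.isWindow_of_le h a b (fun p q ha hpB hp hq => ?_) fun γ => ?_
  · rcases hp.eq_or_lt with rfl | hp
    · exact h1 _ (harc.2 ⟨ha, hpB⟩)
    · exact h2 p q (harc.2 ⟨ha, hpB⟩) hp hq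
  · rw [hN, Set.mem_inter_iff, hkept, hbN]
    constructor
    · rintro ⟨⟨h3, h4⟩, -, h5⟩
      exact ⟨h3, h4, h5⟩
    · rintro ⟨h3, h4, h5⟩
      refine ⟨⟨h3, h4⟩, ?_, h5⟩
      obtain ⟨l, hl, h6, h7, h8, rfl⟩ := h3
      refine ⟨l, hl, ?_, fun x hx => h7 x (harc.1 hx).1, fun x hx => h8 x (harc.1 hx).1, rfl⟩
      exact h6.imp_of_mem_imp fun x y hx _ hxy => harc.2 ⟨hxy, h4 hx⟩

end

end AffineTITO

/-! ### The window of the waning block -/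

namespace AffineTITO

namespace HasBlocks

variable {n : ℕ} {c : Equiv.Perm ℤ} {r : ℤ → ℤ → Prop} {L M R : Set ℤ} (h : AvoidsPatterns n c r)
  (H : HasBlocks n c r L M R)
include h H

/-- In the waning block, the sequence goes from the end of a chain to the chain that precedes it. -/
theorem step_pred {b p b' u : ℤ} (hs : Step c r (ncad r) b p b') (hb : b ∈ M)
    (ht : ∀ q, ¬ HasArc (ncad r) b q) (hu : CoverRel r u b) :
    ∃ γ m T, ChainData r γ m T ∧ u ∈ γ ∧ b' ∈ γ := by
  have hA := h.toIsPeriodicOrder.isSubdiagram_ncad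
  have hub : u < b := by
    by_contra hlt
    have := h.ne hu.1
    exact ht u (hasArc_ncad.2 ⟨by omega, hu⟩)
  have huM : u ∈ M := by
    obtain ⟨v, hv, hf⟩ := h.exists_pred h.pos b
    rw [h.cover_left_unique hu hv]
    exact (H.fdM b hb v).2 hf
  have hubot : ∀ x, ¬ HasArc (ncad r) x u := fun x hx => by
    have h1 := hasArc_ncad.1 hx
    have := h.cover_right_unique h1.2 hu
    omega
  obtain ⟨γ, hγ, huγ⟩ := exists_isArcChain h u fun f hf e => by
    have := hf (-1)
    rw [show (-1 : ℤ) + 1 = 0 by norm_num, e] at this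
    exact hubot _ this
  obtain ⟨m, T, hc⟩ := exists_chainData h hγ
  obtain rfl := hc.eq_m_of_bot huγ hubot
  have hbγ : b ∉ γ := fun hbγ => by
    rcases ((hc.mem_iff b).1 hbγ).2 with e | e
    · omega
    · exact h.asymm hu.1 e
  have hTM := H.chain_subset_M h hc huγ huM hc.memT
  have hTb : r T b := by
    rcases ((hc.mem_iff u).1 huγ).1 with e | e
    · exact e ▸ hu.1
    · exact h.trans _ _ _ e hu.1
  -- If T < b, the point T of color R and a smaller translate of it give T ≺ b ≺ T - j n, a
  -- forbidden pattern.
  have hlt : b < T := by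
    by_contra hle
    have hne : T ≠ b := fun e => hbγ (e ▸ hc.memT)
    -- a small translate of `T` is to the right of `b`
    have key : ∃ j : ℤ, 0 < j ∧ r b (T - j * n) := by
      have h1 : ¬ Far n r (T) b := fun hf =>
        IsPeriodicOrder.Far.not_finiteDistance h.toIsPeriodicOrder h.pos hf ((H.fdM T hTM b).1 hb)
      unfold Far at h1
      push Not at h1
      obtain ⟨i, hi⟩ := h1
      refine ⟨|i| + 1, by positivity, ?_⟩
      have h2 := h.wane_mul (x := T - (|i| + 1) * n) (k := i + (|i| + 1))
        (by
          have := (H.mem_M_add h T (-(|i| + 1))).2 hTM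
          rw [neg_mul, ← sub_eq_add_neg] at this
          exact H.waneM _ this) (by have := neg_abs_le i; omega)
      rw [show T - (|i| + 1) * n + (i + (|i| + 1)) * n = T + i * n by ring] at h2
      by_cases e : T + i * n = b
      · rwa [e] at h2
      · exact h.trans _ _ _ ((h.not_iff e).1 hi) h2
    obtain ⟨j, hj, hbj⟩ := key
    have hjn : 0 < j * n := mul_pos hj (by have := h.pos; omega)
    exact h.jki (i := T - j * n) (by omega) (by omega) (H.mem_R_of_top h hTM hc.top) hTb hbj
  have hpb : p ≠ b := fun e => ht _ (e ▸ hs.arc)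
  have hle := hs.le
  have hbR := H.mem_R_of_top h hb ht
  have hb'u : b' = u ∨ r b' u := h.le_cover hu (hs.lt_of_mem_R h hA hbR)
  obtain ⟨p', hp', q', hq', ha, h1, h2⟩ := hc.exists_arc hub.le hlt
  have hp'b : p' ≠ b := fun e => hbγ (e ▸ hp')
  refine ⟨γ, u, T, hc, huγ, (hc.mem_iff b').2 ⟨?_, hb'u⟩⟩
  have hTq := ((hc.mem_iff q').1 hq').1
  rcases hs.closeR (by omega) hbR p' q' ha (by omega) h2 with e | e
  · rwa [e] at hTq
  · rcases hTq with rfl | hTq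
    · exact Or.inr e
    · exact Or.inr (h.trans _ _ _ hTq e)

variable {F : ℤ → ℤ} {σ : ℤ → Letter} {k d : ℤ} (hF : IsOrbit n c (ncad r) F σ k d)
include hF

theorem orbit_lt {i j : ℤ} (hij : i < j) : r (F j) (F i) := by
  have hA := h.toIsPeriodicOrder.isSubdiagram_ncad
  induction j, hij using Int.leInduction with
  | base =>
    obtain ⟨p, hs, -⟩ := hF.exists_step h hA i
    exact (H.step_of_mem_M h hs (H.orbit_mem_M h hF i)).2
  | succ j hj ih =>
    obtain ⟨p, hs, -⟩ := hF.exists_step h hA j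
    exact h.trans _ _ _ (H.step_of_mem_M h hs (H.orbit_mem_M h hF j)).2 ih

theorem orbit_le {i j : ℤ} (hij : i ≤ j) : F j = F i ∨ r (F j) (F i) := by
  rcases hij.eq_or_lt with rfl | hij
  · exact Or.inl rfl
  · exact Or.inr (H.orbit_lt h hF hij)

/-- The orbit stays at finite distance of x in a waning block and drifts by d n > 0 in each period,
so it ends up before x. -/
theorem exists_orbit_lt {x : ℤ} (hx : x ∈ M) : ∃ i, r (F i) x := by
  have hA := h.toIsPeriodicOrder.isSubdiagram_ncad
  have h1 : ¬ Far n r x (F 0) := fun hf =>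
    IsPeriodicOrder.Far.not_finiteDistance h.toIsPeriodicOrder h.pos hf ((H.fdM x hx _).1 (H.orbit_mem_M h hF 0))
  unfold Far at h1
  push Not at h1
  obtain ⟨i, hi⟩ := h1
  have hd := hF.d_pos h hA
  refine ⟨0 + (|i| + 1) * k, ?_⟩
  rw [hF.add_mul]
  have hw := H.waneM (F 0 + -i * n) ((H.mem_M_add h _ _).2 (H.orbit_mem_M h hF 0))
  have h2 : 0 < i + (|i| + 1) * d := by
    have := neg_abs_le i
    have : (|i| + 1) * 1 ≤ (|i| + 1) * d := mul_le_mul_of_nonneg_left (by omega) (by positivity)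
    omega
  have h3 := h.wane_mul hw h2
  rw [show F 0 + -i * n + (i + (|i| + 1) * d) * n = F 0 + (|i| + 1) * d * n by ring] at h3
  have h4 := (not_congr (h.tr (-i) (x + i * n) (F 0))).2 hi
  rw [show x + i * n + -i * n = x by ring] at h4
  by_cases e : x = F 0 + -i * n
  · rwa [e]
  · exact h.trans _ _ _ h3 ((h.not_iff e).1 h4)

theorem exists_orbit_gt {x : ℤ} (hx : x ∈ M) : ∃ i, r x (F i) := by
  have hA := h.toIsPeriodicOrder.isSubdiagram_ncad
  have h1 : ¬ Far n r (F 0) x := fun hf =>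
    IsPeriodicOrder.Far.not_finiteDistance h.toIsPeriodicOrder h.pos hf ((H.fdM _ (H.orbit_mem_M h hF 0) x).1 hx)
  unfold Far at h1
  push Not at h1
  obtain ⟨i, hi⟩ := h1
  have hd := hF.d_pos h hA
  refine ⟨0 + -(|i| + 1) * k, ?_⟩
  rw [hF.add_mul]
  have hw := H.waneM (F 0 + -(|i| + 1) * d * n)
    ((H.mem_M_add h _ _).2 (H.orbit_mem_M h hF 0))
  have h2 : 0 < i + (|i| + 1) * d := by
    have := neg_abs_le i
    have : (|i| + 1) * 1 ≤ (|i| + 1) * d := mul_le_mul_of_nonneg_left (by omega) (by positivity)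
    omega
  have h3 := h.wane_mul hw h2
  rw [show F 0 + -(|i| + 1) * d * n + (i + (|i| + 1) * d) * n = F 0 + i * n by ring] at h3
  by_cases e : F 0 + i * n = x
  · rwa [e] at h3
  · exact h.trans _ _ _ ((h.not_iff e).1 hi) h3

/-- The sequence visits all the chains of the waning block. -/
theorem top_mem_range {x : ℤ} (hx : x ∈ M) (ht : ∀ q, ¬ HasArc (ncad r) x q) :
    x ∈ Set.range F := by
  have hA := h.toIsPeriodicOrder.isSubdiagram_ncad
  by_contra hxO
  obtain ⟨i, hi⟩ := H.exists_orbit_gt h hF hx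
  obtain ⟨j, hj⟩ := H.exists_orbit_lt h hF hx
  have hij : i ≤ j := by
    by_contra hlt
    exact h.asymm (h.trans _ _ _ hj hi) (H.orbit_lt h hF (by omega))
  obtain ⟨t, -, -, ht1, ht2⟩ := exists_int_switch (P := fun t => r x (F t)) hij hi
    (fun H' => h.asymm hj H')
  have h1 : r (F (t + 1)) x := (h.not_iff fun e => hxO ⟨_, e.symm⟩).1 ht2
  -- The step jumps over x. An arc is a covering relation and cannot do so; a vertical arrow lands
  -- in the immediately preceding chain, so x is in this chain, and as its end it comes no later
  -- than the landing point.
  obtain ⟨p, hs, -⟩ := hF.exists_step h hA t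
  have htM := H.orbit_mem_M h hF t
  rcases hs.out with e | e
  · have := (hA.arc hs.arc).2.2 x
    rw [e] at this
    exact this ⟨h1, ht1⟩
  · obtain ⟨u, hu, -⟩ := h.exists_pred h.pos (F t)
    obtain ⟨γ, m, T, hc, huγ, hγ⟩ := H.step_pred h hs htM e hu
    have hxu : x = u ∨ r x u := h.le_cover hu ht1
    have hxγ : x ∈ γ := (hc.mem_iff x).2 ⟨by
        rcases ((hc.mem_iff _).1 hγ).1 with e' | e'
        · exact Or.inr (e' ▸ h1)
        · exact Or.inr (h.trans _ _ _ e' h1), by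
        rcases hxu with rfl | hxu
        · exact ((hc.mem_iff _).1 huγ).2
        · rcases ((hc.mem_iff _).1 huγ).2 with e' | e'
          · exact Or.inr (e' ▸ hxu)
          · exact Or.inr (h.trans _ _ _ hxu e')⟩
    obtain rfl := hc.eq_T_of_top hxγ ht
    rcases ((hc.mem_iff _).1 hγ).1 with e' | e'
    · exact hxO ⟨_, e'⟩
    · exact h.asymm h1 e'

variable {a : ℤ} (htau : tauInts n c (ncad r) a = F '' Set.Ico 0 k)
include htau

/-- The window of the waning block when it consists of chains. -/
theorem isWindow_of_top (ht : ∀ q, ¬ HasArc (ncad r) (F (-1)) q) :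
    IsWindow n r .waning (windowOf n c (ncad r) a (middleNumbering n c (ncad r) a)) ∧
      ∀ x, InBlock n (windowOf n c (ncad r) a (middleNumbering n c (ncad r) a)) x ↔ x ∈ M := by
  have hA := h.toIsPeriodicOrder.isSubdiagram_ncad
  have hbM := H.orbit_mem_M h hF (-1)
  -- The translate of F (-1) by n is also the end of a chain, so the orbit visits it, and the
  -- displacement is n.
  obtain ⟨j, hj⟩ := H.top_mem_range h hF (x := F (-1) + 1 * n) ((H.mem_M_add h _ _).2 hbM)
    fun q hq => ht (q - 1 * n) ((hA.tr 1).1 (by simpa using hq))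
  obtain rfl := hF.d_eq_one_of_mem h hA (i := j) (j := -1) (by rw [hj, one_mul])
  have hT : TopOrbit n c r F k :=
    ⟨hF.stepSeq h hA, hF.pos, fun i => by rw [hF.add, one_mul], ht⟩
  have hlast : F (k - 1) = F (-1) + n := hT.last
  have hk := hT.pos
  have hmid := hT.mem_middleNumbering h htau
  -- The union of the chains is the half-open interval of r from F (k - 1) = F (-1) + n, included,
  -- to F (-1), excluded.
  have hU : ∀ x, x ∈ ⋃₀ middleNumbering n c (ncad r) a ↔
      x ∈ M ∧ (x = F (k - 1) ∨ r (F (k - 1)) x) ∧ r x (F (-1)) := by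
    intro x
    constructor
    · rintro ⟨γ, hγ, hx⟩
      obtain ⟨-, m, t, hc, ht0, htk⟩ := (hmid γ).1 hγ
      refine ⟨H.chain_subset_M h hc hc.memT (H.orbit_mem_M h hF t) hx, ?_, ?_⟩
      · have h1 := H.orbit_le h hF (show t ≤ k - 1 by omega)
        rcases ((hc.mem_iff x).1 hx).1 with rfl | h2
        · exact h1.imp Eq.symm id
        · rcases h1 with e | e
          · exact Or.inr (e ▸ h2)
          · exact Or.inr (h.trans _ _ _ e h2)
      · have h1 := H.orbit_lt h hF (show -1 < t by omega)
        refine hc.all_lt_of_lt h (fun hm => ?_) hc.memT h1 hx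
        rw [hc.eq_T_of_top hm ht] at h1
        exact h.irrefl _ h1
    · rintro ⟨hxM, h1, h2⟩
      obtain ⟨γ, hγ, hx⟩ := exists_isArcChain h x fun f hf e => by
        have h3 := (h.loop_wane hf 0).2 (F (-1)) ((H.fdM _ (e ▸ hxM) _).1 hbM)
        obtain ⟨l, hl⟩ := h3
        exact ht _ (hl ▸ hf l)
      obtain ⟨m, T, hc⟩ := exists_chainData h hγ
      obtain ⟨t, rfl⟩ := H.top_mem_range h hF (H.chain_subset_M h hc hx hxM hc.memT) hc.top
      have ht0 : -1 < t := by
        by_contra hle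
        have h3 : r (F t) (F (-1)) := by
          rcases ((hc.mem_iff x).1 hx).1 with e | e
          · exact e ▸ h2
          · exact h.trans _ _ _ e h2
        rcases H.orbit_le h hF (show t ≤ -1 by omega) with e | e
        · exact h.irrefl _ (e ▸ h3)
        · exact h.asymm e h3
      have htk : t < k := by
        by_contra hle
        have h3 := H.orbit_lt h hF (show k - 1 < t by omega)
        have h4 : F (k - 1) ∈ γ := (hc.mem_iff _).2 ⟨Or.inr h3, by
          rcases ((hc.mem_iff x).1 hx).2 with e | e <;> rcases h1 with e' | e'
          · exact Or.inl (e'.symm.trans e)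
          · exact Or.inr (e ▸ e')
          · exact Or.inr (e' ▸ e)
          · exact Or.inr (h.trans _ _ _ e' e)⟩
        rw [hc.eq_T_of_top h4 (hT.last_top' h)] at h3
        exact h.irrefl _ h3
      exact ⟨γ, (hmid γ).2 ⟨hγ, m, t, hc, by omega, htk⟩, hx⟩
  have hfin : (⋃₀ middleNumbering n c (ncad r) a).Finite := by
    refine ((h.finite_wane h.pos (F (-1)) 1).insert (F (k - 1))).subset fun x hx => ?_
    obtain ⟨-, h1, h2⟩ := (hU x).1 hx
    rcases h1 with e | e
    · exact Or.inl e
    · refine Or.inr ⟨?_, h2⟩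
      rw [hlast] at e
      simpa using e
  obtain ⟨hw, hmem⟩ := windowOf_spec h a (fun γ hγ => ((hmid γ).1 hγ).1) hfin (by
    intro x hx z hz y hxy hyz
    obtain ⟨hx1, hx2, -⟩ := (hU x).1 hx
    obtain ⟨hz1, -, hz2⟩ := (hU z).1 hz
    refine (hU y).2 ⟨H.mem_M_of_lt h hx1 hz1 hxy hyz, Or.inr ?_, h.trans _ _ _ hyz hz2⟩
    rcases hx2 with rfl | hx2
    · exact hxy
    · exact h.trans _ _ _ hx2 hxy)
  refine ⟨⟨hw, fun u hu v hv => ?_⟩, fun x => ⟨?_, fun hx => ?_⟩⟩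
  · have hu' := ((hU u).1 ((hmem u).1 hu)).2.2
    have hv' := ((hU v).1 ((hmem v).1 hv)).2.1
    have h1 : r (u + n) (F (k - 1)) := by
      rw [hlast]
      have := (h.tr 1 _ _).2 hu'
      rwa [one_mul] at this
    rcases hv' with rfl | hv'
    · exact h1
    · exact h.trans _ _ _ h1 hv'
  · rintro ⟨y, hy, e⟩
    obtain ⟨l, rfl⟩ := exists_eq_add_mul e.symm
    exact (H.mem_M_add h _ _).2 ((hU y).1 ((hmem y).1 hy)).1
  · obtain ⟨i, hi⟩ := H.exists_orbit_gt h hF hx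
    obtain ⟨j, hj⟩ := H.exists_orbit_lt h hF hx
    -- the first translate of `x` that precedes `F (-1)`
    have hex1 : ∃ l : ℤ, r x (F (-1) + l * n) := by
      obtain ⟨l, t, h1, h2, h3, h4⟩ := hT.exists_period i
      refine ⟨l, ?_⟩
      have h5 := (h.tr l _ _).2 (H.orbit_lt h hF (show -1 < t by omega))
      rw [← h4] at h5
      exact h.trans _ _ _ hi h5
    have hex2 : ∃ l : ℤ, r (F (-1) + l * n) x := by
      obtain ⟨l, t, h1, h2, h3, h4⟩ := hT.exists_period j
      refine ⟨l + 1, ?_⟩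
      have h5 := H.orbit_le h hF (show t ≤ k - 1 by omega)
      have e : F (-1) + (l + 1) * n = F (k - 1) + l * n := by rw [hlast]; ring
      rw [e]
      rcases h5 with h5 | h5
      · rwa [h5, ← h4]
      · have h6 := (h.tr l _ _).2 h5
        rw [← h4] at h6
        exact h.trans _ _ _ h6 hj
    obtain ⟨l₁, hl₁⟩ := hex1
    obtain ⟨l₂, hl₂⟩ := hex2
    have hmono : ∀ {i j : ℤ}, i < j → r (F (-1) + j * n) (F (-1) + i * n) := fun {i j} hij => by
      have := h.wane_mul (H.waneM _ ((H.mem_M_add h _ i).2 hbM)) (show 0 < j - i by omega)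
      rwa [show F (-1) + i * n + (j - i) * n = F (-1) + j * n by ring] at this
    have hl : l₁ ≤ l₂ := by
      by_contra hlt
      exact h.asymm (h.trans _ _ _ hl₂ hl₁) (hmono (by omega))
    obtain ⟨l, -, -, h1, h2⟩ := exists_int_switch (P := fun l => r x (F (-1) + l * n)) hl hl₁
      (fun H' => h.asymm hl₂ H')
    refine ⟨x + (-l) * n, (hmem _).2 ((hU _).2 ⟨(H.mem_M_add h _ _).2 hx, ?_, ?_⟩), by
      simp [Int.ModEq]⟩
    · by_cases e : x = F (-1) + (l + 1) * n
      · left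
        rw [hlast, e]; ring
      · right
        rw [hlast]
        have := (h.tr (-l) _ _).2 ((h.not_iff e).1 h2)
        rwa [show F (-1) + (l + 1) * n + -l * n = F (-1) + n by ring] at this
    · have := (h.tr (-l) _ _).2 h1
      rwa [show F (-1) + l * n + -l * n = F (-1) by ring] at this

/-- The window of the waning block when it consists of a loop. -/
theorem isWindow_of_loop (hloop : ∀ i, HasArc (ncad r) (F i) (F (i + 1))) :
    IsWindow n r .waning (windowOf n c (ncad r) a (middleNumbering n c (ncad r) a)) ∧
      ∀ x, InBlock n (windowOf n c (ncad r) a (middleNumbering n c (ncad r) a)) x ↔ x ∈ M := by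
  classical
  have hA := h.toIsPeriodicOrder.isSubdiagram_ncad
  have hS := hF.stepSeq h hA
  have hM : M = Set.range F := by
    ext x
    constructor
    · intro hx
      exact (h.loop_wane hloop 0).2 x ((H.fdM _ (H.orbit_mem_M h hF 0) x).1 hx)
    · rintro ⟨i, rfl⟩
      exact H.orbit_mem_M h hF i
  have hN : middleNumbering n c (ncad r) a = {M} := by
    ext γ
    unfold middleNumbering
    rw [Set.mem_ofPred_eq, Set.mem_singleton_iff, htau]
    constructor
    · rintro ⟨hγ | ⟨f, hf, rfl⟩, x, hx, i, -, rfl⟩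
      · obtain ⟨m, T, hc⟩ := exists_chainData h hγ
        have hT := H.chain_subset_M h hc hx (H.orbit_mem_M h hF i) hc.memT
        rw [hM] at hT
        obtain ⟨j, rfl⟩ := hT
        exact (hc.top _ (hloop j)).elim
      · obtain ⟨j, hj⟩ := hx
        have hfM : ∀ l, f l ∈ M := by
          have hjM : f j ∈ M := hj ▸ H.orbit_mem_M h hF i
          intro l
          have h1 := fun l => H.mem_M_of_arc h (hf l)
          have h2 : ∀ l, f l ∈ M ↔ f 0 ∈ M := fun l => by
            induction l using Int.induction_on with
            | zero => rfl
            | succ l ih => rw [← h1, ih]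
            | pred l ih =>
              rw [← ih, h1, sub_add_cancel]
          exact (h2 l).2 ((h2 j).1 hjM)
        refine Set.Subset.antisymm ?_ ?_
        · rintro _ ⟨l, rfl⟩
          exact hfM l
        · intro x hx
          exact (h.loop_wane hf 0).2 x ((H.fdM _ (hfM 0) x).1 hx)
    · rintro rfl
      refine ⟨Or.inr ⟨F, hloop, hM⟩, F 0, H.orbit_mem_M h hF 0, 0, ⟨le_rfl, hF.pos⟩, rfl⟩
  -- The choice operator is evaluated on a family with a single, unhidden element.
  have hsel : select c (ncad r) {M} = M := by
    have hun : M ∈ unhidden c (ncad r) {M} := ⟨rfl, fun γ hγ hne => (hne hγ).elim⟩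
    have : select c (ncad r) {M} ∈ unhidden c (ncad r) {M} ∧
        ∀ γ' ∈ unhidden c (ncad r) {M}, maxOf (ncad r) (select c (ncad r) {M}) ≤ maxOf (ncad r) γ' :=
      Classical.epsilon_spec (p := fun γ => γ ∈ unhidden c (ncad r) {M} ∧
        ∀ γ' ∈ unhidden c (ncad r) {M}, maxOf (ncad r) γ ≤ maxOf (ncad r) γ')
        ⟨M, hun, fun γ' hγ' => by rw [show γ' = M from hγ'.1]⟩
    exact this.1.1
  have hinf : ¬ M.Finite := IsPeriodicOrder.infinite_of_closed h.pos (x := F 0) fun l =>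
    (H.mem_M_add h _ _).2 (H.orbit_mem_M h hF 0)
  have hfin : (M ∩ Set.Ioc (a - n) a).Finite := (Set.finite_Ioc _ _).inter_of_right _
  have hw : windowOf n c (ncad r) a (middleNumbering n c (ncad r) a) =
      hfin.toFinset.sort (· ≥ ·) := by
    unfold windowOf
    rw [hN, Set.ncard_singleton, selectList, selectList, hsel, List.flatMap_cons, List.flatMap_nil,
      List.append_nil, supportWord, if_neg hinf, descending, dif_pos hfin]
  have hmem : ∀ x, x ∈ hfin.toFinset.sort (· ≥ ·) ↔ x ∈ M ∩ Set.Ioc (a - n) a := fun x => by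
    rw [Finset.mem_sort, Set.Finite.mem_toFinset]
  have hanti : ∀ x ∈ M, ∀ y ∈ M, y < x → r x y := by
    rw [hM]
    rintro _ ⟨i, rfl⟩ _ ⟨j, rfl⟩ hlt
    exact H.orbit_lt h hF (hS.strictMono.lt_iff_lt.1 hlt)
  rw [hw]
  refine ⟨⟨?_, fun u hu v hv => ?_⟩, fun x => ⟨?_, fun hx => ?_⟩⟩
  · have h1 := (Finset.pairwise_sort hfin.toFinset (· ≥ ·)).and (Finset.sort_nodup _ _)
    refine List.Pairwise.imp_of_mem (fun hx hy hxy => ?_) h1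
    exact hanti _ ((hmem _).1 hx).1 _ ((hmem _).1 hy).1 (lt_of_le_of_ne hxy.1 (Ne.symm hxy.2))
  · obtain ⟨hu1, hu2⟩ := (hmem u).1 hu
    obtain ⟨hv1, hv2⟩ := (hmem v).1 hv
    refine hanti _ ?_ _ hv1 (by linarith [hu2.1, hv2.2])
    have := (H.mem_M_add h u 1).2 hu1
    rwa [one_mul] at this
  · rintro ⟨y, hy, e⟩
    obtain ⟨l, rfl⟩ := exists_eq_add_mul e.symm
    exact (H.mem_M_add h _ _).2 ((hmem y).1 hy).1
  · have hn : (0 : ℤ) < n := by have := h.pos; omega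
    have h1 := Int.emod_add_mul_ediv (a - x) n
    have h2 := Int.emod_nonneg (a - x) hn.ne'
    have h3 := Int.emod_lt_of_pos (a - x) hn
    -- The translate of x in ]a - n, a], obtained by Euclidean division of a - x.
    refine ⟨x + (a - x) / n * n, (hmem _).2 ⟨(H.mem_M_add h _ _).2 hx, ?_, ?_⟩, by simp [Int.ModEq]⟩
    · linarith
    · linarith

end HasBlocks

/-! ### The map `tito` is a left inverse of `ncad` -/

section

variable {n : ℕ} {c : Equiv.Perm ℤ} {r : ℤ → ℤ → Prop} (h : AvoidsPatterns n c r)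
include h

theorem tito_ncad_of_hasBlocks {L M R : Set ℤ} (H : HasBlocks n c r L M R) (a : ℤ) :
    tito n c a (ncad r) = r := by
  have hA := h.toIsPeriodicOrder.isSubdiagram_ncad
  have hfin := H.not_seqFinite h a
  obtain ⟨P, s, hP⟩ := exists_isSeq hfin
  obtain ⟨F, σ, k, d, hF, htau, hσ, hdown, -, hright⟩ := hP.exists_orbit h hA
  have hFM := H.orbit_mem_M h hF
  obtain ⟨p, hs, h1, h2, h3⟩ := hF.exists_step h hA (-1)
  have hst : tauStart n c (ncad r) a ≠ .down := fun e => by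
    obtain ⟨h4, h5⟩ := h2.1 (hσ.trans e)
    exact not_L_and_R h4 (H.mem_R_of_top h (hFM _) h5)
  have hmidM : ∀ γ ∈ middleNumbering n c (ncad r) a, (γ ∩ M).Nonempty := by
    rintro γ ⟨-, x, hx, hx'⟩
    rw [htau] at hx'
    obtain ⟨i, -, rfl⟩ := hx'
    exact ⟨_, hx, hFM i⟩
  have hmid : IsWindow n r .waning (windowOf n c (ncad r) a (middleNumbering n c (ncad r) a)) ∧
      ∀ x, InBlock n (windowOf n c (ncad r) a (middleNumbering n c (ncad r) a)) x ↔ x ∈ M := by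
    rcases tauStart_cases (n := n) (c := c) (A := ncad r) (a := a) with ⟨e, -⟩ | ⟨e, -⟩ | ⟨e, -⟩
    · exact (hst e).elim
    · exact H.isWindow_of_top h hF htau (h3.1 (hσ.trans e)).2
    · refine H.isWindow_of_loop h hF htau fun i => ?_
      obtain ⟨p, -, h4, -⟩ := hF.exists_step h hA i
      exact h4.1 (hright e i)
  -- Chains of a waxing block have no translate that meets τ_a, since τ_a lies in M. Conversely a
  -- chain of color L is not in M, whose chains end with color R, and a chain of color R is not in
  -- M, whose chains begin with color L.
  have hkept : ∀ {B X : Set ℤ}, IsWaxing n r B → (∀ x ∈ B, x ∉ M) → B ⊆ X →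
      (∀ γ, IsArcChain (ncad r) γ → γ ⊆ X → γ ⊆ B) → ∀ γ, γ ∈ keptChains n c (ncad r) a X ↔
        IsArcChain (ncad r) γ ∧ γ ⊆ B := by
    intro B X hB hBM hBX hX γ
    refine ⟨fun hγ => ⟨hγ.1, hX γ hγ.1 hγ.2.1⟩, fun hγ => ⟨hγ.1, hγ.2.trans hBX, fun l hl => ?_⟩⟩
    obtain ⟨_, ⟨x, hx, rfl⟩, hxM⟩ := hmidM _ hl
    exact hBM _ ((hB.tr h x l).2 (hγ.2 hx)) hxM
  have hkeptL := hkept H.isWaxing_L (fun x hx => H.not_mem_M_of_L h hx) H.subL fun γ hγ hsub => by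
    obtain ⟨m, T, hc⟩ := exists_chainData h hγ
    rcases H.cases T with hT | hT | hT
    · exact H.isWaxing_L.chain_subset h hc hc.memT hT
    · exact (not_L_and_R (hsub hc.memT) (H.mem_R_of_top h hT hc.top)).elim
    · exact (not_L_and_R (hsub hc.memT) (H.subR hT)).elim
  have hkeptR := hkept H.isWaxing_R (fun x hx => H.not_mem_M_of_R h hx) H.subR fun γ hγ hsub => by
    obtain ⟨m, T, hc⟩ := exists_chainData h hγ
    rcases H.cases m with hT | hT | hT
    · exact (not_L_and_R (H.subL hT) (hsub hc.memm)).elim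
    · exact (not_L_and_R (H.mem_L_of_bot h hT hc.bot) (hsub hc.memm)).elim
    · exact H.isWaxing_R.chain_subset h hc hc.memm hT
  obtain ⟨hL1, hL2⟩ := isWindow_kept h H.isWaxing_L (Or.inl H.subL) hkeptL
    (N := leftNumbering n c (ncad r) a) (by rw [leftNumbering, if_neg hst])
  obtain ⟨hR1, hR2⟩ := isWindow_kept h H.isWaxing_R (Or.inr H.subR) hkeptR
    (N := rightNumbering n c (ncad r) a) (by rw [rightNumbering, if_neg hst])
  unfold tito
  rw [if_neg (by rw [hdown]; exact not_or.2 ⟨hfin, hst⟩)]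
  refine windowNotation_triple h.toIsPeriodicOrder hL1 hmid.1 hR1 (fun x y hx hy => ?_) (fun x y hx hy => ?_)
    (fun x y hx hy => ?_) fun x => ?_
  · exact H.LM x ((hL2 x).1 hx) y ((hmid.2 y).1 hy)
  · exact H.LR x ((hL2 x).1 hx) y ((hR2 y).1 hy)
  · exact H.MR x ((hmid.2 x).1 hx) y ((hR2 y).1 hy)
  · rw [hL2, hmid.2, hR2]
    exact H.cases x

end

theorem tito_ncad {n : ℕ} (hn : 0 < n) {c : Equiv.Perm ℤ} (hc : IsColoring n c)
    {r : ℤ → ℤ → Prop} (hr : IsSortable n c r) (a : ℤ) : tito n c a (ncad r) = r := by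
  have h := hr.avoidsPatterns hn hc
  rcases hr.cases with ⟨h1, h2⟩ | ⟨L, M, R, H⟩
  · exact tito_ncad_of_wax h h1 h2 a
  · exact tito_ncad_of_hasBlocks h H a

end AffineTITO

theorem mainTheorem3 (n : ℕ) (hn : 2 ≤ n) (c : Equiv.Perm ℤ)
    (hc : AffineTITO.IsCoxeterElement n c) :
    Set.BijOn AffineTITO.ncad (AffineTITO.sortableTITO n c) (AffineTITO.cyclicCNCAD n c) ∧
    (∀ a : ℤ,
      Set.MapsTo (AffineTITO.tito n c a) (AffineTITO.cyclicCNCAD n c)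
        (AffineTITO.sortableTITO n c) ∧
      Set.InvOn (AffineTITO.tito n c a) AffineTITO.ncad (AffineTITO.sortableTITO n c)
        (AffineTITO.cyclicCNCAD n c)) ∧
    (∀ a b : ℤ, ∀ A ∈ AffineTITO.cyclicCNCAD n c,
      AffineTITO.tito n c a A = AffineTITO.tito n c b A) := by
  have hn0 : 0 < n := by omega
  exact AffineTITO.bijOn_and_invOn_of_tito_ncad hn0 (hc.isColoring hn0) fun a r hr => AffineTITO.tito_ncad hn0 (hc.isColoring hn0) hr a
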